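/- Let $\mathbb T^2=\mathbb R^2/\mathbb Z^2$ and let $H^s=H^s(\mathbb T^2)$, $s\in\mathbb R$, be the real Sobolev spaces ($H^0=L^2$, $H^{-1}=(H^1)'$). Let $H$ be the space of divergence-free vector fields with zero average in $L^2(\mathbb T^2)^2$, let $V$ be the space of those in $H^1(\mathbb T^2)^2$, and let $P_\sigma$ be the orthogonal (Leray) projection of $L^2(\mathbb T^2)^2$ onto $H$. For vector fields, $H^s\cap V$ means $H^s(\mathbb T^2)^2\cap V$. Write $\nabla\times b=\partial_1b_2-\partial_2b_1$ and $\vec e_2=(0,1)^T$. Let $\nu,\mu,\kappa,g>0$, $\alpha\in\mathbb R$ and $\varepsilon>0$. Let $\zeta^\varepsilon:\mathbb R\to\mathbb R$ be a calming function, that is, a globally Lipschitz function such that, for some constant $M_\varepsilon$, $|\zeta^\varepsilon(x)|+|(\zeta^\varepsilon)'(x)|\le M_\varepsilon$ at every point $x$ where the derivative exists, and such that, for some $C>0$, $\gamma>0$, $\beta\ge1$, $|x-\zeta^\varepsilon(x)|\le C\varepsilon^\gamma|x|^\beta$ for all $x\in\mathbb R$. Consider the calmed magnetohydrodynamic Boussinesq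 system with Ohmic heating on $\mathbb T^2$, $$\begin{cases}\partial_tu-\nu\Delta u+(u\cdot\nabla)u+\nabla p=(b\cdot\nabla)b+g\theta\vec e_2,\\ \partial_tb-\mu\Delta b+(u\cdot\nabla)b=(b\cdot\nabla)u,\\ \partial_t\theta-\kappa\Delta\theta+(u\cdot\nabla)\theta=\alpha\mu\,\zeta^\varepsilon(|\nabla\times b|)\,|\nabla\times b|,\\ \nabla\cdot u=0=\nabla\cdot b,\end{cases}$$ where the first equation is understood after applying $P_\sigma$, i.e. as $$\partial_tu-\nu\Delta u+P_\sigma((u\cdot\nabla)u)=P_\sigma((b\cdot\nabla)b)+gP_\sigma(\theta\vec e_2).$$ Then for every $T>0$ and all initial data $u_0,b_0\in H^2\cap V$ and $\theta_0\in H^2$ there exists a strong solution $(u,b,\theta)$ of this system on $[0,T]$. This means that: 1. (semi-strong solution) $u,b\in C([0,T];V)\cap L^2(0,T;H^2\cap V)$ with $\partial_tu,\partial_tb\in L^2(0,T;H)$; $\theta\in C([0,T];L^2)\cap L^2(0,T;H^1)$ with $\partial_t\theta\in L^2(0,T;H^{-1})$; the three equations hold for almost every $t\in(0,T)$, as equalities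 in $L^2(0,T;H)$, $L^2(0,T;H)$ and $L^2(0,T;H^{-1})$ respectively; and $u(0)=u_0$, $b(0)=b_0$, $\theta(0)=\theta_0$, where the values at $t=0$ are those of the continuous curves $u,b$ in $V$ and $\theta$ in $L^2$; 2. moreover $u,b\in C([0,T];H^2\cap V)\cap L^2(0,T;H^3\cap V)$ and $\theta\in L^\infty(0,T;H^2)\cap L^2(0,T;H^3)$, so that the initial data $u_0,b_0$ are also attained in $C([0,T];H^2\cap V)$. -/

import Mathlib

open MeasureTheory Set Filter Topology
open scoped ContDiff ENNReal NNReal ComplexConjugate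

noncomputable section

namespace CalmedMHD

/-! ### The torus, real `L²` functions and Fourier coefficients -/

/-- The two-dimensional torus `ℝ² / ℤ²`. The coordinate `x₁` has index `0`, and `x₂` index `1`. -/
abbrev Torus : Type := UnitAddTorus (Fin 2)

/-- Lebesgue measure on the torus (total mass one). -/
abbrev torusMeasure : Measure Torus :=
  Measure.pi fun _ : Fin 2 => (AddCircle.haarAddCircle : Measure UnitAddCircle)

/-- The real-valued square-integrable functions on the torus. -/
abbrev L2 : Type := Lp ℝ 2 torusMeasure

/-- A periodic distribution, given by the family of its Fourier coefficients. -/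
abbrev FSeries : Type := (Fin 2 → ℤ) → ℂ

/-- The Fourier coefficients `∫ F(x) exp(-2πi k·x) dx` of a real function on the torus. -/
def fnCoeff (F : Torus → ℝ) : FSeries :=
  fun k => UnitAddTorus.mFourierCoeff (fun x => ((F x : ℝ) : ℂ)) k

/-- The Fourier coefficients of an `L²` function. -/
def coeff (f : L2) : FSeries := fnCoeff (f : Torus → ℝ)

/-- The Fourier coefficients of the components of a vector field. -/
def vcoeff (v : Fin 2 → L2) : Fin 2 → FSeries := fun i => coeff (v i)

/-- The symbol `|2πk|²` of `-Δ`. -/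
def lapSymbol (k : Fin 2 → ℤ) : ℝ := (2 * Real.pi) ^ 2 * ∑ j, (k j : ℝ) ^ 2

/-! ### Sobolev spaces -/

/-- The square of the `H^s` norm, `∑ₖ (1 + |2πk|²)^s |c k|²`. -/
def sobNormSq (s : ℝ) (c : FSeries) : ℝ≥0∞ :=
  ∑' k, ENNReal.ofReal ((1 + lapSymbol k) ^ s) * ‖c k‖ₑ ^ 2

/-- The distribution is real-valued. -/
def IsRealValued (c : FSeries) : Prop := ∀ k, c (-k) = conj (c k)

/-- Membership in the real Sobolev space `H^s` of the torus, for any real `s`; the space `H^{-1}`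
is the dual of `H^1`, and `H^0 = L²`. -/
def MemHs (s : ℝ) (c : FSeries) : Prop := IsRealValued c ∧ sobNormSq s c < ⊤

/-- Divergence-free vector fields with zero average. -/
def IsSolenoidal (v : Fin 2 → FSeries) : Prop :=
  (∀ i, v i 0 = 0) ∧ ∀ k, ∑ j, (2 * Real.pi * Complex.I * (k j : ℂ)) * v j k = 0

/-- `H^s` vector fields that are divergence-free with zero average: the space `H` for `s = 0`,
`V` for `s = 1`, and `H^s ∩ V` for `s ≥ 1`. -/
def MemVs (s : ℝ) (v : Fin 2 → FSeries) : Prop := (∀ i, MemHs s (v i)) ∧ IsSolenoidal v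

/-! ### Spaces of functions of time -/

/-- Measurability of a curve of distributions on `(0, T)`. As `H^s` is a separable Hilbert space,
weak measurability is the same as strong measurability. -/
def CurveMeasurable (T : ℝ) (c : ℝ → FSeries) : Prop :=
  ∀ k, AEStronglyMeasurable (fun t => c t k) (volume.restrict (Ioo 0 T))

/-- `L²(0, T; H^s)`. -/
def MemL2Hs (T s : ℝ) (c : ℝ → FSeries) : Prop :=
  CurveMeasurable T c ∧ (∀ᵐ t ∂volume.restrict (Ioo 0 T), MemHs s (c t)) ∧
    ∫⁻ t in Ioo 0 T, sobNormSq s (c t) < ⊤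

/-- `L^∞(0, T; H^s)`. -/
def MemLinftyHs (T s : ℝ) (c : ℝ → FSeries) : Prop :=
  CurveMeasurable T c ∧ (∀ᵐ t ∂volume.restrict (Ioo 0 T), MemHs s (c t)) ∧
    ∃ C : ℝ≥0, ∀ᵐ t ∂volume.restrict (Ioo 0 T), sobNormSq s (c t) ≤ C

/-- `C([0, T]; H^s)`. -/
def MemCHs (T s : ℝ) (c : ℝ → FSeries) : Prop :=
  (∀ t ∈ Icc 0 T, MemHs s (c t)) ∧
    ∀ t₀ ∈ Icc 0 T, Tendsto (fun t => sobNormSq s (c t - c t₀)) (𝓝[Icc 0 T] t₀) (𝓝 0)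

/-- `L²(0, T; H)` for `s = 0`, and `L²(0, T; H^s ∩ V)` for `s ≥ 1`. -/
def MemL2Vs (T s : ℝ) (c : ℝ → Fin 2 → FSeries) : Prop :=
  (∀ i, MemL2Hs T s fun t => c t i) ∧ ∀ᵐ t ∂volume.restrict (Ioo 0 T), IsSolenoidal (c t)

/-- `C([0, T]; H^s ∩ V)` for `s ≥ 1`. -/
def MemCVs (T s : ℝ) (c : ℝ → Fin 2 → FSeries) : Prop :=
  (∀ i, MemCHs T s fun t => c t i) ∧ ∀ t ∈ Icc 0 T, IsSolenoidal (c t)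

/-- `c'` is the distributional time derivative of `c` on `(0, T)`. -/
def HasWeakTimeDeriv (T : ℝ) (c c' : ℝ → FSeries) : Prop :=
  ∀ φ : ℝ → ℝ, ContDiff ℝ ∞ φ → HasCompactSupport φ → tsupport φ ⊆ Ioo 0 T →
    ∀ k, ∫ t in Ioo 0 T, ((deriv φ t : ℝ) : ℂ) * c t k = -∫ t in Ioo 0 T, ((φ t : ℝ) : ℂ) * c' t k

/-! ### Spatial derivatives and the nonlinear terms -/

/-- `g` is the weak partial derivative `∂ⱼ f`, tested against the exponentials. -/
def HasWeakPDeriv (j : Fin 2) (f g : L2) : Prop :=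
  ∀ k, coeff g k = (2 * Real.pi * Complex.I * (k j : ℂ)) * coeff f k

open Classical in
/-- The weak partial derivative `∂ⱼ f ∈ L²`; it exists for `f ∈ H^1` (and is set to `0` when
there is none). -/
def pderiv (j : Fin 2) (f : L2) : L2 :=
  if h : ∃ g, HasWeakPDeriv j f g then h.choose else 0

/-- The term `(v · ∇) f`. -/
def advect (v : Fin 2 → L2) (f : L2) : Torus → ℝ :=
  fun x => ∑ j, v j x * pderiv j f x

/-- The term `(v · ∇) w` for a vector field `w`, through its Fourier coefficients. -/
def vadvect (v w : Fin 2 → L2) : Fin 2 → FSeries :=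
  fun i => fnCoeff (advect v (w i))

/-- The scalar curl `∇ × b = ∂₁ b₂ - ∂₂ b₁`. -/
def curl (b : Fin 2 → L2) : Torus → ℝ :=
  fun x => pderiv 0 (b 1) x - pderiv 1 (b 0) x

/-- The calmed Ohmic heating term `ζ(|∇ × b|) |∇ × b|`. -/
def ohmic (ζ : ℝ → ℝ) (b : Fin 2 → L2) : Torus → ℝ :=
  fun x => ζ |curl b x| * |curl b x|

/-- The Leray projection onto divergence-free fields with zero average. -/
def leray (v : Fin 2 → FSeries) : Fin 2 → FSeries :=
  fun i k =>
    if k = 0 then 0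
    else v i k - (k i : ℂ) * (∑ j, (k j : ℂ) * v j k) / (∑ j, (k j : ℂ) ^ 2)

/-- The vector field `θ e₂`. -/
def buoyancy (θ : L2) : Fin 2 → FSeries := ![0, coeff θ]

/-! ### Calming functions and solutions -/

/-- `ζ` is a calming function with parameter `ε`. The derivative of a Lipschitz function exists
almost everywhere, and the bound is asked for wherever it exists. -/
structure IsCalming (ε : ℝ) (ζ : ℝ → ℝ) : Prop where
  lipschitz : ∃ L : ℝ≥0, LipschitzWith L ζ
  bounded : ∃ M : ℝ, ∀ x, DifferentiableAt ℝ ζ x → |ζ x| + |deriv ζ x| ≤ M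
  approx : ∃ C γ β : ℝ, 0 < C ∧ 0 < γ ∧ 1 ≤ β ∧ ∀ x, |x - ζ x| ≤ C * ε ^ γ * |x| ^ β

/-- Semi-strong solutions on `[0, T]` of the calmed system, with initial data `(u₀, b₀, θ₀)`.
The three equations hold in `L²(0, T; H)`, `L²(0, T; H)` and `L²(0, T; H^{-1})`; the pressure is
eliminated by the Leray projection. -/
structure IsSemiStrongSolution (ν μ κ g α : ℝ) (ζ : ℝ → ℝ) (T : ℝ)
    (u₀ b₀ : Fin 2 → L2) (θ₀ : L2) (u b : ℝ → Fin 2 → L2) (θ : ℝ → L2) : Prop where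
  u_cont : MemCVs T 1 fun t => vcoeff (u t)
  b_cont : MemCVs T 1 fun t => vcoeff (b t)
  θ_cont : MemCHs T 0 fun t => coeff (θ t)
  u_L2 : MemL2Vs T 2 fun t => vcoeff (u t)
  b_L2 : MemL2Vs T 2 fun t => vcoeff (b t)
  θ_L2 : MemL2Hs T 1 fun t => coeff (θ t)
  u_init : u 0 = u₀
  b_init : b 0 = b₀
  θ_init : θ 0 = θ₀
  u_eq : ∃ u' : ℝ → Fin 2 → FSeries, MemL2Vs T 0 u' ∧
    (∀ i, HasWeakTimeDeriv T (fun t => vcoeff (u t) i) fun t => u' t i) ∧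
    ∀ᵐ t ∂volume.restrict (Ioo 0 T), ∀ i k,
      u' t i k + ν * lapSymbol k * vcoeff (u t) i k + leray (vadvect (u t) (u t)) i k
        = leray (vadvect (b t) (b t)) i k + g * leray (buoyancy (θ t)) i k
  b_eq : ∃ b' : ℝ → Fin 2 → FSeries, MemL2Vs T 0 b' ∧
    (∀ i, HasWeakTimeDeriv T (fun t => vcoeff (b t) i) fun t => b' t i) ∧
    ∀ᵐ t ∂volume.restrict (Ioo 0 T), ∀ i k,
      b' t i k + μ * lapSymbol k * vcoeff (b t) i k + vadvect (u t) (b t) i k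
        = vadvect (b t) (u t) i k
  θ_eq : ∃ θ' : ℝ → FSeries, MemL2Hs T (-1) θ' ∧
    HasWeakTimeDeriv T (fun t => coeff (θ t)) θ' ∧
    ∀ᵐ t ∂volume.restrict (Ioo 0 T), ∀ k,
      θ' t k + κ * lapSymbol k * coeff (θ t) k + fnCoeff (advect (u t) (θ t)) k
        = α * μ * fnCoeff (ohmic ζ (b t)) k

/-- Strong solutions on `[0, T]` of the calmed system. -/
structure IsStrongSolution (ν μ κ g α : ℝ) (ζ : ℝ → ℝ) (T : ℝ)
    (u₀ b₀ : Fin 2 → L2) (θ₀ : L2) (u b : ℝ → Fin 2 → L2) (θ : ℝ → L2) : Prop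
    extends IsSemiStrongSolution ν μ κ g α ζ T u₀ b₀ θ₀ u b θ where
  u_cont_H2 : MemCVs T 2 fun t => vcoeff (u t)
  b_cont_H2 : MemCVs T 2 fun t => vcoeff (b t)
  u_L2_H3 : MemL2Vs T 3 fun t => vcoeff (u t)
  b_L2_H3 : MemL2Vs T 3 fun t => vcoeff (b t)
  θ_Linfty_H2 : MemLinftyHs T 2 fun t => coeff (θ t)
  θ_L2_H3 : MemL2Hs T 3 fun t => coeff (θ t)

/-! ### An `L²` function is determined by its Fourier coefficients -/

theorem coeff_injective : Function.Injective coeff := by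
  intro f f' h
  have key : ∀ f : L2, ∀ k, (UnitAddTorus.mFourierBasis (d := Fin 2)).repr
      (Complex.ofRealCLM.compLp f : Lp ℂ 2 torusMeasure) k = coeff f k := by
    intro f k
    rw [UnitAddTorus.mFourierBasis_repr]
    refine integral_congr_ae ?_
    have h1 : ((Complex.ofRealCLM.compLp f : Lp ℂ 2 torusMeasure) : Torus → ℂ)
        =ᵐ[torusMeasure] fun x => ((f x : ℝ) : ℂ) := Complex.ofRealCLM.coeFn_compLp f
    filter_upwards [h1] with x hx
    rw [hx]
  have h2 : (Complex.ofRealCLM.compLp f : Lp ℂ 2 torusMeasure) = Complex.ofRealCLM.compLp f' := by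
    apply (UnitAddTorus.mFourierBasis (d := Fin 2)).repr.injective
    ext k
    rw [key, key, h]
  apply Lp.ext
  have h1 := Complex.ofRealCLM.coeFn_compLp f
  have h3 := Complex.ofRealCLM.coeFn_compLp f'
  rw [h2] at h1
  filter_upwards [h1, h3] with x hx hx'
  have := hx.symm.trans hx'
  simpa using this

theorem pderiv_eq {j : Fin 2} {f g : L2} (h : HasWeakPDeriv j f g) : pderiv j f = g := by
  have hex : ∃ g, HasWeakPDeriv j f g := ⟨g, h⟩
  rw [pderiv, dif_pos hex]
  exact coeff_injective (funext fun k => (hex.choose_spec k).trans (h k).symm)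

end CalmedMHD

end

open CalmedMHD

/-! The argument runs entirely on Fourier coefficients: Galerkin approximation, bounds uniform in
the number of modes, compactness, and then parabolic regularity of the limit, mode by mode.

Energy. Tested against the solution, the transport terms vanish, and the Lorentz force cancels the
stretching term of the induction equation (`sum_conj_mul_force`). Only buoyancy and heating remain.
Calming is what makes the heating harmless: since ζ is bounded, the heating is at most linear in the
current ∇ × b in L², instead of quadratic. Young's inequality then pays for it with half of the
magnetic dissipation and a multiple of the squared L² norm of θ (`re_sum_force_le`). This closes the
energy estimate, makes the Galerkin systems globally solvable (`exists_galerkin`) and bounds θ in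
L^∞(L²) ∩ L²(H¹).

Higher norms of velocity and magnetic field. The temperature enters the velocity equation only
linearly, so the bounds on θ just obtained suffice here. The quadratic terms are convolutions,
estimated by Young's inequality with one factor in ℓ¹. In two dimensions Agmon's inequality
`sq_sum_le_agmon` bounds the ℓ¹ norm with a free parameter ρ. Choosing ρ in terms of the current H¹
norm makes the top-order part absorbable by the dissipation, and what is left fits Grönwall's
inequality with an integrable rate: at level H¹ the rate is integrable by the energy dissipation, at
level H² by the dissipation gained at level H¹ (`exists_uniform_bound`).

Limit. Each coefficient is Lipschitz in time uniformly along the approximations, so a subsequence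
converges for all modes and all times (`exists_subseq_tendsto`). The H² bounds turn this into strong
L² convergence, enough for the quadratic terms. For the heating, the profile r ↦ ζ(|r|)|r| has a
Lipschitz estimate whose constant depends on one of the two arguments only. That argument is taken
to be the current of the limit, which is bounded at almost every time because the limit lies in
L²(H³) (`tendsto_heatCoeff`).

Regularity. The energy inequality of the scalar equation c' = -κ l c + h passes to the limit in each
mode (`IsModeSolution.of_tendsto`). Summed with weights, it says that data in H^s and forcing in
L²(H^{s-1}) give C(H^s) ∩ L²(H^{s+1}) (`tsum_modeData`, `tendsto_sobNormSq_of_mode`). This is used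
with s = 2 for u and b, and for θ first with s = 1 and then with s = 2. The last step needs the
heating in L²(H¹). As ζ is only Lipschitz, its H¹ norm is estimated by difference quotients rather
than by a chain rule (`tsum_sq_deriv_le_of_translate`).

Finally the coefficients are turned back into L² functions, and the Fourier series of the products
are identified with the convolutions used throughout (`fnCoeff_advect`, `fnCoeff_ohmic`). -/

noncomputable section

namespace CalmedMHD

/-! ### Frequencies -/

theorem lapSymbol_nonneg (k : Fin 2 → ℤ) : 0 ≤ lapSymbol k := by
  unfold lapSymbol; positivity

theorem lapSymbol_neg (k : Fin 2 → ℤ) : lapSymbol (-k) = lapSymbol k := by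
  simp [lapSymbol]

/-- The length `|2πk|`. -/
def freq (k : Fin 2 → ℤ) : ℝ := √(lapSymbol k)

theorem freq_nonneg (k : Fin 2 → ℤ) : 0 ≤ freq k := Real.sqrt_nonneg _

theorem freq_sq (k : Fin 2 → ℤ) : freq k ^ 2 = lapSymbol k := Real.sq_sqrt (lapSymbol_nonneg k)

/-- Writing the length as a Euclidean norm gives access to the triangle inequality. -/
theorem freq_eq_norm (k : Fin 2 → ℤ) :
    freq k = ‖WithLp.toLp 2 (fun j => 2 * Real.pi * (k j : ℝ))‖ := by
  rw [EuclideanSpace.norm_eq, freq, lapSymbol, Finset.mul_sum]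
  congr 1
  refine Finset.sum_congr rfl fun j _ => ?_
  rw [Real.norm_eq_abs, sq_abs]
  ring

theorem freq_add_le (k l : Fin 2 → ℤ) : freq (k + l) ≤ freq k + freq l := by
  simp only [freq_eq_norm]
  refine le_trans (le_of_eq ?_) (norm_add_le _ _)
  congr 1
  ext j
  simp [mul_add]

theorem freq_le_add_sub (k l : Fin 2 → ℤ) : freq k ≤ freq l + freq (k - l) := by
  simpa using freq_add_le l (k - l)

theorem two_pi_abs_le_freq (k : Fin 2 → ℤ) (j : Fin 2) : 2 * Real.pi * |(k j : ℝ)| ≤ freq k := by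
  refine Real.le_sqrt_of_sq_le ?_
  rw [mul_pow, sq_abs, lapSymbol]
  exact mul_le_mul_of_nonneg_left
    (Finset.single_le_sum (f := fun j => (k j : ℝ) ^ 2) (fun i _ => sq_nonneg _)
      (Finset.mem_univ j)) (by positivity)

/-! ### Sums over the lattice -/

/-- With q = √r ≥ 1 one has (q + n)(q + n + 1) ≤ 4(r + n²), so the terms with n ≥ 0 are dominated by
a telescoping series of sum 4/q. The negative half costs the same again. -/
theorem tsum_int_inv_le {r : ℝ} (hr : 1 ≤ r) :
    ∑' m : ℤ, ENNReal.ofReal (1 / (r + (m : ℝ) ^ 2)) ≤ ENNReal.ofReal (8 / √r) := by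
  set q := √r with hq
  have hq1 : 1 ≤ q := Real.one_le_sqrt.2 hr
  have hqr : q ^ 2 = r := Real.sq_sqrt (by linarith)
  have key : ∀ n : ℕ, 1 / (r + (n : ℝ) ^ 2) ≤ 4 * (1 / (q + n) - 1 / (q + (n + 1 : ℕ))) := by
    intro n
    have hn : (0 : ℝ) ≤ n := n.cast_nonneg
    have h1 : 4 * (1 / (q + n) - 1 / (q + (n + 1 : ℕ))) = 4 / ((q + n) * (q + n + 1)) := by
      push_cast
      field_simp
      ring
    rw [h1, div_le_div_iff₀ (by positivity) (by positivity)]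
    nlinarith [sq_nonneg (q - n), mul_nonneg hn hn]
  have half : ∑' n : ℕ, ENNReal.ofReal (1 / (r + (n : ℝ) ^ 2)) ≤ ENNReal.ofReal (4 / q) := by
    refine ENNReal.tsum_le_of_sum_range_le fun N => ?_
    rw [← ENNReal.ofReal_sum_of_nonneg fun i _ => by positivity]
    refine ENNReal.ofReal_le_ofReal ?_
    refine (Finset.sum_le_sum fun i _ => key i).trans ?_
    rw [← Finset.mul_sum, Finset.sum_range_sub' (fun n : ℕ => 1 / (q + n))]
    have : 0 ≤ 1 / (q + N) := by positivity
    have h2 : 4 / q = 4 * (1 / q) := by ring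
    rw [h2]
    push_cast
    rw [add_zero]
    linarith
  rw [tsum_of_nat_of_neg_add_one ENNReal.summable ENNReal.summable]
  have h8 : (8 : ℝ) / q = 4 / q + 4 / q := by ring
  rw [h8, ENNReal.ofReal_add (by positivity) (by positivity)]
  -- The negative integers are indexed as -(n + 1), so their series is dominated by the nonnegative
  -- half.
  refine add_le_add (by simpa using half) (le_trans (ENNReal.tsum_le_tsum fun n => ?_) half)
  refine ENNReal.ofReal_le_ofReal (one_div_le_one_div_of_le (by positivity) ?_)
  push_cast
  have hn : (0 : ℝ) ≤ n := n.cast_nonneg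
  nlinarith

/-- Both factors of the square dominate a one-dimensional one, (r + |2πk|²)² ≥ (r + k₀²)(r + k₁²),
so the lattice sum factors and costs (8/√r)². The decay 1/r in the parameter is what makes Agmon's
inequality work. -/
theorem tsum_lattice_inv_le {r : ℝ} (hr : 1 ≤ r) :
    ∑' k : Fin 2 → ℤ, ENNReal.ofReal (1 / (r + lapSymbol k) ^ 2) ≤ ENNReal.ofReal (64 / r) := by
  have h1 : ∀ k : Fin 2 → ℤ, ENNReal.ofReal (1 / (r + lapSymbol k) ^ 2) ≤
      ENNReal.ofReal (1 / (r + (k 0 : ℝ) ^ 2)) * ENNReal.ofReal (1 / (r + (k 1 : ℝ) ^ 2)) := by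
    intro k
    rw [← ENNReal.ofReal_mul (by positivity), one_div_mul_one_div_rev]
    refine ENNReal.ofReal_le_ofReal ?_
    refine one_div_le_one_div_of_le (by positivity) ?_
    have hpi : (1 : ℝ) ≤ (2 * Real.pi) ^ 2 := by nlinarith [Real.pi_gt_three]
    have h2 : ∀ j, (k j : ℝ) ^ 2 ≤ lapSymbol k := by
      intro j
      have h4 : (k j : ℝ) ^ 2 ≤ ∑ j, (k j : ℝ) ^ 2 :=
        Finset.single_le_sum (f := fun j => (k j : ℝ) ^ 2) (fun i _ => sq_nonneg _)
          (Finset.mem_univ j)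
      have h3 : (0 : ℝ) ≤ ∑ j, (k j : ℝ) ^ 2 := by positivity
      unfold lapSymbol
      nlinarith
    have := mul_le_mul (add_le_add_right (h2 1) r) (add_le_add_right (h2 0) r)
      (by positivity) (by have := lapSymbol_nonneg k; positivity)
    nlinarith
  refine (ENNReal.tsum_le_tsum h1).trans ?_
  rw [← (finTwoArrowEquiv ℤ).symm.tsum_eq]
  have h2 : ∀ p : ℤ × ℤ, ENNReal.ofReal (1 / (r + (((finTwoArrowEquiv ℤ).symm p) 0 : ℝ) ^ 2)) *
      ENNReal.ofReal (1 / (r + (((finTwoArrowEquiv ℤ).symm p) 1 : ℝ) ^ 2)) =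
      ENNReal.ofReal (1 / (r + (p.1 : ℝ) ^ 2)) * ENNReal.ofReal (1 / (r + (p.2 : ℝ) ^ 2)) := by
    intro p; simp [finTwoArrowEquiv]
  simp_rw [h2]
  rw [ENNReal.tsum_prod (f := fun a b : ℤ => ENNReal.ofReal (1 / (r + (a : ℝ) ^ 2)) *
    ENNReal.ofReal (1 / (r + (b : ℝ) ^ 2)))]
  simp_rw [ENNReal.tsum_mul_left, ENNReal.tsum_mul_right]
  refine (mul_le_mul' (tsum_int_inv_le hr) (tsum_int_inv_le hr)).trans ?_
  rw [← ENNReal.ofReal_mul (by positivity)]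
  refine ENNReal.ofReal_le_ofReal (le_of_eq ?_)
  rw [div_mul_div_comm, Real.mul_self_sqrt (by linarith)]
  norm_num

theorem sum_lattice_inv_le {r : ℝ} (hr : 1 ≤ r) (B : Finset (Fin 2 → ℤ)) :
    ∑ k ∈ B, 1 / (r + lapSymbol k) ^ 2 ≤ 64 / r := by
  have h := (ENNReal.sum_le_tsum B).trans (tsum_lattice_inv_le hr)
  rw [← ENNReal.ofReal_sum_of_nonneg fun i _ => by positivity] at h
  exact (ENNReal.ofReal_le_ofReal_iff (by positivity)).1 h

/-- Agmon's inequality in the Wiener algebra, for finite sums, with a free parameter. -/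
theorem sq_sum_le_agmon {r : ℝ} (hr : 1 ≤ r) (B : Finset (Fin 2 → ℤ)) (a : (Fin 2 → ℤ) → ℝ) :
    (∑ k ∈ B, a k) ^ 2 ≤
      128 * (r * ∑ k ∈ B, a k ^ 2 + (∑ k ∈ B, lapSymbol k ^ 2 * a k ^ 2) / r) := by
  have hr0 : 0 < r := by linarith
  have hpos : ∀ k, 0 < r + lapSymbol k := fun k => by
    have := lapSymbol_nonneg k; linarith
  -- Cauchy–Schwarz against the weight (r + |2πk|²)⁻¹, whose squares sum to at most 64/r.
  have h1 := Finset.sum_mul_sq_le_sq_mul_sq B (fun k => 1 / (r + lapSymbol k))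
    (fun k => (r + lapSymbol k) * a k)
  have h2 : ∀ k, 1 / (r + lapSymbol k) * ((r + lapSymbol k) * a k) = a k := by
    intro k; have := (hpos k).ne'; field_simp
  simp_rw [h2, one_div_pow] at h1
  refine h1.trans ((mul_le_mul_of_nonneg_right (sum_lattice_inv_le hr B)
    (Finset.sum_nonneg fun i _ => sq_nonneg _)).trans ?_)
  have h3 : ∑ k ∈ B, ((r + lapSymbol k) * a k) ^ 2 ≤
      2 * r ^ 2 * ∑ k ∈ B, a k ^ 2 + 2 * ∑ k ∈ B, lapSymbol k ^ 2 * a k ^ 2 := by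
    rw [Finset.mul_sum, Finset.mul_sum, ← Finset.sum_add_distrib]
    refine Finset.sum_le_sum fun k _ => ?_
    nlinarith [sq_nonneg ((r - lapSymbol k) * a k)]
  refine (mul_le_mul_of_nonneg_left h3 (by positivity)).trans (le_of_eq ?_)
  field_simp
  ring

/-- Young's inequality for convolutions, for finite sums. -/
theorem sum_sq_conv_le (B : Finset (Fin 2 → ℤ)) {a c : (Fin 2 → ℤ) → ℝ} (ha : ∀ k, 0 ≤ a k)
    (hc : ∀ k ∉ B, c k = 0) :
    ∑ k ∈ B, (∑ l ∈ B, a l * c (k - l)) ^ 2 ≤ (∑ l ∈ B, a l) ^ 2 * ∑ k ∈ B, c k ^ 2 := by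
  -- Cauchy–Schwarz for the measure with weights a. Summing in k afterwards leaves a translate of c
  -- for each l.
  have h1 : ∀ k ∈ B, (∑ l ∈ B, a l * c (k - l)) ^ 2 ≤
      (∑ l ∈ B, a l) * ∑ l ∈ B, a l * c (k - l) ^ 2 := by
    intro k _
    refine Finset.sum_sq_le_sum_mul_sum_of_sq_le_mul B (fun l _ => ha l)
      (fun l _ => mul_nonneg (ha l) (sq_nonneg _)) fun l _ => le_of_eq (by ring)
  refine (Finset.sum_le_sum h1).trans ?_
  rw [← Finset.mul_sum, Finset.sum_comm, sq, mul_assoc]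
  refine mul_le_mul_of_nonneg_left ?_ (Finset.sum_nonneg fun l _ => ha l)
  rw [Finset.sum_mul]
  refine Finset.sum_le_sum fun l _ => ?_
  rw [← Finset.mul_sum]
  refine mul_le_mul_of_nonneg_left ?_ (ha l)
  have h2 : ∑ k ∈ B, c (k - l) ^ 2 = ∑ m ∈ B.image (· - l), c m ^ 2 := by
    rw [Finset.sum_image fun x _ y _ h => sub_left_injective h]
  rw [h2, ← Finset.sum_filter_add_sum_filter_not (B.image (· - l)) (· ∈ B)]
  have h3 : ∑ m ∈ (B.image (· - l)).filter (· ∉ B), c m ^ 2 = 0 :=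
    Finset.sum_eq_zero fun m hm => by rw [hc m (Finset.mem_filter.1 hm).2]; simp
  rw [h3, add_zero]
  exact Finset.sum_le_sum_of_subset_of_nonneg (fun m hm => (Finset.mem_filter.1 hm).2)
    fun m _ _ => sq_nonneg _

/-! ### Extended nonnegative sums -/

/-- Hölder's inequality with exponents 2 and 2 for the counting measure. -/
theorem ennreal_tsum_mul_sq_le {ι : Type*} (f g : ι → ℝ≥0∞) :
    (∑' i, f i * g i) ^ 2 ≤ (∑' i, f i ^ 2) * ∑' i, g i ^ 2 := by
  let _ : MeasurableSpace ι := ⊤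
  have h := ENNReal.lintegral_mul_le_Lp_mul_Lq (Measure.count : Measure ι)
    (Real.HolderConjugate.two_two) (f := f) (g := g)
    (Measurable.of_discrete).aemeasurable (Measurable.of_discrete).aemeasurable
  simp only [lintegral_count, Pi.mul_apply, ENNReal.rpow_two] at h
  refine (pow_le_pow_left₀ zero_le h 2).trans (le_of_eq ?_)
  rw [mul_pow]
  simp only [← ENNReal.rpow_two, ← ENNReal.rpow_mul]
  norm_num

/-- Young's inequality for convolutions. -/
theorem tsum_sq_conv_le (a c : (Fin 2 → ℤ) → ℝ≥0∞) :
    ∑' k, (∑' l, a l * c (k - l)) ^ 2 ≤ (∑' l, a l) ^ 2 * ∑' k, c k ^ 2 := by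
  have h1 : ∀ k, (∑' l, a l * c (k - l)) ^ 2 ≤ (∑' l, a l) * ∑' l, a l * c (k - l) ^ 2 := by
    intro k
    -- One square root of the weight goes to each factor of Cauchy–Schwarz.
    have h := ennreal_tsum_mul_sq_le (fun l => a l ^ (1 / 2 : ℝ))
      (fun l => a l ^ (1 / 2 : ℝ) * c (k - l))
    have h2 : ∀ x : ℝ≥0∞, x ^ (1 / 2 : ℝ) * x ^ (1 / 2 : ℝ) = x := by
      intro x
      rw [← ENNReal.rpow_add_of_nonneg _ _ (by norm_num) (by norm_num)]
      norm_num
    simpa only [mul_pow, sq (_ ^ (1 / 2 : ℝ)), h2, ← mul_assoc] using h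
  refine (ENNReal.tsum_le_tsum h1).trans (le_of_eq ?_)
  rw [ENNReal.tsum_mul_left, ENNReal.tsum_comm, sq, mul_assoc]
  congr 1
  simp_rw [ENNReal.tsum_mul_left]
  have h2 : ∀ l, ∑' k, c (k - l) ^ 2 = ∑' k, c k ^ 2 := fun l =>
    (Equiv.subRight l).tsum_eq fun k => c k ^ 2
  simp_rw [h2, ENNReal.tsum_mul_right]

/-- In dimension two the squares of (1 + |2πk|²)⁻¹ are summable, so H² embeds into the algebra of
absolutely convergent Fourier series. The constant is the lattice sum at r = 1. -/
theorem sq_tsum_le_sobNormSq (c : FSeries) : (∑' k, ‖c k‖ₑ) ^ 2 ≤ 64 * sobNormSq 2 c := by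
  have hpos : ∀ k, 0 < 1 + lapSymbol k := fun k => by
    have := lapSymbol_nonneg k; linarith
  have h := ennreal_tsum_mul_sq_le (fun k => ENNReal.ofReal (1 / (1 + lapSymbol k)))
    (fun k => ENNReal.ofReal (1 + lapSymbol k) * ‖c k‖ₑ)
  have h2 : ∀ k, ENNReal.ofReal (1 / (1 + lapSymbol k)) *
      (ENNReal.ofReal (1 + lapSymbol k) * ‖c k‖ₑ) = ‖c k‖ₑ := by
    intro k
    rw [← mul_assoc, ← ENNReal.ofReal_mul (by have := hpos k; positivity),
      one_div_mul_cancel (hpos k).ne', ENNReal.ofReal_one, one_mul]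
  simp_rw [h2] at h
  refine h.trans (mul_le_mul' ?_ (le_of_eq ?_))
  · refine le_trans (le_of_eq (tsum_congr fun k => ?_)) ((tsum_lattice_inv_le le_rfl).trans ?_)
    · rw [← ENNReal.ofReal_pow (by have := hpos k; positivity), one_div_pow]
    · norm_num
  · unfold sobNormSq
    refine tsum_congr fun k => ?_
    rw [mul_pow, ← ENNReal.ofReal_pow (hpos k).le, Real.rpow_two]

end CalmedMHD

end

noncomputable section

namespace CalmedMHD

/-! ### Real `L²` functions and their Fourier coefficients -/

theorem fnCoeff_congr_ae {F G : Torus → ℝ} (h : F =ᵐ[torusMeasure] G) : fnCoeff F = fnCoeff G := by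
  funext k
  refine integral_congr_ae ?_
  filter_upwards [h] with x hx
  rw [hx]

theorem fnCoeff_neg (F : Torus → ℝ) (k : Fin 2 → ℤ) : fnCoeff F (-k) = conj (fnCoeff F k) := by
  unfold fnCoeff UnitAddTorus.mFourierCoeff
  rw [← integral_conj]
  refine integral_congr_ae (ae_of_all _ fun x => ?_)
  simp only [smul_eq_mul, map_mul, Complex.conj_ofReal, UnitAddTorus.mFourier_neg,
    Complex.conj_conj]

theorem isRealValued_fnCoeff (F : Torus → ℝ) : IsRealValued (fnCoeff F) := fnCoeff_neg F

theorem memLp_ofReal {F : Torus → ℝ} (hF : MemLp F 2 torusMeasure) :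
    MemLp (fun x => ((F x : ℝ) : ℂ)) 2 torusMeasure :=
  Complex.ofRealCLM.comp_memLp' hF

theorem fnCoeff_eq_toLp {F : Torus → ℝ} (hF : MemLp F 2 torusMeasure) (k : Fin 2 → ℤ) :
    fnCoeff F k = UnitAddTorus.mFourierCoeff ((memLp_ofReal hF).toLp : Lp ℂ 2 torusMeasure) k := by
  refine integral_congr_ae ?_
  filter_upwards [(memLp_ofReal hF).coeFn_toLp] with x hx
  rw [hx]

theorem fnCoeff_coeFn (f : L2) : fnCoeff f = coeff f := rfl

theorem coeff_toLp {F : Torus → ℝ} (hF : MemLp F 2 torusMeasure) :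
    coeff (hF.toLp F) = fnCoeff F :=
  fnCoeff_congr_ae hF.coeFn_toLp

/-- Parseval's identity for real functions. -/
theorem tsum_sq_fnCoeff {F : Torus → ℝ} (hF : MemLp F 2 torusMeasure) :
    ∑' k, ‖fnCoeff F k‖ₑ ^ 2 = ∫⁻ x, ‖F x‖ₑ ^ 2 ∂torusMeasure := by
  have h := UnitAddTorus.hasSum_sq_mFourierCoeff (d := Fin 2) ((memLp_ofReal hF).toLp)
  simp_rw [← fnCoeff_eq_toLp hF] at h
  have h1 : ∫ t, ‖((memLp_ofReal hF).toLp : Lp ℂ 2 torusMeasure) t‖ ^ 2 ∂torusMeasure =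
      ∫ t, ‖F t‖ ^ 2 ∂torusMeasure := by
    refine integral_congr_ae ?_
    filter_upwards [(memLp_ofReal hF).coeFn_toLp] with x hx
    rw [hx, Complex.norm_real]
  have h2 : HasSum (fun k => ‖fnCoeff F k‖ ^ 2) (∫ t, ‖F t‖ ^ 2 ∂torusMeasure) := h1 ▸ h
  have h3 : ∀ x : ℝ≥0∞, x ^ 2 = x ^ (2 : ℝ) := fun x => (ENNReal.rpow_two x).symm
  have h4 : ∀ k, ‖fnCoeff F k‖ₑ ^ 2 = ENNReal.ofReal (‖fnCoeff F k‖ ^ 2) := fun k => by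
    rw [ENNReal.ofReal_pow (norm_nonneg _), ofReal_norm]
  have h5 : ∀ x, ‖F x‖ₑ ^ 2 = ENNReal.ofReal (‖F x‖ ^ 2) := fun k => by
    rw [ENNReal.ofReal_pow (norm_nonneg _), ofReal_norm]
  simp_rw [h4, h5]
  rw [← ENNReal.ofReal_tsum_of_nonneg (fun k => sq_nonneg _) h2.summable, h2.tsum_eq,
    ofReal_integral_eq_lintegral_ofReal hF.integrable_norm_pow' (ae_of_all _ fun x => by positivity)]

theorem tsum_sq_coeff (f : L2) : ∑' k, ‖coeff f k‖ₑ ^ 2 = ∫⁻ x, ‖f x‖ₑ ^ 2 ∂torusMeasure :=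
  tsum_sq_fnCoeff (Lp.memLp f)

theorem tsum_sq_coeff_lt_top (f : L2) : ∑' k, ‖coeff f k‖ₑ ^ 2 < ⊤ := by
  rw [tsum_sq_coeff]
  have h := (Lp.memLp f).eLpNorm_lt_top
  rw [eLpNorm_lt_top_iff_lintegral_rpow_enorm_lt_top (by norm_num) (by norm_num)] at h
  simpa using h

/-- Parseval's identity for the pair e_k F and G, where e_k is the exponential of frequency k:
multiplication by it shifts the coefficients of F, and reality of F turns the conjugate into a
reflection. -/
theorem fnCoeff_mul {F G : Torus → ℝ} (hF : MemLp F 2 torusMeasure) (hG : MemLp G 2 torusMeasure)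
    (k : Fin 2 → ℤ) :
    HasSum (fun l => fnCoeff F l * fnCoeff G (k - l)) (fnCoeff (fun x => F x * G x) k) := by
  have hb : MemLp (fun x => UnitAddTorus.mFourier k x * ((F x : ℝ) : ℂ)) 2 torusMeasure := by
    refine (memLp_ofReal hF).of_le
      ((UnitAddTorus.mFourier k).continuous.aestronglyMeasurable.mul
        (memLp_ofReal hF).aestronglyMeasurable) (ae_of_all _ fun x => ?_)
    rw [norm_mul]
    have := (UnitAddTorus.mFourier k).norm_coe_le_norm x
    rw [UnitAddTorus.mFourier_norm] at this
    exact mul_le_of_le_one_left (norm_nonneg _) this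
  have h := UnitAddTorus.hasSum_prod_mFourierCoeff (d := Fin 2) hb.toLp (memLp_ofReal hG).toLp
  have h1 : ∀ i, UnitAddTorus.mFourierCoeff (hb.toLp : Lp ℂ 2 torusMeasure) i =
      fnCoeff F (i - k) := by
    intro i
    refine integral_congr_ae ?_
    filter_upwards [hb.coeFn_toLp] with x hx
    rw [hx, smul_eq_mul, smul_eq_mul, ← mul_assoc, ← UnitAddTorus.mFourier_add, neg_sub,
      neg_add_eq_sub]
  simp_rw [h1, ← fnCoeff_eq_toLp hG, ← fnCoeff_neg, neg_sub] at h
  have h2 : ∫ t, conj ((hb.toLp : Lp ℂ 2 torusMeasure) t) *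
      ((memLp_ofReal hG).toLp : Lp ℂ 2 torusMeasure) t ∂torusMeasure =
      fnCoeff (fun x => F x * G x) k := by
    refine integral_congr_ae ?_
    filter_upwards [hb.coeFn_toLp, (memLp_ofReal hG).coeFn_toLp] with x hx hx'
    rw [hx, hx', map_mul, smul_eq_mul, UnitAddTorus.mFourier_neg, Complex.conj_ofReal,
      Complex.ofReal_mul, mul_assoc]
  have h3 : HasSum (fun i => fnCoeff F (k - i) * fnCoeff G i) (fnCoeff (fun x => F x * G x) k) :=
    h2 ▸ h
  rw [← (Equiv.subLeft k).hasSum_iff]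
  convert h3 using 2 with i
  simp

/-- The `L²` function with given Fourier coefficients. -/
theorem exists_coeff_eq {c : FSeries} (hc : IsRealValued c) (hs : ∑' k, ‖c k‖ₑ ^ 2 < ⊤) :
    ∃ f : L2, coeff f = c := by
  have hmem : Memℓp c 2 := by
    rw [memℓp_gen_iff (by norm_num)]
    have h4 : ∀ k, ‖c k‖ₑ ^ 2 = ENNReal.ofReal (‖c k‖ ^ 2) := fun k => by
      rw [ENNReal.ofReal_pow (norm_nonneg _), ofReal_norm]
    simp_rw [h4] at hs
    have := ENNReal.summable_toReal hs.ne
    simpa [ENNReal.toReal_ofReal] using this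
  set G := (UnitAddTorus.mFourierBasis (d := Fin 2)).repr.symm ⟨c, hmem⟩ with hG
  have hGc : ∀ k, UnitAddTorus.mFourierCoeff G k = c k := by
    intro k
    rw [← UnitAddTorus.mFourierBasis_repr, hG, LinearIsometryEquiv.apply_symm_apply]
  have hGm : MemLp (G : Torus → ℂ) 2 torusMeasure := Lp.memLp G
  -- Taking the real part averages c k with the conjugate of c (-k), which changes nothing by the
  -- symmetry of c.
  have hre : MemLp (fun x => (G x).re) 2 torusMeasure := hGm.re
  refine ⟨hre.toLp, ?_⟩
  rw [coeff_toLp]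
  funext k
  have h1 : ∀ k, fnCoeff (fun x => (G x).re) k =
      (UnitAddTorus.mFourierCoeff G k + conj (UnitAddTorus.mFourierCoeff G (-k))) / 2 := by
    intro k
    unfold fnCoeff UnitAddTorus.mFourierCoeff
    have hi : ∀ k, Integrable (fun x => UnitAddTorus.mFourier k x • G x) torusMeasure := by
      intro k
      have hGi : Integrable G torusMeasure := hGm.integrable (by norm_num)
      refine hGi.mono ((UnitAddTorus.mFourier k).continuous.aestronglyMeasurable.smul
        hGi.aestronglyMeasurable) (ae_of_all _ fun x => ?_)
      rw [norm_smul]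
      have := (UnitAddTorus.mFourier k).norm_coe_le_norm x
      rw [UnitAddTorus.mFourier_norm] at this
      exact mul_le_of_le_one_left (norm_nonneg _) this
    have hi2 : Integrable (fun x => conj (UnitAddTorus.mFourier (- -k) x • G x)) torusMeasure :=
      (Complex.conjCLE.toContinuousLinearMap.integrable_comp (hi (- -k)))
    rw [← integral_conj]
    refine Eq.trans ?_ (congrArg (· / 2) (integral_add (hi (-k)) hi2))
    rw [← integral_div]
    refine integral_congr_ae (ae_of_all _ fun x => ?_)
    simp only [smul_eq_mul, map_mul, neg_neg, UnitAddTorus.mFourier_neg]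
    rw [Complex.re_eq_add_conj]
    ring
  rw [h1, hGc, hGc, hc, Complex.conj_conj]
  ring

open Classical in
/-- The `L²` function with Fourier coefficients `c` (and `0` when there is none). -/
def synth (c : FSeries) : L2 := if h : ∃ f : L2, coeff f = c then h.choose else 0

theorem coeff_synth {c : FSeries} (hc : IsRealValued c) (hs : ∑' k, ‖c k‖ₑ ^ 2 < ⊤) :
    coeff (synth c) = c := by
  have h := exists_coeff_eq hc hs
  rw [synth, dif_pos h]
  exact h.choose_spec

theorem coeff_sub (f g : L2) (k : Fin 2 → ℤ) : coeff (f - g) k = coeff f k - coeff g k := by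
  have h : ∀ f : L2, Integrable (fun x => UnitAddTorus.mFourier (-k) x • ((f x : ℝ) : ℂ))
      torusMeasure := by
    intro f
    have hf : Integrable (fun x => ((f x : ℝ) : ℂ)) torusMeasure :=
      (memLp_ofReal (Lp.memLp f)).integrable (by norm_num)
    refine hf.mono ((UnitAddTorus.mFourier (-k)).continuous.aestronglyMeasurable.smul
      hf.aestronglyMeasurable) (ae_of_all _ fun x => ?_)
    rw [norm_smul]
    have := (UnitAddTorus.mFourier (-k)).norm_coe_le_norm x
    rw [UnitAddTorus.mFourier_norm] at this
    exact mul_le_of_le_one_left (norm_nonneg _) this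
  refine Eq.trans ?_ (integral_sub (h f) (h g))
  refine integral_congr_ae ?_
  filter_upwards [Lp.coeFn_sub f g] with x hx
  simp only [hx, Pi.sub_apply, smul_eq_mul, Complex.ofReal_sub]
  ring

end CalmedMHD

end

noncomputable section

namespace CalmedMHD

/-! ### The calmed heating profile -/

/-- The bound is assumed only where the derivative exists. By Rademacher's theorem these points are
dense, and the sublevel set of |ζ| is closed, hence everything. -/
theorem IsCalming.exists_bound {ε : ℝ} {ζ : ℝ → ℝ} (h : IsCalming ε ζ) :
    ∃ M : ℝ, 0 ≤ M ∧ ∀ x, |ζ x| ≤ M := by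
  obtain ⟨L, hL⟩ := h.lipschitz
  obtain ⟨M, hM⟩ := h.bounded
  have hd : Dense {x | |ζ x| ≤ M} := by
    refine (Measure.dense_of_ae (hL.ae_differentiableAt (μ := volume))).mono fun x hx => ?_
    exact (le_add_of_nonneg_right (abs_nonneg _)).trans (hM x hx)
  have hc : IsClosed {x | |ζ x| ≤ M} := isClosed_le hL.continuous.abs continuous_const
  have hu := hc.closure_eq ▸ hd.closure_eq
  have hall : ∀ x, |ζ x| ≤ M := fun x => by
    have : x ∈ {x | |ζ x| ≤ M} := hu ▸ mem_univ x
    exact this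
  exact ⟨M, (abs_nonneg _).trans (hall 0), hall⟩

/-- The profile `r ↦ ζ(|r|) |r|` of the heating term. -/
def heatProfile (ζ : ℝ → ℝ) (r : ℝ) : ℝ := ζ |r| * |r|

variable {ζ : ℝ → ℝ} {M : ℝ} {L : ℝ≥0}

theorem abs_heatProfile_le (hM : ∀ x, |ζ x| ≤ M) (r : ℝ) : |heatProfile ζ r| ≤ M * |r| := by
  rw [heatProfile, abs_mul, abs_abs]
  exact mul_le_mul_of_nonneg_right (hM _) (abs_nonneg _)

/-- The increment is split so that the growing factor |s| belongs to only one of the two points.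
This asymmetry matters in the limit, where a pointwise bound is available for the limit but not
uniformly for the approximations. -/
theorem abs_heatProfile_sub_le (hM : ∀ x, |ζ x| ≤ M) (hL : LipschitzWith L ζ) (r s : ℝ) :
    |heatProfile ζ r - heatProfile ζ s| ≤ (M + L * |s|) * |r - s| := by
  have h1 : heatProfile ζ r - heatProfile ζ s =
      ζ |r| * (|r| - |s|) + |s| * (ζ |r| - ζ |s|) := by unfold heatProfile; ring
  have h2 : |ζ (|r|) - ζ (|s|)| ≤ L * |r - s| := by
    have := hL.dist_le_mul (|r|) (|s|)
    rw [Real.dist_eq, Real.dist_eq] at this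
    exact this.trans (mul_le_mul_of_nonneg_left (abs_abs_sub_abs_le r s) L.2)
  rw [h1]
  refine (abs_add_le _ _).trans ?_
  rw [abs_mul, abs_mul, abs_abs, add_mul]
  refine add_le_add (mul_le_mul (hM _) (abs_abs_sub_abs_le r s) (abs_nonneg _)
    ((abs_nonneg _).trans (hM 0))) ?_
  refine (mul_le_mul_of_nonneg_left h2 (abs_nonneg _)).trans (le_of_eq (by ring))

theorem continuous_heatProfile (hL : LipschitzWith L ζ) : Continuous (heatProfile ζ) :=
  (hL.continuous.comp continuous_abs).mul continuous_abs

theorem memLp_heatProfile_comp (hM : ∀ x, |ζ x| ≤ M) (hL : LipschitzWith L ζ) {F : Torus → ℝ}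
    (hF : MemLp F 2 torusMeasure) : MemLp (fun x => heatProfile ζ (F x)) 2 torusMeasure := by
  refine hF.of_le_mul (c := M)
    ((continuous_heatProfile hL).comp_aestronglyMeasurable hF.aestronglyMeasurable)
    (ae_of_all _ fun x => ?_)
  exact abs_heatProfile_le hM _

/-- The Fourier coefficients of `ζ(|ω|) |ω|`, in terms of those of `ω`. -/
def heatCoeff (ζ : ℝ → ℝ) (c : FSeries) : FSeries :=
  fnCoeff fun x => heatProfile ζ (synth c x)

/-- Parseval and the linear growth of the profile. This is the effect of calming on which the energy
estimate rests. -/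
theorem tsum_sq_heatCoeff_le (hM : ∀ x, |ζ x| ≤ M) (hL : LipschitzWith L ζ) {c : FSeries}
    (hc : IsRealValued c) (hs : ∑' k, ‖c k‖ₑ ^ 2 < ⊤) :
    ∑' k, ‖heatCoeff ζ c k‖ₑ ^ 2 ≤ ENNReal.ofReal M ^ 2 * ∑' k, ‖c k‖ₑ ^ 2 := by
  rw [heatCoeff, tsum_sq_fnCoeff (memLp_heatProfile_comp hM hL (Lp.memLp _))]
  have h := tsum_sq_coeff (synth c)
  rw [coeff_synth hc hs] at h
  rw [h, ← lintegral_const_mul' _ _ (by simp)]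
  refine lintegral_mono fun x => ?_
  rw [← mul_pow]
  refine pow_le_pow_left₀ zero_le ?_ 2
  rw [← ofReal_norm, ← ofReal_norm, ← ENNReal.ofReal_mul ((abs_nonneg _).trans (hM 0))]
  exact ENNReal.ofReal_le_ofReal (abs_heatProfile_le hM _)

/-- A function with absolutely summable Fourier coefficients is bounded by their sum. -/
theorem ae_abs_le_tsum_coeff {f : L2} (hs : ∑' k, ‖coeff f k‖ₑ < ⊤) :
    ∀ᵐ x ∂torusMeasure, |f x| ≤ (∑' k, ‖coeff f k‖ₑ).toReal := by
  have hsum : Summable fun k => ‖coeff f k‖ := by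
    have := ENNReal.summable_toReal hs.ne
    simpa using this
  have hsumC : Summable fun k => coeff f k • UnitAddTorus.mFourier (d := Fin 2) k := by
    refine Summable.of_norm ?_
    simpa [norm_smul, UnitAddTorus.mFourier_norm] using hsum
  obtain ⟨G, hG⟩ := hsumC
  have h1 := (ContinuousMap.toLp (E := ℂ) 2 torusMeasure ℂ).hasSum hG
  have h2 := UnitAddTorus.hasSum_mFourier_series_L2 (d := Fin 2) (memLp_ofReal (Lp.memLp f)).toLp
  simp_rw [← fnCoeff_eq_toLp (Lp.memLp f)] at h2
  have h3 : ContinuousMap.toLp (E := ℂ) 2 torusMeasure ℂ G =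
      (memLp_ofReal (Lp.memLp f)).toLp := by
    refine h1.unique ?_
    simp_rw [map_smul]
    exact h2
  have h4 := ContinuousMap.coeFn_toLp (p := 2) (𝕜 := ℂ) torusMeasure G
  rw [h3] at h4
  filter_upwards [h4, (memLp_ofReal (Lp.memLp f)).coeFn_toLp] with x hx hx'
  have h5 : ((f x : ℝ) : ℂ) = G x := hx'.symm.trans hx
  have h6 : |f x| = ‖G x‖ := by rw [← h5, Complex.norm_real, Real.norm_eq_abs]
  rw [h6]
  have h7 : (∑' k, ‖coeff f k‖ₑ).toReal = ∑' k, ‖coeff f k‖ := by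
    rw [ENNReal.tsum_toReal_eq fun k => by simp]
    simp
  rw [h7, ← hG.tsum_eq]
  refine (ContinuousMap.norm_coe_le_norm _ x).trans ?_
  refine (norm_tsum_le_tsum_norm ?_).trans (le_of_eq ?_)
  · simpa [norm_smul, UnitAddTorus.mFourier_norm] using hsum
  · simp [norm_smul, UnitAddTorus.mFourier_norm]

/-- Absolute summability is required of d alone: it bounds the factor |s| in
`abs_heatProfile_sub_le` almost everywhere. -/
theorem tsum_sq_heatCoeff_sub_le (hM : ∀ x, |ζ x| ≤ M) (hL : LipschitzWith L ζ) {c d : FSeries}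
    (hc : IsRealValued c) (hcs : ∑' k, ‖c k‖ₑ ^ 2 < ⊤) (hd : IsRealValued d)
    (hds : ∑' k, ‖d k‖ₑ ^ 2 < ⊤) (hd1 : ∑' k, ‖d k‖ₑ < ⊤) :
    ∑' k, ‖heatCoeff ζ c k - heatCoeff ζ d k‖ₑ ^ 2 ≤
      ENNReal.ofReal (M + L * (∑' k, ‖d k‖ₑ).toReal) ^ 2 * ∑' k, ‖c k - d k‖ₑ ^ 2 := by
  have hM0 : 0 ≤ M := (abs_nonneg _).trans (hM 0)
  have hmc := memLp_heatProfile_comp hM hL (Lp.memLp (synth c))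
  have hmd := memLp_heatProfile_comp hM hL (Lp.memLp (synth d))
  have h1 : ∀ k, heatCoeff ζ c k - heatCoeff ζ d k = coeff (hmc.toLp - hmd.toLp) k := by
    intro k
    rw [coeff_sub, coeff_toLp, coeff_toLp]
    rfl
  have h2 : ∀ k, c k - d k = coeff (synth c - synth d) k := by
    intro k
    rw [coeff_sub, coeff_synth hc hcs, coeff_synth hd hds]
  have hbd := ae_abs_le_tsum_coeff (f := synth d) (by rwa [coeff_synth hd hds])
  rw [coeff_synth hd hds] at hbd
  simp_rw [h1, h2]
  rw [tsum_sq_coeff, tsum_sq_coeff, ← lintegral_const_mul' _ _ (by simp)]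
  refine lintegral_mono_ae ?_
  filter_upwards [Lp.coeFn_sub hmc.toLp hmd.toLp, Lp.coeFn_sub (synth c) (synth d),
    hmc.coeFn_toLp, hmd.coeFn_toLp, hbd] with x hx1 hx2 hx3 hx4 hx5
  rw [hx1, hx2, Pi.sub_apply, Pi.sub_apply, hx3, hx4, ← mul_pow]
  refine pow_le_pow_left₀ zero_le ?_ 2
  rw [← ofReal_norm, ← ofReal_norm, ← ENNReal.ofReal_mul (by positivity)]
  refine ENNReal.ofReal_le_ofReal ((abs_heatProfile_sub_le hM hL _ _).trans ?_)
  exact mul_le_mul_of_nonneg_right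
    (add_le_add_right (mul_le_mul_of_nonneg_left hx5 L.2) M) (abs_nonneg _)

/-! ### Translations and the `H¹` bound -/

/-- Translation acts on coefficients as multiplication by a character, so difference quotients
become Fourier multipliers. -/
theorem fnCoeff_translate (F : Torus → ℝ) (y : Torus) (k : Fin 2 → ℤ) :
    fnCoeff (fun x => F (x + y)) k = UnitAddTorus.mFourier k y * fnCoeff F k := by
  have h := integral_add_right_eq_self (μ := torusMeasure)
    (fun x => UnitAddTorus.mFourier k y * (UnitAddTorus.mFourier (-k) x • ((F x : ℝ) : ℂ))) y
  unfold fnCoeff UnitAddTorus.mFourierCoeff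
  refine Eq.trans (integral_congr_ae (ae_of_all _ fun x => ?_)) (h.trans (integral_const_mul _ _))
  have h2 : UnitAddTorus.mFourier k y * UnitAddTorus.mFourier (-k) (x + y) =
      UnitAddTorus.mFourier (-k) x := by
    have h3 : UnitAddTorus.mFourier (-k) (x + y) =
        UnitAddTorus.mFourier (-k) x * UnitAddTorus.mFourier (-k) y := by
      simp only [UnitAddTorus.mFourier, ContinuousMap.coe_mk, ← Finset.prod_mul_distrib,
        Pi.add_apply, fourier_apply, smul_add, AddCircle.toCircle_add,
        Circle.coe_mul]
    have h4 : UnitAddTorus.mFourier k y * UnitAddTorus.mFourier (-k) y = 1 := by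
      rw [← UnitAddTorus.mFourier_add, add_neg_cancel, UnitAddTorus.mFourier_zero]; rfl
    rw [h3, mul_left_comm, h4, mul_one]
  simp only [smul_eq_mul]
  rw [← mul_assoc, h2]

theorem memLp_translate {F : Torus → ℝ} (hF : MemLp F 2 torusMeasure) (y : Torus) :
    MemLp (fun x => F (x + y)) 2 torusMeasure :=
  hF.comp_measurePreserving (measurePreserving_add_right torusMeasure y)

theorem tsum_sq_translate_sub {F : Torus → ℝ} (hF : MemLp F 2 torusMeasure) (y : Torus) :
    ∑' k, ‖UnitAddTorus.mFourier k y - 1‖ₑ ^ 2 * ‖fnCoeff F k‖ₑ ^ 2 =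
      ∫⁻ x, ‖F (x + y) - F x‖ₑ ^ 2 ∂torusMeasure := by
  have hT := memLp_translate hF y
  have h1 : ∀ k, ‖UnitAddTorus.mFourier k y - 1‖ₑ ^ 2 * ‖fnCoeff F k‖ₑ ^ 2 =
      ‖coeff (hT.toLp - hF.toLp) k‖ₑ ^ 2 := by
    intro k
    rw [coeff_sub, coeff_toLp, coeff_toLp, fnCoeff_translate, ← mul_pow, ← enorm_mul, sub_mul,
      one_mul]
  simp_rw [h1]
  rw [tsum_sq_coeff]
  refine lintegral_congr_ae ?_
  filter_upwards [Lp.coeFn_sub hT.toLp hF.toLp, hT.coeFn_toLp, hF.coeFn_toLp] with x h1 h2 h3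
  rw [h1, Pi.sub_apply, h2, h3]

theorem mFourier_single_coe (k : Fin 2 → ℤ) (j : Fin 2) (h : ℝ) :
    UnitAddTorus.mFourier k (Pi.single j (h : UnitAddCircle)) =
      Complex.exp (Complex.I * ((2 * Real.pi * k j * h : ℝ) : ℂ)) := by
  have h0 : ∀ i, i ≠ j → fourier (k i) ((Pi.single j (h : UnitAddCircle) : Torus) i) = 1 := by
    intro i hi
    rw [Pi.single_eq_of_ne hi, fourier_eval_zero]
  simp only [UnitAddTorus.mFourier, ContinuousMap.coe_mk]
  rw [Finset.prod_eq_single j (fun i _ hi => h0 i hi) (fun hj => absurd (Finset.mem_univ j) hj),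
    Pi.single_eq_same, fourier_coe_apply]
  congr 1
  push_cast
  ring

theorem tendsto_mFourier_sub_one_div (k : Fin 2 → ℤ) (j : Fin 2) :
    Tendsto (fun h : ℝ => (h : ℂ)⁻¹ * (UnitAddTorus.mFourier k (Pi.single j (h : UnitAddCircle)) - 1))
      (𝓝[≠] 0) (𝓝 (2 * Real.pi * Complex.I * (k j : ℂ))) := by
  have hd : HasDerivAt (fun h : ℝ => Complex.exp (Complex.I * ((2 * Real.pi * k j * h : ℝ) : ℂ)))
      (2 * Real.pi * Complex.I * (k j : ℂ)) 0 := by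
    have h1 : HasDerivAt (fun h : ℝ => Complex.I * ((2 * Real.pi * k j * h : ℝ) : ℂ))
        (2 * Real.pi * Complex.I * (k j : ℂ)) 0 := by
      have h2 : HasDerivAt (fun h : ℝ => 2 * Real.pi * k j * h) (2 * Real.pi * k j) 0 := by
        simpa using (hasDerivAt_id (0 : ℝ)).const_mul (2 * Real.pi * k j)
      exact (h2.ofReal_comp.const_mul Complex.I).congr_deriv (by push_cast; ring)
    have := h1.cexp
    simpa using this
  have h := hd.tendsto_slope_zero
  refine h.congr fun t => ?_
  simp only [zero_add, mFourier_single_coe, mul_zero, Complex.ofReal_zero, Complex.exp_zero]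
  rw [Complex.real_smul]
  push_cast
  rfl

/-- Nirenberg's difference quotients. On a finite set of modes the quotients of F converge to its
derivative, while at every step size the quotients of F are dominated by those of G through the
pointwise hypothesis and Parseval. No differentiability of the map taking G to F is needed. -/
theorem tsum_sq_deriv_le_of_translate {F G : Torus → ℝ} (hF : MemLp F 2 torusMeasure)
    (hG : MemLp G 2 torusMeasure) {K : ℝ≥0}
    (h : ∀ y, ∀ᵐ x ∂torusMeasure, |F (x + y) - F x| ≤ K * |G (x + y) - G x|) (j : Fin 2) :
    ∑' k : Fin 2 → ℤ, ENNReal.ofReal ((2 * Real.pi * k j) ^ 2) * ‖fnCoeff F k‖ₑ ^ 2 ≤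
      K ^ 2 * ∑' k : Fin 2 → ℤ, ENNReal.ofReal ((2 * Real.pi * k j) ^ 2) * ‖fnCoeff G k‖ₑ ^ 2 := by
  have hn : ∀ k : Fin 2 → ℤ, ‖(2 * Real.pi * Complex.I * (k j : ℂ))‖ₑ ^ 2 =
      ENNReal.ofReal ((2 * Real.pi * k j) ^ 2) := by
    intro k
    rw [← ofReal_norm, ← ENNReal.ofReal_pow (norm_nonneg _)]
    congr 1
    simp only [norm_mul, Complex.norm_I, Complex.norm_real, Complex.norm_intCast, mul_pow]
    simp
  rw [ENNReal.tsum_eq_iSup_sum]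
  refine iSup_le fun B => ?_
  have hlim : Tendsto (fun t : ℝ => ∑ k ∈ B, ‖(t : ℂ)⁻¹ *
      (UnitAddTorus.mFourier k (Pi.single j (t : UnitAddCircle)) - 1)‖ₑ ^ 2 * ‖fnCoeff F k‖ₑ ^ 2)
      (𝓝[≠] 0) (𝓝 (∑ k ∈ B, ENNReal.ofReal ((2 * Real.pi * k j) ^ 2) * ‖fnCoeff F k‖ₑ ^ 2)) := by
    refine tendsto_finsetSum _ fun k _ => ENNReal.Tendsto.mul_const ?_ (Or.inr (by finiteness))
    rw [← hn]
    exact (ENNReal.continuous_pow 2).continuousAt.tendsto.comp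
      ((continuous_enorm.tendsto _).comp (tendsto_mFourier_sub_one_div k j))
  refine le_of_tendsto hlim ?_
  filter_upwards [self_mem_nhdsWithin] with t ht
  have ht0 : (t : ℝ) ≠ 0 := ht
  set y : Torus := Pi.single j (t : UnitAddCircle) with hy
  have h1 : ∀ H : Torus → ℝ, ∀ k, ‖(t : ℂ)⁻¹ * (UnitAddTorus.mFourier k y - 1)‖ₑ ^ 2 *
      ‖fnCoeff H k‖ₑ ^ 2 = ‖(t : ℂ)⁻¹‖ₑ ^ 2 *
        (‖UnitAddTorus.mFourier k y - 1‖ₑ ^ 2 * ‖fnCoeff H k‖ₑ ^ 2) := by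
    intro H k
    rw [enorm_mul, mul_pow, mul_assoc]
  refine (ENNReal.sum_le_tsum B).trans ?_
  simp_rw [h1 F]
  rw [ENNReal.tsum_mul_left, tsum_sq_translate_sub hF]
  have h2 : ∫⁻ x, ‖F (x + y) - F x‖ₑ ^ 2 ∂torusMeasure ≤
      K ^ 2 * ∫⁻ x, ‖G (x + y) - G x‖ₑ ^ 2 ∂torusMeasure := by
    rw [← lintegral_const_mul' _ _ (by finiteness)]
    refine lintegral_mono_ae ?_
    filter_upwards [h y] with x hx
    rw [← mul_pow]
    refine pow_le_pow_left₀ zero_le ?_ 2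
    rw [← ofReal_norm, ← ofReal_norm, ← ENNReal.ofReal_coe_nnreal,
      ← ENNReal.ofReal_mul K.coe_nonneg]
    exact ENNReal.ofReal_le_ofReal hx
  refine (mul_le_mul_right h2 _).trans ?_
  rw [← tsum_sq_translate_sub hG, mul_left_comm]
  refine mul_le_mul_right ?_ _
  rw [← ENNReal.tsum_mul_left]
  refine ENNReal.tsum_le_tsum fun k => ?_
  rw [← h1 G]
  refine mul_le_mul_left ?_ _
  -- On the side of G no limit is taken: |e^{ix} - 1| ≤ |x| bounds the quotient at each step size.
  rw [← ofReal_norm, ← sq_abs (2 * Real.pi * k j), ENNReal.ofReal_pow (abs_nonneg _)]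
  refine pow_le_pow_left₀ zero_le (ENNReal.ofReal_le_ofReal ?_) 2
  rw [norm_mul, norm_inv, Complex.norm_real, inv_mul_le_iff₀ (norm_pos_iff.2 ht0), hy,
    mFourier_single_coe]
  refine Real.norm_exp_I_mul_ofReal_sub_one_le.trans (le_of_eq ?_)
  rw [norm_mul, mul_comm, Real.norm_eq_abs (_ * _)]

theorem sobNormSq_one_eq (c : FSeries) :
    sobNormSq 1 c = ∑' k, ‖c k‖ₑ ^ 2 +
      ∑ j, ∑' k : Fin 2 → ℤ, ENNReal.ofReal ((2 * Real.pi * k j) ^ 2) * ‖c k‖ₑ ^ 2 := by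
  rw [Fin.sum_univ_two, ← ENNReal.tsum_add, ← ENNReal.tsum_add]
  refine tsum_congr fun k => ?_
  rw [Real.rpow_one, ENNReal.ofReal_add zero_le_one (lapSymbol_nonneg k), ENNReal.ofReal_one,
    add_mul, one_mul, ← add_mul, ← ENNReal.ofReal_add (sq_nonneg _) (sq_nonneg _)]
  congr 3
  rw [lapSymbol, Fin.sum_univ_two]
  ring

/-- On the range of a bounded function the profile is Lipschitz with the displayed constant, so the
H¹ norm grows at most by that factor. For the part without derivatives M alone would do. -/
theorem sobNormSq_one_heatCoeff_le (hM : ∀ x, |ζ x| ≤ M) (hL : LipschitzWith L ζ) {c : FSeries}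
    (hc : IsRealValued c) (hs : ∑' k, ‖c k‖ₑ ^ 2 < ⊤) (hs1 : ∑' k, ‖c k‖ₑ < ⊤) :
    sobNormSq 1 (heatCoeff ζ c) ≤
      ENNReal.ofReal (M + L * (∑' k, ‖c k‖ₑ).toReal) ^ 2 * sobNormSq 1 c := by
  have hM0 : 0 ≤ M := (abs_nonneg _).trans (hM 0)
  have hK : 0 ≤ M + L * (∑' k, ‖c k‖ₑ).toReal := by positivity
  rw [sobNormSq_one_eq, sobNormSq_one_eq, mul_add, Finset.mul_sum]
  refine add_le_add ((tsum_sq_heatCoeff_le hM hL hc hs).trans (mul_le_mul_left ?_ _))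
    (Finset.sum_le_sum fun j _ => ?_)
  · refine pow_le_pow_left₀ zero_le (ENNReal.ofReal_le_ofReal ?_) 2
    exact le_add_of_nonneg_right (by positivity)
  · have hbd := ae_abs_le_tsum_coeff (f := synth c) (by rwa [coeff_synth hc hs])
    rw [coeff_synth hc hs] at hbd
    have h := tsum_sq_deriv_le_of_translate (memLp_heatProfile_comp hM hL (Lp.memLp (synth c)))
      (Lp.memLp (synth c)) (K := ⟨_, hK⟩) (fun y => ?_) j
    · rw [fnCoeff_coeFn, coeff_synth hc hs] at h
      refine h.trans (le_of_eq ?_)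
      rw [ENNReal.ofReal, Real.toNNReal_of_nonneg hK]
      rfl
    · filter_upwards [hbd] with x hx
      refine (abs_heatProfile_sub_le hM hL _ _).trans ?_
      exact mul_le_mul_of_nonneg_right
        (add_le_add_right (mul_le_mul_of_nonneg_left hx L.2) M) (abs_nonneg _)

end CalmedMHD

end

noncomputable section

namespace CalmedMHD

/-! ### The bilinear term in divergence form -/

/-- The symbol `2πi k·v(l)`. -/
def dotSymbol (k : Fin 2 → ℤ) (v : Fin 2 → FSeries) (l : Fin 2 → ℤ) : ℂ :=
  ∑ j, (2 * Real.pi * Complex.I * (k j : ℂ)) * v j l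

theorem dotSymbol_sub (k m : Fin 2 → ℤ) (v : Fin 2 → FSeries) (l : Fin 2 → ℤ) :
    dotSymbol (k - m) v l = dotSymbol k v l - dotSymbol m v l := by
  simp only [dotSymbol, ← Finset.sum_sub_distrib]
  refine Finset.sum_congr rfl fun j _ => ?_
  push_cast [Pi.sub_apply]
  ring

theorem dotSymbol_zero (v : Fin 2 → FSeries) (l : Fin 2 → ℤ) : dotSymbol 0 v l = 0 := by
  simp [dotSymbol]

theorem conj_dotSymbol {v : Fin 2 → FSeries} (hv : ∀ i, IsRealValued (v i)) (k l : Fin 2 → ℤ) :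
    conj (dotSymbol k v l) = dotSymbol (-k) v (-l) := by
  simp only [dotSymbol, map_sum, map_mul, hv _ l, Complex.conj_I, Complex.conj_ofReal, map_ofNat,
    Pi.neg_apply]
  refine Finset.sum_congr rfl fun j _ => ?_
  push_cast
  rw [map_intCast]
  ring

theorem dotSymbol_self {v : Fin 2 → FSeries} (hv : IsSolenoidal v) (l : Fin 2 → ℤ) :
    dotSymbol l v l = 0 := hv.2 l

theorem norm_dotSymbol_le (k : Fin 2 → ℤ) (v : Fin 2 → FSeries) (l : Fin 2 → ℤ) :
    ‖dotSymbol k v l‖ ≤ freq k * ∑ j, ‖v j l‖ := by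
  refine (norm_sum_le _ _).trans ?_
  rw [Finset.mul_sum]
  refine Finset.sum_le_sum fun j _ => ?_
  rw [norm_mul]
  refine mul_le_mul_of_nonneg_right (le_trans (le_of_eq ?_) (two_pi_abs_le_freq k j))
    (norm_nonneg _)
  simp [abs_of_pos Real.pi_pos]

/-- The Fourier coefficients of `∇·(w v)`. -/
def divP (v : Fin 2 → FSeries) (w : FSeries) : FSeries :=
  fun k => ∑' l, dotSymbol k v l * w (k - l)

theorem isRealValued_divP {v : Fin 2 → FSeries} {w : FSeries} (hv : ∀ i, IsRealValued (v i))
    (hw : IsRealValued w) : IsRealValued (divP v w) := by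
  intro k
  rw [divP, divP, Complex.conj_tsum, ← (Equiv.neg _).tsum_eq]
  refine tsum_congr fun l => ?_
  rw [map_mul, conj_dotSymbol hv, ← hw]
  congr 2
  simp only [Equiv.neg_apply]
  abel

theorem divP_eq_sum {B : Finset (Fin 2 → ℤ)} {v : Fin 2 → FSeries} (hv : ∀ i, ∀ k ∉ B, v i k = 0)
    (w : FSeries) (k : Fin 2 → ℤ) : divP v w k = ∑ l ∈ B, dotSymbol k v l * w (k - l) :=
  tsum_eq_sum fun l hl => by simp [dotSymbol, hv _ l hl]

/-- Because l · v(l) = 0, the frequency k may be replaced by k - l: this is the passage from ∇·(w v)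
to (v · ∇)w. -/
theorem divP_eq_tsum_sub {v : Fin 2 → FSeries} (hv : IsSolenoidal v) (w : FSeries)
    (k : Fin 2 → ℤ) : divP v w k = ∑' l, dotSymbol (k - l) v l * w (k - l) :=
  tsum_congr fun l => by rw [dotSymbol_sub, dotSymbol_self hv, sub_zero]

theorem norm_divP_le_of_support {B : Finset (Fin 2 → ℤ)} {v : Fin 2 → FSeries}
    (hv : ∀ i, ∀ k ∉ B, v i k = 0) (hs : IsSolenoidal v) (w : FSeries) (k : Fin 2 → ℤ) :
    ‖divP v w k‖ ≤ ∑ l ∈ B, (∑ j, ‖v j l‖) * (freq (k - l) * ‖w (k - l)‖) := by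
  rw [divP_eq_sum hv]
  refine (norm_sum_le _ _).trans (Finset.sum_le_sum fun l _ => ?_)
  have h : dotSymbol k v l = dotSymbol (k - l) v l := by
    rw [dotSymbol_sub, dotSymbol_self hs, sub_zero]
  rw [h, norm_mul]
  refine (mul_le_mul_of_nonneg_right (norm_dotSymbol_le _ _ _) (norm_nonneg _)).trans
    (le_of_eq (by ring))

/-- If the right-hand side is infinite there is nothing to prove; otherwise the series converges
absolutely. -/
theorem enorm_tsum_le {ι : Type*} (f : ι → ℂ) : ‖∑' i, f i‖ₑ ≤ ∑' i, ‖f i‖ₑ := by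
  by_cases h : ∑' i, ‖f i‖ₑ = ⊤
  · rw [h]; exact le_top
  · have hs : Summable fun i => ‖f i‖ := by
      have := ENNReal.summable_toReal h
      simpa using this
    rw [← ofReal_norm]
    simp_rw [← ofReal_norm]
    rw [← ENNReal.ofReal_tsum_of_nonneg (fun _ => norm_nonneg _) hs]
    exact ENNReal.ofReal_le_ofReal (norm_tsum_le_tsum_norm hs)

theorem enorm_dotSymbol_le (k : Fin 2 → ℤ) (v : Fin 2 → FSeries) (l : Fin 2 → ℤ) :
    ‖dotSymbol k v l‖ₑ ≤ ENNReal.ofReal (freq k) * ∑ j, ‖v j l‖ₑ := by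
  simp_rw [← ofReal_norm]
  rw [← ENNReal.ofReal_sum_of_nonneg fun _ _ => norm_nonneg _,
    ← ENNReal.ofReal_mul (freq_nonneg k)]
  exact ENNReal.ofReal_le_ofReal (norm_dotSymbol_le k v l)

theorem enorm_divP_le {v : Fin 2 → FSeries} (hs : IsSolenoidal v) (w : FSeries)
    (k : Fin 2 → ℤ) :
    ‖divP v w k‖ₑ ≤ ∑' l, (∑ j, ‖v j l‖ₑ) * (ENNReal.ofReal (freq (k - l)) * ‖w (k - l)‖ₑ) := by
  rw [divP_eq_tsum_sub hs]
  refine (enorm_tsum_le _).trans (ENNReal.tsum_le_tsum fun l => ?_)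
  rw [enorm_mul]
  refine (mul_le_mul_left (enorm_dotSymbol_le _ _ _) _).trans (le_of_eq (by ring))

/-- The derivative is left outside the convolution, so nothing beyond L² is asked of w. For a fixed
mode this is enough. -/
theorem enorm_divP_le_freq_mul (v : Fin 2 → FSeries) (w : FSeries) (k : Fin 2 → ℤ) :
    ‖divP v w k‖ₑ ≤ ENNReal.ofReal (freq k) * ∑' l, (∑ j, ‖v j l‖ₑ) * ‖w (k - l)‖ₑ := by
  rw [divP, ← ENNReal.tsum_mul_left]
  refine (enorm_tsum_le _).trans (ENNReal.tsum_le_tsum fun l => ?_)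
  rw [enorm_mul]
  refine (mul_le_mul_left (enorm_dotSymbol_le _ _ _) _).trans (le_of_eq (by ring))

/-- Cauchy–Schwarz, uniformly in the shift. It is needed before series over several components may
be recombined. -/
theorem summable_conv {a b : FSeries} (ha : ∑' k, ‖a k‖ₑ ^ 2 < ⊤) (hb : ∑' k, ‖b k‖ₑ ^ 2 < ⊤)
    (k : Fin 2 → ℤ) : Summable fun l => a l * b (k - l) := by
  have h := ennreal_tsum_mul_sq_le (fun l => ‖a l‖ₑ) (fun l => ‖b (k - l)‖ₑ)
  have h2 : ∑' l, ‖b (k - l)‖ₑ ^ 2 = ∑' l, ‖b l‖ₑ ^ 2 :=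
    (Equiv.subLeft k).tsum_eq fun l => ‖b l‖ₑ ^ 2
  rw [h2] at h
  have h3 : ∑' l, ‖a l‖ₑ * ‖b (k - l)‖ₑ ≠ ⊤ := by
    intro h4
    rw [h4] at h
    have := h.trans_lt (ENNReal.mul_lt_top ha hb)
    simp at this
  have := ENNReal.summable_toReal h3
  refine Summable.of_norm ?_
  simpa using this

theorem divP_eq_sum_tsum {v : Fin 2 → FSeries} {w : FSeries}
    (hv : ∀ i, ∑' k, ‖v i k‖ₑ ^ 2 < ⊤) (hw : ∑' k, ‖w k‖ₑ ^ 2 < ⊤) (k : Fin 2 → ℤ) :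
    divP v w k = ∑ j, (2 * Real.pi * Complex.I * (k j : ℂ)) * ∑' l, v j l * w (k - l) := by
  simp_rw [← tsum_mul_left]
  rw [← Summable.tsum_finsetSum fun j _ => (summable_conv (hv j) hw k).mul_left _]
  refine tsum_congr fun l => ?_
  rw [dotSymbol, Finset.sum_mul]
  exact Finset.sum_congr rfl fun j _ => by ring

/-- The induction term is divergence-free with zero average. -/
theorem isSolenoidal_induction {u b : Fin 2 → FSeries} (hu : ∀ i, ∑' k, ‖u i k‖ₑ ^ 2 < ⊤)
    (hb : ∀ i, ∑' k, ‖b i k‖ₑ ^ 2 < ⊤) :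
    IsSolenoidal fun i k => divP b (u i) k - divP u (b i) k := by
  refine ⟨fun i => by simp [divP, dotSymbol_zero], fun k => ?_⟩
  -- Convolution is commutative, so the divergence contracts the symmetric tensor of the k's with an
  -- antisymmetric one.
  have h : ∀ i j, ∑' l, b j l * u i (k - l) = ∑' l, u i l * b j (k - l) := by
    intro i j
    rw [← (Equiv.subLeft k).tsum_eq]
    refine tsum_congr fun l => ?_
    simp [mul_comm]
  simp only [divP_eq_sum_tsum hu (hb _), divP_eq_sum_tsum hb (hu _), h]
  simp only [Fin.sum_univ_two]
  ring

/-- The transport term is antisymmetric. -/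
theorem sum_mul_divP_antisymm {B : Finset (Fin 2 → ℤ)} {v : Fin 2 → FSeries} {f h : FSeries}
    (hB : ∀ k ∈ B, -k ∈ B)
    (hv : ∀ i, ∀ k ∉ B, v i k = 0) (hs : IsSolenoidal v) (hf : ∀ k ∉ B, f k = 0)
    (hh : ∀ k ∉ B, h k = 0) :
    ∑ k ∈ B, h (-k) * divP v f k = -∑ k ∈ B, f (-k) * divP v h k := by
  have hBn : ∀ k ∉ B, -k ∉ B := fun k hk hk' => hk (by simpa using hB _ hk')
  simp_rw [divP_eq_sum hv, Finset.mul_sum]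
  rw [Finset.sum_comm]
  conv_rhs => rw [Finset.sum_comm]
  rw [← Finset.sum_neg_distrib]
  refine Finset.sum_congr rfl fun l _ => ?_
  -- The finite sums are extended to the whole lattice so that k can be reflected to l - k. Under
  -- this reflection the symbol changes sign by solenoidality, and f and h exchange roles.
  have h1 : ∀ (f h : FSeries), (∀ k ∉ B, h k = 0) →
      ∑ k ∈ B, h (-k) * (dotSymbol k v l * f (k - l)) =
      ∑' k, h (-k) * (dotSymbol k v l * f (k - l)) := fun f h hh =>
    (tsum_eq_sum fun k hk => by rw [hh _ (hBn k hk), zero_mul]).symm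
  rw [h1 f h hh, h1 h f hf, ← (Equiv.subLeft l).tsum_eq, ← tsum_neg]
  refine tsum_congr fun k => ?_
  simp only [Equiv.subLeft_apply, neg_sub, sub_sub_cancel_left, dotSymbol_sub,
    dotSymbol_self hs]
  ring

/-! ### The Leray projection -/

theorem sum_sq_ne_zero {k : Fin 2 → ℤ} (hk : k ≠ 0) : (∑ j, (k j : ℂ) ^ 2) ≠ 0 := by
  intro h
  have h1 : (∑ j, (k j : ℝ) ^ 2) = 0 := by exact_mod_cast h
  rw [Finset.sum_eq_zero_iff_of_nonneg fun i _ => sq_nonneg _] at h1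
  refine hk (funext fun j => ?_)
  have := h1 j (Finset.mem_univ j)
  simpa using this

theorem isSolenoidal_leray (v : Fin 2 → FSeries) : IsSolenoidal (leray v) := by
  refine ⟨fun i => by simp [leray], fun k => ?_⟩
  by_cases hk : k = 0
  · simp [hk]
  · have h := sum_sq_ne_zero hk
    simp only [leray, if_neg hk]
    simp only [Fin.sum_univ_two] at h ⊢
    field_simp
    ring

theorem isRealValued_leray {v : Fin 2 → FSeries} (hv : ∀ i, IsRealValued (v i)) (i : Fin 2) :
    IsRealValued (leray v i) := by
  intro k
  by_cases hk : k = 0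
  · simp [leray, hk]
  · have hk' : -k ≠ 0 := by simpa using hk
    simp only [leray, if_neg hk, if_neg hk', hv _ k, Pi.neg_apply, map_sub, map_div₀, map_mul,
      map_sum, map_pow, map_intCast]
    push_cast
    simp only [neg_sq, neg_mul, Finset.sum_neg_distrib, mul_neg, neg_neg]

/-- The projection removes a multiple of k, which is orthogonal to the coefficient of a solenoidal
field. The pressure therefore does no work. -/
theorem sum_conj_mul_leray {u : Fin 2 → FSeries} (hu : IsSolenoidal u) (v : Fin 2 → FSeries)
    (k : Fin 2 → ℤ) : ∑ i, conj (u i k) * leray v i k = ∑ i, conj (u i k) * v i k := by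
  by_cases hk : k = 0
  · simp [leray, hk, hu.1]
  · have h := hu.2 k
    have h0 : ∑ j, (k j : ℂ) * u j k = 0 := by
      have h2 : (2 * Real.pi * Complex.I : ℂ) * ∑ j, (k j : ℂ) * u j k = 0 := by
        rw [Finset.mul_sum, ← h]
        exact Finset.sum_congr rfl fun j _ => by ring
      have h3 : (2 * Real.pi * Complex.I : ℂ) ≠ 0 := Complex.two_pi_I_ne_zero
      exact (mul_eq_zero.1 h2).resolve_left h3
    have h1 : ∑ j, (k j : ℂ) * conj (u j k) = 0 := by
      have := congrArg conj h0
      simpa [map_sum] using this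
    simp only [leray, if_neg hk, Fin.sum_univ_two] at h1 ⊢
    linear_combination (-((k 0 : ℂ) * v 0 k + (k 1 : ℂ) * v 1 k) /
      ((k 0 : ℂ) ^ 2 + (k 1 : ℂ) ^ 2)) * h1

/-- The removed part has size at most |k_i| |k·v| / |k|², and |k_i| |k_j| ≤ |k|²; one copy of the
sum pays for each of the two terms. -/
theorem norm_leray_le (v : Fin 2 → FSeries) (i : Fin 2) (k : Fin 2 → ℤ) :
    ‖leray v i k‖ ≤ 2 * ∑ j, ‖v j k‖ := by
  by_cases hk : k = 0
  · simp only [leray, if_pos hk, norm_zero]; positivity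
  · simp only [leray, if_neg hk]
    have h := sum_sq_ne_zero hk
    have h1 : ‖v i k‖ ≤ ∑ j, ‖v j k‖ :=
      Finset.single_le_sum (f := fun j => ‖v j k‖) (fun j _ => norm_nonneg _) (Finset.mem_univ i)
    refine (norm_sub_le _ _).trans ?_
    have hR : ‖∑ j, (k j : ℂ) ^ 2‖ = ∑ j, |(k j : ℝ)| ^ 2 := by
      have : (∑ j, (k j : ℂ) ^ 2) = ((∑ j, |(k j : ℝ)| ^ 2 : ℝ) : ℂ) := by
        push_cast [sq_abs]; rfl
      rw [this, Complex.norm_real, Real.norm_eq_abs, abs_of_nonneg (by positivity)]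
    have h2 : ‖(k i : ℂ) * (∑ j, (k j : ℂ) * v j k) / ∑ j, (k j : ℂ) ^ 2‖ ≤ ∑ j, ‖v j k‖ := by
      rw [norm_div, div_le_iff₀ (norm_pos_iff.2 h), hR, norm_mul, Complex.norm_intCast]
      have h4 : ‖∑ j, (k j : ℂ) * v j k‖ ≤ ∑ j, |(k j : ℝ)| * ‖v j k‖ := by
        refine (norm_sum_le _ _).trans (le_of_eq (Finset.sum_congr rfl fun j _ => ?_))
        rw [norm_mul, Complex.norm_intCast]
      refine (mul_le_mul_of_nonneg_left h4 (abs_nonneg _)).trans ?_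
      have hi : |(k i : ℝ)| = |(k 0 : ℝ)| ∨ |(k i : ℝ)| = |(k 1 : ℝ)| := by
        fin_cases i <;> simp
      have ha := abs_nonneg (k 0 : ℝ)
      have hb := abs_nonneg (k 1 : ℝ)
      have hx := norm_nonneg (v 0 k)
      have hy := norm_nonneg (v 1 k)
      simp only [Fin.sum_univ_two]
      rcases hi with hi | hi <;> rw [hi] <;>
      nlinarith [mul_nonneg hx (sq_nonneg (|(k 0 : ℝ)| - |(k 1 : ℝ)|)),
        mul_nonneg hy (sq_nonneg (|(k 0 : ℝ)| - |(k 1 : ℝ)|)), mul_nonneg hx (sq_nonneg (k 0 : ℝ)),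
        mul_nonneg hy (mul_nonneg ha ha), mul_nonneg hx (mul_nonneg ha ha),
        mul_nonneg hy (mul_nonneg hb hb), mul_nonneg hx (mul_nonneg hb hb)]
    linarith

end CalmedMHD

end

noncomputable section

namespace CalmedMHD

/-! ### Grönwall's inequality with dissipation -/

theorem hasDerivAt_primitive {T : ℝ} {f : ℝ → ℝ} (hf : ContinuousOn f (Icc 0 T)) {t : ℝ}
    (ht : t ∈ Ioo 0 T) : HasDerivAt (fun t => ∫ s in (0 : ℝ)..t, f s) (f t) t := by
  have hn : Icc 0 T ∈ 𝓝 t := Icc_mem_nhds ht.1 ht.2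
  refine intervalIntegral.integral_hasDerivAt_right ?_ ?_ (hf.continuousAt hn)
  · refine (hf.mono ?_).intervalIntegrable
    rw [uIcc_of_le ht.1.le]
    exact Icc_subset_Icc_right ht.2.le
  · exact hf.stronglyMeasurableAtFilter_nhdsWithin measurableSet_Icc t |>.filter_mono
      (le_of_eq (nhdsWithin_eq_nhds.2 hn).symm)

theorem continuousOn_primitive {T : ℝ} {f : ℝ → ℝ} (hf : ContinuousOn f (Icc 0 T)) :
    ContinuousOn (fun t => ∫ s in (0 : ℝ)..t, f s) (Icc 0 T) := by
  rcases le_or_gt 0 T with h | h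
  · have := intervalIntegral.continuousOn_primitive_interval (μ := volume) (f := f) (a := 0) (b := T)
      (by rw [uIcc_of_le h]; exact hf.integrableOn_Icc)
    rwa [uIcc_of_le h] at this
  · rw [Icc_eq_empty (not_le.2 h)]; exact continuousOn_empty _

/-- With G, I and J the primitives of a, f and D, the quantity e^{-G}(Y + J) - I is nonincreasing:
since aJ ≥ 0 and e^{-G} ≤ 1, the hypothesis leaves only nonpositive terms in its derivative. The
dissipation is thus estimated together with Y. -/
theorem gronwall_dissipation {T A F : ℝ} {Y Y' a f D : ℝ → ℝ}
    (hY : ∀ t ∈ Icc 0 T, HasDerivWithinAt Y (Y' t) (Icc 0 T) t)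
    (ha : ContinuousOn a (Icc 0 T)) (hf : ContinuousOn f (Icc 0 T)) (hD : ContinuousOn D (Icc 0 T))
    (ha0 : ∀ t ∈ Icc 0 T, 0 ≤ a t) (hf0 : ∀ t ∈ Icc 0 T, 0 ≤ f t) (hD0 : ∀ t ∈ Icc 0 T, 0 ≤ D t)
    (hY0 : ∀ t ∈ Icc 0 T, 0 ≤ Y t) (hle : ∀ t ∈ Icc 0 T, Y' t + D t ≤ a t * Y t + f t)
    (hA : ∫ s in (0 : ℝ)..T, a s ≤ A) (hF : ∫ s in (0 : ℝ)..T, f s ≤ F) {t : ℝ}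
    (ht : t ∈ Icc 0 T) :
    Y t + ∫ s in (0 : ℝ)..t, D s ≤ Real.exp A * (Y 0 + F) := by
  have hT : 0 ≤ T := ht.1.trans ht.2
  have hint : ∀ f : ℝ → ℝ, ContinuousOn f (Icc 0 T) → ∀ s ∈ Icc 0 T, ∀ r ∈ Icc 0 T,
      IntervalIntegrable f volume s r := fun f hf s hs r hr =>
    (hf.mono (uIcc_subset_Icc hs hr)).intervalIntegrable
  have h0m : (0 : ℝ) ∈ Icc 0 T := ⟨le_rfl, hT⟩
  have hTm : T ∈ Icc 0 T := ⟨hT, le_rfl⟩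
  have hmono : ∀ f : ℝ → ℝ, ContinuousOn f (Icc 0 T) → (∀ t ∈ Icc 0 T, 0 ≤ f t) → ∀ s ∈ Icc 0 T,
      0 ≤ ∫ r in (0 : ℝ)..s, f r ∧ ∫ r in (0 : ℝ)..s, f r ≤ ∫ r in (0 : ℝ)..T, f r := by
    intro f hf hf0 s hs
    have h1 : 0 ≤ ∫ r in (0 : ℝ)..s, f r := intervalIntegral.integral_nonneg hs.1 fun r hr =>
      hf0 r ⟨hr.1, hr.2.trans hs.2⟩
    have h2 : 0 ≤ ∫ r in s..T, f r := intervalIntegral.integral_nonneg hs.2 fun r hr =>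
      hf0 r ⟨hs.1.trans hr.1, hr.2⟩
    have h3 := intervalIntegral.integral_add_adjacent_intervals (hint f hf 0 h0m s hs)
      (hint f hf s hs T hTm)
    exact ⟨h1, by linarith⟩
  set G := fun t => ∫ s in (0 : ℝ)..t, a s with hG
  set I := fun t => ∫ s in (0 : ℝ)..t, f s with hI
  set J := fun t => ∫ s in (0 : ℝ)..t, D s with hJ
  set Z := fun t => Real.exp (-G t) * (Y t + J t) - I t with hZ
  have hYc : ContinuousOn Y (Icc 0 T) := fun t ht => (hY t ht).continuousWithinAt
  have hanti : AntitoneOn Z (Icc 0 T) := by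
    have hder : ∀ s ∈ Ioo 0 T, HasDerivAt Z
        (Real.exp (-G s) * (-a s) * (Y s + J s) + Real.exp (-G s) * (Y' s + D s) - f s) s := by
      intro s hs
      have h1 := (hY s (Ioo_subset_Icc_self hs)).hasDerivAt (Icc_mem_nhds hs.1 hs.2)
      exact (((hasDerivAt_primitive ha hs).neg.exp).mul (h1.add (hasDerivAt_primitive hD hs))).sub
        (hasDerivAt_primitive hf hs)
    refine antitoneOn_of_deriv_nonpos (convex_Icc 0 T) ?_ ?_ ?_
    · exact (((continuousOn_primitive ha).neg.rexp).mul (hYc.add (continuousOn_primitive hD))).sub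
        (continuousOn_primitive hf)
    · rw [interior_Icc]
      exact fun s hs => (hder s hs).differentiableAt.differentiableWithinAt
    · rw [interior_Icc]
      intro s hs
      rw [(hder s hs).deriv]
      have hs' := Ioo_subset_Icc_self hs
      have hJ0 := (hmono D hD hD0 s hs').1
      have hG0 := (hmono a ha ha0 s hs').1
      have hexp : Real.exp (-G s) ≤ 1 := Real.exp_le_one_iff.2 (by simpa [hG] using hG0)
      have hpos := Real.exp_pos (-G s)
      have h1 := hle s hs'
      have h2 := ha0 s hs'
      have h3 := hf0 s hs'
      have h4 : 0 ≤ a s * J s := mul_nonneg h2 hJ0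
      have h5 : Real.exp (-G s) * (-a s) * (Y s + J s) + Real.exp (-G s) * (Y' s + D s) - f s =
        Real.exp (-G s) * (Y' s + D s - a s * Y s - f s) - Real.exp (-G s) * (a s * J s)
          - (1 - Real.exp (-G s)) * f s := by ring
      rw [h5]
      have h6 : Real.exp (-G s) * (Y' s + D s - a s * Y s - f s) ≤ 0 :=
        mul_nonpos_of_nonneg_of_nonpos hpos.le (by linarith)
      have h7 : 0 ≤ Real.exp (-G s) * (a s * J s) := mul_nonneg hpos.le h4
      have h8 : 0 ≤ (1 - Real.exp (-G s)) * f s := mul_nonneg (by linarith) h3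
      linarith
  have h1 := hanti h0m ht ht.1
  have hZ0 : Z 0 = Y 0 := by simp [hZ, hG, hI, hJ]
  rw [hZ0] at h1
  have hIle := (hmono f hf hf0 t ht).2.trans hF
  have hGle := (hmono a ha ha0 t ht).2.trans hA
  have h2 : Real.exp (-G t) * (Y t + J t) ≤ Y 0 + F := by
    have : Z t = Real.exp (-G t) * (Y t + J t) - I t := rfl
    have h3 : I t ≤ F := hIle
    linarith
  have h3 : Y t + J t ≤ Real.exp (G t) * (Y 0 + F) := by
    have h4 := mul_le_mul_of_nonneg_left h2 (Real.exp_pos (G t)).le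
    rwa [← mul_assoc, ← Real.exp_add, add_neg_cancel, Real.exp_zero, one_mul] at h4
  refine h3.trans (mul_le_mul_of_nonneg_right (Real.exp_le_exp.2 hGle) ?_)
  have := hY0 0 h0m
  have h5 := (hmono f hf hf0 T hTm).1.trans hF
  linarith

/-! ### Functions that are Lipschitz on balls, and global solutions of ordinary equations -/

/-- Lipschitz continuity on every ball around the origin. -/
def LipOnBalls {E F : Type*} [NormedAddCommGroup E] [NormedAddCommGroup F] (f : E → F) : Prop :=
  ∀ R : ℝ, ∃ K : ℝ, 0 ≤ K ∧ ∀ x y, ‖x‖ ≤ R → ‖y‖ ≤ R → ‖f x - f y‖ ≤ K * ‖x - y‖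

namespace LipOnBalls

variable {E F G : Type*} [NormedAddCommGroup E] [NormedAddCommGroup F] [NormedAddCommGroup G]

theorem of_le {f : E → F} {K : ℝ} (hK : 0 ≤ K) (h : ∀ x y, ‖f x - f y‖ ≤ K * ‖x - y‖) :
    LipOnBalls f := fun _ => ⟨K, hK, fun x y _ _ => h x y⟩

theorem bounded {f : E → F} (hf : LipOnBalls f) (R : ℝ) :
    ∃ C : ℝ, 0 ≤ C ∧ ∀ x, ‖x‖ ≤ R → ‖f x‖ ≤ C := by
  -- The maximum with 0 keeps the origin in the ball when R is negative.
  obtain ⟨K, hK, h⟩ := hf (max R 0)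
  refine ⟨‖f 0‖ + K * max R 0, by positivity, fun x hx => ?_⟩
  have h1 := h x 0 (hx.trans (le_max_left _ _)) (by simp)
  rw [sub_zero] at h1
  have h2 : ‖f x‖ ≤ ‖f 0‖ + ‖f x - f 0‖ := by
    simpa using norm_add_le (f 0) (f x - f 0)
  refine h2.trans (add_le_add_right (h1.trans ?_) _)
  exact mul_le_mul_of_nonneg_left (hx.trans (le_max_left _ _)) hK

theorem continuous {f : E → F} (hf : LipOnBalls f) : Continuous f := by
  refine continuous_iff_continuousAt.2 fun x => ?_
  obtain ⟨K, hK, h⟩ := hf (‖x‖ + 1)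
  rw [ContinuousAt, tendsto_iff_norm_sub_tendsto_zero]
  have hlim : Tendsto (fun y => K * ‖y - x‖) (𝓝 x) (𝓝 0) := by
    have h1 : Continuous fun y => K * ‖y - x‖ := by fun_prop
    simpa using h1.tendsto x
  refine squeeze_zero' (Eventually.of_forall fun y => norm_nonneg _) ?_ hlim
  filter_upwards [Metric.ball_mem_nhds x one_pos] with y hy
  refine h y x ?_ (by linarith)
  rw [mem_ball_iff_norm] at hy
  have := norm_add_le x (y - x)
  rw [add_sub_cancel] at this
  linarith

theorem const (c : F) : LipOnBalls (fun _ : E => c) := of_le le_rfl fun x y => by simp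

theorem add {f g : E → F} (hf : LipOnBalls f) (hg : LipOnBalls g) :
    LipOnBalls fun x => f x + g x := by
  intro R
  obtain ⟨K, hK, h⟩ := hf R
  obtain ⟨K', hK', h'⟩ := hg R
  refine ⟨K + K', by positivity, fun x y hx hy => ?_⟩
  rw [add_sub_add_comm, add_mul]
  exact (norm_add_le _ _).trans (add_le_add (h x y hx hy) (h' x y hx hy))

theorem mul {f g : E → ℂ} (hf : LipOnBalls f) (hg : LipOnBalls g) :
    LipOnBalls fun x => f x * g x := by
  intro R
  obtain ⟨K, hK, h⟩ := hf R
  obtain ⟨K', hK', h'⟩ := hg R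
  obtain ⟨C, hC, hb⟩ := hf.bounded R
  obtain ⟨C', hC', hb'⟩ := hg.bounded R
  refine ⟨C * K' + K * C', by positivity, fun x y hx hy => ?_⟩
  have h1 : f x * g x - f y * g y = f x * (g x - g y) + (f x - f y) * g y := by ring
  rw [h1, add_mul]
  refine (norm_add_le _ _).trans (add_le_add ?_ ?_)
  · rw [norm_mul, mul_assoc]
    exact mul_le_mul (hb x hx) (h' x y hx hy) (norm_nonneg _) hC
  · rw [norm_mul, mul_right_comm]
    exact mul_le_mul (h x y hx hy) (hb' y hy) (norm_nonneg _) (by positivity)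

theorem const_mul (c : ℂ) {f : E → ℂ} (hf : LipOnBalls f) : LipOnBalls fun x => c * f x :=
  (const c).mul hf

theorem neg {f : E → ℂ} (hf : LipOnBalls f) : LipOnBalls fun x => -f x := by
  simpa using hf.const_mul (-1)

theorem sub {f g : E → ℂ} (hf : LipOnBalls f) (hg : LipOnBalls g) :
    LipOnBalls fun x => f x - g x := by
  simpa only [sub_eq_add_neg] using hf.add hg.neg

theorem sum {ι : Type*} {f : ι → E → F} (s : Finset ι) (hf : ∀ i ∈ s, LipOnBalls (f i)) :
    LipOnBalls fun x => ∑ i ∈ s, f i x := by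
  classical
  induction s using Finset.induction_on with
  | empty => simpa using const (E := E) (0 : F)
  | insert i s hi ih =>
    simp only [Finset.sum_insert hi]
    exact (hf i (Finset.mem_insert_self _ _)).add
      (ih fun j hj => hf j (Finset.mem_insert_of_mem hj))

theorem pi {ι : Type*} [Fintype ι] {f : E → ι → F} (hf : ∀ i, LipOnBalls fun x => f x i) :
    LipOnBalls f := by
  intro R
  choose K hK h using fun i => hf i R
  refine ⟨∑ i, K i, Finset.sum_nonneg fun i _ => hK i, fun x y hx hy => ?_⟩
  refine (pi_norm_le_iff_of_nonneg (mul_nonneg (Finset.sum_nonneg fun i _ => hK i)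
    (norm_nonneg _))).2 fun i => (h i x y hx hy).trans ?_
  exact mul_le_mul_of_nonneg_right (Finset.single_le_sum (f := K) (fun i _ => hK i)
    (Finset.mem_univ i)) (norm_nonneg _)

theorem prodMk {f : E → F} {g : E → G} (hf : LipOnBalls f) (hg : LipOnBalls g) :
    LipOnBalls fun x => (f x, g x) := by
  intro R
  obtain ⟨K, hK, h⟩ := hf R
  obtain ⟨K', hK', h'⟩ := hg R
  refine ⟨max K K', le_max_of_le_left hK, fun x y hx hy => ?_⟩
  rw [Prod.mk_sub_mk, Prod.norm_mk]
  exact max_le ((h x y hx hy).trans (mul_le_mul_of_nonneg_right (le_max_left _ _) (norm_nonneg _)))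
    ((h' x y hx hy).trans (mul_le_mul_of_nonneg_right (le_max_right _ _) (norm_nonneg _)))

end LipOnBalls

/-- A cutoff that is `1` on the ball of radius `R` and `0` outside that of radius `R + 1`. -/
def cutoff (R r : ℝ) : ℝ := max 0 (min 1 (R + 1 - r))

theorem cutoff_nonneg (R r : ℝ) : 0 ≤ cutoff R r := le_max_left _ _

theorem cutoff_le_one (R r : ℝ) : cutoff R r ≤ 1 := max_le zero_le_one (min_le_left _ _)

theorem cutoff_eq_one {R r : ℝ} (h : r ≤ R) : cutoff R r = 1 := by
  rw [cutoff, min_eq_left (by linarith), max_eq_right zero_le_one]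

theorem cutoff_eq_zero {R r : ℝ} (h : R + 1 ≤ r) : cutoff R r = 0 :=
  max_eq_left ((min_le_right _ _).trans (by linarith))

theorem abs_cutoff_sub_le (R r s : ℝ) : |cutoff R r - cutoff R s| ≤ |r - s| := by
  unfold cutoff
  refine (abs_max_sub_max_le_max _ _ _ _).trans ?_
  rw [sub_self, abs_zero, max_eq_right (abs_nonneg _)]
  refine (abs_min_sub_min_le_max _ _ _ _).trans ?_
  rw [sub_self, abs_zero, max_eq_right (abs_nonneg _)]
  rw [show R + 1 - r - (R + 1 - s) = -(r - s) by ring, abs_neg]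

/-- The cutoff is 1-Lipschitz and vanishes beyond R + 1. If one of the two points lies in the larger
ball, the product rule applies with f evaluated at that point; if neither does, both values are
zero. -/
theorem exists_lipschitz_cutoff {E : Type*} [NormedAddCommGroup E] [NormedSpace ℝ E] {f : E → E}
    (hf : LipOnBalls f) (R : ℝ) :
    ∃ K C : ℝ≥0, LipschitzWith K (fun x => cutoff R ‖x‖ • f x) ∧
      ∀ x, ‖cutoff R ‖x‖ • f x‖ ≤ C := by
  obtain ⟨K, hK, h⟩ := hf (R + 1)
  obtain ⟨C, hC, hb⟩ := hf.bounded (R + 1)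
  have key : ∀ x y, ‖x‖ ≤ R + 1 →
      ‖cutoff R ‖x‖ • f x - cutoff R ‖y‖ • f y‖ ≤ (K + C) * ‖x - y‖ := by
    intro x y hx
    have h1 : cutoff R ‖x‖ • f x - cutoff R ‖y‖ • f y =
        (cutoff R ‖x‖ - cutoff R ‖y‖) • f x + cutoff R ‖y‖ • (f x - f y) := by
      rw [sub_smul, smul_sub]; abel
    have h2 : ‖(cutoff R ‖x‖ - cutoff R ‖y‖) • f x‖ ≤ C * ‖x - y‖ := by
      rw [norm_smul, mul_comm]
      refine mul_le_mul (hb x hx) ?_ (norm_nonneg _) hC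
      exact (abs_cutoff_sub_le _ _ _).trans (abs_norm_sub_norm_le x y)
    have h3 : ‖cutoff R ‖y‖ • (f x - f y)‖ ≤ K * ‖x - y‖ := by
      rw [norm_smul, Real.norm_eq_abs, abs_of_nonneg (cutoff_nonneg _ _)]
      rcases le_or_gt ‖y‖ (R + 1) with hy | hy
      · exact (mul_le_of_le_one_left (norm_nonneg _) (cutoff_le_one _ _)).trans (h x y hx hy)
      · rw [cutoff_eq_zero hy.le, zero_mul]; positivity
    rw [h1, add_mul, add_comm (K * _)]
    exact (norm_add_le _ _).trans (add_le_add h2 h3)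
  refine ⟨⟨K + C, by positivity⟩, ⟨C, hC⟩, LipschitzWith.of_dist_le_mul fun x y => ?_, fun x => ?_⟩
  · rw [dist_eq_norm, dist_eq_norm]
    rcases le_or_gt ‖x‖ (R + 1) with hx | hx
    · exact key x y hx
    · rcases le_or_gt ‖y‖ (R + 1) with hy | hy
      · rw [norm_sub_rev, norm_sub_rev x]; exact key y x hy
      · rw [cutoff_eq_zero hx.le, cutoff_eq_zero hy.le, zero_smul, zero_smul, sub_zero, norm_zero]
        exact mul_nonneg (add_nonneg hK hC) (norm_nonneg _)
  · rw [norm_smul, Real.norm_eq_abs, abs_of_nonneg (cutoff_nonneg _ _)]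
    rcases le_or_gt ‖x‖ (R + 1) with hx | hx
    · exact (mul_le_of_le_one_left (norm_nonneg _) (cutoff_le_one _ _)).trans (hb x hx)
    · rw [cutoff_eq_zero hx.le, zero_mul]; exact hC

/-- Global solvability from an a priori bound that is stable under multiplying the vector field by
a factor in `[0, 1]`. -/
theorem exists_solution_of_apriori {E : Type*} [NormedAddCommGroup E] [NormedSpace ℝ E]
    [CompleteSpace E] {f : E → E} (hf : LipOnBalls f) {T : ℝ} (hT : 0 ≤ T) (x₀ : E) {R : ℝ}
    (hap : ∀ (x : ℝ → E) (χ : ℝ → ℝ), (∀ t, 0 ≤ χ t ∧ χ t ≤ 1) → x 0 = x₀ →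
      (∀ t ∈ Icc 0 T, HasDerivWithinAt x (χ t • f (x t)) (Icc 0 T) t) →
      ∀ t ∈ Icc 0 T, ‖x t‖ ≤ R) :
    ∃ x : ℝ → E, x 0 = x₀ ∧ ∀ t ∈ Icc 0 T, HasDerivWithinAt x (f (x t)) (Icc 0 T) t := by
  obtain ⟨K, C, hK, hC⟩ := exists_lipschitz_cutoff hf (max R 0)
  -- The cut-off field is bounded by C, so the ball of radius C T contains the solution up to time T
  -- and no smallness of T is needed.
  have hPL : IsPicardLindelof (fun _ x => cutoff (max R 0) ‖x‖ • f x)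
      (⟨0, le_rfl, hT⟩ : Icc 0 T) x₀ (C * ⟨T, hT⟩) 0 C K := by
    refine ⟨fun t _ => hK.lipschitzOnWith, fun x _ => continuousOn_const, fun t _ x _ => hC x, ?_⟩
    simp only [sub_zero, sub_self, max_eq_left hT, NNReal.coe_zero]
    exact le_rfl
  obtain ⟨x, hx0, hx⟩ := hPL.exists_eq_forall_mem_Icc_hasDerivWithinAt₀
  -- The cutoff evaluated along the solution is an admissible factor. The a priori bound then shows
  -- that it equals 1 all the way.
  have hbound := hap x (fun t => cutoff (max R 0) ‖x t‖)
    (fun t => ⟨cutoff_nonneg _ _, cutoff_le_one _ _⟩) hx0 hx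
  refine ⟨x, hx0, fun t ht => ?_⟩
  have := hx t ht
  rwa [cutoff_eq_one ((hbound t ht).trans (le_max_left _ _)), one_smul] at this

end CalmedMHD

end

noncomputable section

namespace CalmedMHD

/-! ### The forcing terms of the three equations, on Fourier coefficients -/

/-- The Fourier coefficients of `∂₁ b₂ - ∂₂ b₁`. -/
def curlCoeff (b : Fin 2 → FSeries) : FSeries := fun k =>
  (2 * Real.pi * Complex.I * (k 0 : ℂ)) * b 1 k - (2 * Real.pi * Complex.I * (k 1 : ℂ)) * b 0 k

/-- The forcing in the velocity equation. -/
def forceU (g : ℝ) (u b : Fin 2 → FSeries) (θ : FSeries) : Fin 2 → FSeries := fun i k =>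
  -leray (fun i => divP u (u i)) i k + leray (fun i => divP b (b i)) i k +
    g * leray ![0, θ] i k

/-- The forcing in the induction equation. -/
def forceB (u b : Fin 2 → FSeries) : Fin 2 → FSeries := fun i k =>
  divP b (u i) k - divP u (b i) k

/-- The forcing in the temperature equation. -/
def forceT (α μ : ℝ) (ζ : ℝ → ℝ) (u b : Fin 2 → FSeries) (θ : FSeries) : FSeries := fun k =>
  -divP u θ k + α * μ * heatCoeff ζ (curlCoeff b) k

theorem isRealValued_zero : IsRealValued 0 := fun k => by simp

theorem IsRealValued.add {c d : FSeries} (hc : IsRealValued c) (hd : IsRealValued d) :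
    IsRealValued (c + d) := fun k => by simp [hc k, hd k]

theorem IsRealValued.sub {c d : FSeries} (hc : IsRealValued c) (hd : IsRealValued d) :
    IsRealValued (c - d) := fun k => by simp [hc k, hd k]

theorem IsRealValued.ofReal_mul {c : FSeries} (hc : IsRealValued c) (r : ℝ) :
    IsRealValued fun k => r * c k := fun k => by simp [hc k]

theorem isRealValued_cons_zero {θ : FSeries} (hθ : IsRealValued θ) (i : Fin 2) :
    IsRealValued ((![0, θ] : Fin 2 → FSeries) i) := by
  fin_cases i
  · exact isRealValued_zero
  · exact hθ

theorem IsSolenoidal.add {v w : Fin 2 → FSeries} (hv : IsSolenoidal v) (hw : IsSolenoidal w) :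
    IsSolenoidal (v + w) := by
  refine ⟨fun i => by simp [hv.1, hw.1], fun k => ?_⟩
  simp only [Pi.add_apply, mul_add, Finset.sum_add_distrib, hv.2, hw.2, add_zero]

/-- The factor may depend on the frequency, which covers scalars, the Laplacian and truncation at
once. -/
theorem IsSolenoidal.const_mul {v : Fin 2 → FSeries} (hv : IsSolenoidal v)
    (c : (Fin 2 → ℤ) → ℂ) : IsSolenoidal fun i k => c k * v i k := by
  refine ⟨fun i => by simp [hv.1], fun k => ?_⟩
  simp only [mul_left_comm _ (c k), ← Finset.mul_sum, hv.2, mul_zero]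

theorem isRealValued_curlCoeff {b : Fin 2 → FSeries} (hb : ∀ i, IsRealValued (b i)) :
    IsRealValued (curlCoeff b) := by
  intro k
  simp only [curlCoeff, hb _ k, Pi.neg_apply, map_sub, map_mul, Complex.conj_I,
    Complex.conj_ofReal, map_ofNat, map_intCast]
  push_cast
  ring

theorem isRealValued_forceU (g : ℝ) {u b : Fin 2 → FSeries} {θ : FSeries}
    (hu : ∀ i, IsRealValued (u i)) (hb : ∀ i, IsRealValued (b i)) (hθ : IsRealValued θ)
    (i : Fin 2) : IsRealValued (forceU g u b θ i) := by
  intro k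
  have h1 := isRealValued_leray (fun i => isRealValued_divP hu (hu i)) i k
  have h2 := isRealValued_leray (fun i => isRealValued_divP hb (hb i)) i k
  have h3 := isRealValued_leray (isRealValued_cons_zero hθ) i k
  simp only [forceU, map_add, map_neg, map_mul, Complex.conj_ofReal, h1, h2, h3]

theorem isRealValued_forceB {u b : Fin 2 → FSeries} (hu : ∀ i, IsRealValued (u i))
    (hb : ∀ i, IsRealValued (b i)) (i : Fin 2) : IsRealValued (forceB u b i) :=
  (isRealValued_divP hb (hu i)).sub (isRealValued_divP hu (hb i))

theorem isRealValued_forceT (α μ : ℝ) (ζ : ℝ → ℝ) {u b : Fin 2 → FSeries} {θ : FSeries}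
    (hu : ∀ i, IsRealValued (u i)) (hθ : IsRealValued θ) : IsRealValued (forceT α μ ζ u b θ) := by
  intro k
  have h1 := isRealValued_divP hu hθ k
  have h2 : heatCoeff ζ (curlCoeff b) (-k) = conj (heatCoeff ζ (curlCoeff b) k) :=
    isRealValued_fnCoeff _ k
  simp only [forceT, map_add, map_neg, map_mul, Complex.conj_ofReal, h1, h2]

theorem isSolenoidal_forceU (g : ℝ) (u b : Fin 2 → FSeries) (θ : FSeries) :
    IsSolenoidal (forceU g u b θ) := by
  have h := (((isSolenoidal_leray fun i => divP u (u i)).const_mul fun _ => -1).add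
    (isSolenoidal_leray fun i => divP b (b i))).add
    ((isSolenoidal_leray ![0, θ]).const_mul fun _ => (g : ℂ))
  convert h using 1
  funext i k
  simp [forceU]

theorem norm_curlCoeff_sq_le (b : Fin 2 → FSeries) (k : Fin 2 → ℤ) :
    ‖curlCoeff b k‖ ^ 2 ≤ 2 * (lapSymbol k * ∑ i, ‖b i k‖ ^ 2) := by
  have h1 : ∀ i j, ‖(2 * Real.pi * Complex.I * (k i : ℂ)) * b j k‖ ≤ freq k * ‖b j k‖ := by
    intro i j
    rw [norm_mul]
    refine mul_le_mul_of_nonneg_right (le_trans (le_of_eq ?_) (two_pi_abs_le_freq k i))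
      (norm_nonneg _)
    simp [abs_of_pos Real.pi_pos]
  have h2 : ‖curlCoeff b k‖ ≤ freq k * ‖b 1 k‖ + freq k * ‖b 0 k‖ :=
    (norm_sub_le _ _).trans (add_le_add (h1 0 1) (h1 1 0))
  have h3 := pow_le_pow_left₀ (norm_nonneg _) h2 2
  rw [← freq_sq, Fin.sum_univ_two]
  nlinarith [sq_nonneg (freq k * ‖b 1 k‖ - freq k * ‖b 0 k‖)]

/-! ### Trigonometric polynomials -/

/-- Real, solenoidal states with Fourier coefficients supported in `B`. -/
structure IsTrig (B : Finset (Fin 2 → ℤ)) (u b : Fin 2 → FSeries) (θ : FSeries) : Prop where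
  supp_u : ∀ i, ∀ k ∉ B, u i k = 0
  supp_b : ∀ i, ∀ k ∉ B, b i k = 0
  supp_θ : ∀ k ∉ B, θ k = 0
  real_u : ∀ i, IsRealValued (u i)
  real_b : ∀ i, IsRealValued (b i)
  real_θ : IsRealValued θ
  sol_u : IsSolenoidal u
  sol_b : IsSolenoidal b

theorem tsum_sq_of_support {B : Finset (Fin 2 → ℤ)} {c : FSeries} (hc : ∀ k ∉ B, c k = 0) :
    ∑' k, ‖c k‖ₑ ^ 2 = ENNReal.ofReal (∑ k ∈ B, ‖c k‖ ^ 2) := by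
  rw [tsum_eq_sum (s := B) fun k hk => by simp [hc k hk],
    ENNReal.ofReal_sum_of_nonneg fun i _ => sq_nonneg _]
  refine Finset.sum_congr rfl fun k _ => ?_
  rw [ENNReal.ofReal_pow (norm_nonneg _), ofReal_norm]

theorem tsum_enorm_of_support {B : Finset (Fin 2 → ℤ)} {c : FSeries} (hc : ∀ k ∉ B, c k = 0) :
    ∑' k, ‖c k‖ₑ = ENNReal.ofReal (∑ k ∈ B, ‖c k‖) := by
  rw [tsum_eq_sum (s := B) fun k hk => by simp [hc k hk],
    ENNReal.ofReal_sum_of_nonneg fun i _ => norm_nonneg _]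
  exact Finset.sum_congr rfl fun k _ => (ofReal_norm _).symm

/-! ### The heating term of a trigonometric polynomial -/

section Heat

variable {B : Finset (Fin 2 → ℤ)} {ζ : ℝ → ℝ} {M : ℝ} {L : ℝ≥0}

/-- The heating of a trigonometric polynomial need not be one, so the modes on the left are
unrelated to those supporting c. -/
theorem sum_sq_heatCoeff_le (hM : ∀ x, |ζ x| ≤ M) (hL : LipschitzWith L ζ) {c : FSeries}
    (hc : IsRealValued c) (hs : ∀ k ∉ B, c k = 0) (B' : Finset (Fin 2 → ℤ)) :
    ∑ k ∈ B', ‖heatCoeff ζ c k‖ ^ 2 ≤ M ^ 2 * ∑ k ∈ B, ‖c k‖ ^ 2 := by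
  have hM0 : 0 ≤ M := (abs_nonneg _).trans (hM 0)
  have h := tsum_sq_heatCoeff_le hM hL hc (by rw [tsum_sq_of_support hs]; simp)
  rw [tsum_sq_of_support hs, ← ENNReal.ofReal_pow hM0, ← ENNReal.ofReal_mul (sq_nonneg _)] at h
  have h2 := (ENNReal.sum_le_tsum B').trans h
  simp_rw [← ofReal_norm, ← ENNReal.ofReal_pow (norm_nonneg _)] at h2
  rw [← ENNReal.ofReal_sum_of_nonneg fun i _ => sq_nonneg _] at h2
  exact (ENNReal.ofReal_le_ofReal_iff (by positivity)).1 h2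

/-- The ℓ² estimate, weakened to sums of norms over finitely many modes. This gives local Lipschitz
continuity on the Galerkin space. -/
theorem norm_heatCoeff_sub_le (hM : ∀ x, |ζ x| ≤ M) (hL : LipschitzWith L ζ) {c d : FSeries}
    (hc : IsRealValued c) (hcs : ∀ k ∉ B, c k = 0) (hd : IsRealValued d)
    (hds : ∀ k ∉ B, d k = 0) (k : Fin 2 → ℤ) :
    ‖heatCoeff ζ c k - heatCoeff ζ d k‖ ≤
      (M + L * ∑ k ∈ B, ‖d k‖) * ∑ k ∈ B, ‖c k - d k‖ := by
  have hM0 : 0 ≤ M := (abs_nonneg _).trans (hM 0)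
  have hsum : 0 ≤ ∑ k ∈ B, ‖d k‖ := Finset.sum_nonneg fun _ _ => norm_nonneg _
  have h := tsum_sq_heatCoeff_sub_le hM hL hc (by rw [tsum_sq_of_support hcs]; simp) hd
    (by rw [tsum_sq_of_support hds]; simp) (by rw [tsum_enorm_of_support hds]; simp)
  have hcd : ∀ k ∉ B, (c - d) k = 0 := fun k hk => by simp [hcs k hk, hds k hk]
  have h3 := tsum_sq_of_support hcd
  simp only [Pi.sub_apply] at h3
  rw [tsum_enorm_of_support hds, ENNReal.toReal_ofReal hsum, h3,
    ← ENNReal.ofReal_pow (by positivity), ← ENNReal.ofReal_mul (sq_nonneg _)] at h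
  have h2 := (ENNReal.le_tsum k).trans h
  simp_rw [← ofReal_norm, ← ENNReal.ofReal_pow (norm_nonneg _)] at h2
  have h4 := (ENNReal.ofReal_le_ofReal_iff (by positivity)).1 h2
  refine le_of_sq_le_sq ?_ (by positivity)
  refine h4.trans ?_
  rw [mul_pow]
  exact mul_le_mul_of_nonneg_left
    (Finset.sum_sq_le_sq_sum_of_nonneg fun i _ => norm_nonneg _) (sq_nonneg _)

end Heat

/-! ### The energy identity -/

section Energy

variable {B : Finset (Fin 2 → ℤ)} {u b : Fin 2 → FSeries} {θ : FSeries}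

theorem sum_conj_mul_divP (hB : ∀ k ∈ B, -k ∈ B) {v : Fin 2 → FSeries} {f h : FSeries}
    (hv : ∀ i, ∀ k ∉ B, v i k = 0) (hs : IsSolenoidal v) (hf : ∀ k ∉ B, f k = 0)
    (hh : ∀ k ∉ B, h k = 0) (hfr : IsRealValued f) (hhr : IsRealValued h) :
    ∑ k ∈ B, conj (h k) * divP v f k = -∑ k ∈ B, conj (f k) * divP v h k := by
  simp_rw [← hfr _, ← hhr _]
  exact sum_mul_divP_antisymm hB hv hs hf hh

theorem sum_conj_mul_divP_self (hB : ∀ k ∈ B, -k ∈ B) {v : Fin 2 → FSeries} {f : FSeries}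
    (hv : ∀ i, ∀ k ∉ B, v i k = 0) (hs : IsSolenoidal v) (hf : ∀ k ∉ B, f k = 0)
    (hfr : IsRealValued f) : ∑ k ∈ B, conj (f k) * divP v f k = 0 :=
  self_eq_neg.1 (sum_conj_mul_divP hB hv hs hf hf hfr hfr)

theorem sum_conj_mul_forceU (g : ℝ) {w : Fin 2 → FSeries} (hw : IsSolenoidal w)
    (k : Fin 2 → ℤ) : ∑ i, conj (w i k) * forceU g u b θ i k =
      ∑ i, conj (w i k) * (divP b (b i) k - divP u (u i) k) + g * (conj (w 1 k) * θ k) := by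
  have h1 := sum_conj_mul_leray hw (fun i => divP u (u i)) k
  have h2 := sum_conj_mul_leray hw (fun i => divP b (b i)) k
  have h3 := sum_conj_mul_leray hw ![0, θ] k
  simp only [Fin.sum_univ_two, forceU] at h1 h2 h3 ⊢
  simp only [Matrix.cons_val_zero, Matrix.cons_val_one, Pi.zero_apply, mul_zero, zero_add] at h3
  linear_combination -h1 + h2 + (g : ℂ) * h3

/-- Transport by u is antisymmetric and drops out of all three equations. Antisymmetry of transport
by b makes the work of the Lorentz force on u the opposite of the stretching work on b. -/
theorem sum_conj_mul_force (hB : ∀ k ∈ B, -k ∈ B) (h : IsTrig B u b θ) (g α μ : ℝ) (ζ : ℝ → ℝ) :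
    ∑ k ∈ B, (∑ i, conj (u i k) * forceU g u b θ i k + ∑ i, conj (b i k) * forceB u b i k +
      conj (θ k) * forceT α μ ζ u b θ k) =
    g * ∑ k ∈ B, conj (u 1 k) * θ k +
      α * μ * ∑ k ∈ B, conj (θ k) * heatCoeff ζ (curlCoeff b) k := by
  have huu := fun i => sum_conj_mul_divP_self hB h.supp_u h.sol_u (h.supp_u i) (h.real_u i)
  have hub := fun i => sum_conj_mul_divP_self hB h.supp_u h.sol_u (h.supp_b i) (h.real_b i)
  have hut := sum_conj_mul_divP_self hB h.supp_u h.sol_u h.supp_θ h.real_θ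
  have hbb := fun i => sum_conj_mul_divP hB h.supp_b h.sol_b (h.supp_b i) (h.supp_u i)
    (h.real_b i) (h.real_u i)
  have h0 := huu 0
  have h1 := huu 1
  have h2 := hub 0
  have h3 := hub 1
  have h4 := hbb 0
  have h5 := hbb 1
  simp only [sum_conj_mul_forceU g h.sol_u, Fin.sum_univ_two, forceB, forceT]
  simp only [mul_add, mul_sub, mul_neg, Finset.sum_add_distrib, Finset.sum_sub_distrib,
    Finset.sum_neg_distrib, Finset.mul_sum] at *
  simp only [mul_left_comm (conj (θ _)) _ (heatCoeff _ _ _), mul_assoc,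
    mul_left_comm (conj (θ _))]
  linear_combination -h0 - h1 - h2 - h3 + h4 + h5 - hut

/-- Weighted sums of squares of Fourier coefficients over `B`. -/
def wsum (B : Finset (Fin 2 → ℤ)) (s : ℕ) (c : FSeries) : ℝ := ∑ k ∈ B, lapSymbol k ^ s * ‖c k‖ ^ 2

theorem wsum_nonneg (B : Finset (Fin 2 → ℤ)) (s : ℕ) (c : FSeries) : 0 ≤ wsum B s c :=
  Finset.sum_nonneg fun k _ => mul_nonneg (pow_nonneg (lapSymbol_nonneg k) _) (sq_nonneg _)

theorem wsum_zero (B : Finset (Fin 2 → ℤ)) (c : FSeries) : wsum B 0 c = ∑ k ∈ B, ‖c k‖ ^ 2 := by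
  simp [wsum]

/-- Buoyancy is bounded by the energy. The heating tested with θ is bounded, by Young's inequality
and the linear L² bound, by a fraction of the magnetic dissipation and a multiple of |θ|². -/
theorem re_sum_force_le {ζ : ℝ → ℝ} {M : ℝ} {L : ℝ≥0} (hM : ∀ x, |ζ x| ≤ M)
    (hL : LipschitzWith L ζ) (hB : ∀ k ∈ B, -k ∈ B) (h : IsTrig B u b θ) {g α μ : ℝ}
    (hg : 0 < g) (hμ : 0 < μ) :
    (∑ k ∈ B, (∑ i, conj (u i k) * forceU g u b θ i k + ∑ i, conj (b i k) * forceB u b i k +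
      conj (θ k) * forceT α μ ζ u b θ k)).re ≤
    μ / 2 * ∑ i, wsum B 1 (b i) +
      (g + |α| * μ * (|α| * M ^ 2 + 1)) * (∑ i, wsum B 0 (u i) + wsum B 0 θ) := by
  rw [sum_conj_mul_force hB h]
  -- Young's weight: the magnetic term comes out as (|α| M² / δ) · μ/2, at most μ/2. The summand 1
  -- keeps δ positive when α or M vanishes.
  set δ := |α| * M ^ 2 + 1 with hδ
  have hδ0 : 0 < δ := by positivity
  have h1 : (g * ∑ k ∈ B, conj (u 1 k) * θ k : ℂ).re ≤
      g * (∑ i, wsum B 0 (u i) + wsum B 0 θ) := by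
    rw [Complex.re_ofReal_mul]
    refine mul_le_mul_of_nonneg_left ?_ hg.le
    refine (Complex.re_le_norm _).trans ((norm_sum_le _ _).trans ?_)
    have h2 : ∀ k ∈ B, ‖conj (u 1 k) * θ k‖ ≤ ‖u 1 k‖ ^ 2 + ‖θ k‖ ^ 2 := by
      intro k _
      rw [norm_mul, Complex.norm_conj]
      nlinarith [sq_nonneg (‖u 1 k‖ - ‖θ k‖), sq_nonneg (‖u 1 k‖ + ‖θ k‖)]
    refine (Finset.sum_le_sum h2).trans ?_
    rw [Finset.sum_add_distrib, Fin.sum_univ_two, wsum_zero B (u 1), wsum_zero B θ]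
    have := wsum_nonneg B 0 (u 0)
    linarith
  have h3 : (α * μ * ∑ k ∈ B, conj (θ k) * heatCoeff ζ (curlCoeff b) k : ℂ).re ≤
      μ / 2 * ∑ i, wsum B 1 (b i) + |α| * μ * δ * wsum B 0 θ := by
    refine (Complex.re_le_norm _).trans ?_
    rw [norm_mul, norm_mul, Complex.norm_real, Complex.norm_real, Real.norm_eq_abs,
      Real.norm_eq_abs, abs_of_pos hμ]
    have h4 : ∀ k ∈ B, ‖conj (θ k) * heatCoeff ζ (curlCoeff b) k‖ ≤
        δ * ‖θ k‖ ^ 2 + 1 / (4 * δ) * ‖heatCoeff ζ (curlCoeff b) k‖ ^ 2 := by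
      intro k _
      rw [norm_mul, Complex.norm_conj]
      have h5 : δ * ‖θ k‖ ^ 2 + 1 / (4 * δ) * ‖heatCoeff ζ (curlCoeff b) k‖ ^ 2 -
          ‖θ k‖ * ‖heatCoeff ζ (curlCoeff b) k‖ =
          1 / (4 * δ) * (2 * δ * ‖θ k‖ - ‖heatCoeff ζ (curlCoeff b) k‖) ^ 2 := by
        field_simp
        ring
      have : 0 ≤ 1 / (4 * δ) * (2 * δ * ‖θ k‖ - ‖heatCoeff ζ (curlCoeff b) k‖) ^ 2 := by positivity
      linarith
    have hcs : ∀ k ∉ B, curlCoeff b k = 0 := fun k hk => by simp [curlCoeff, h.supp_b _ k hk]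
    have h6 : ∑ k ∈ B, ‖heatCoeff ζ (curlCoeff b) k‖ ^ 2 ≤
        M ^ 2 * (2 * ∑ i, wsum B 1 (b i)) := by
      refine (sum_sq_heatCoeff_le hM hL (isRealValued_curlCoeff h.real_b) hcs B).trans ?_
      refine mul_le_mul_of_nonneg_left ?_ (sq_nonneg _)
      refine (Finset.sum_le_sum fun k _ => norm_curlCoeff_sq_le b k).trans (le_of_eq ?_)
      simp only [wsum, pow_one]
      rw [Finset.sum_comm, ← Finset.mul_sum]
      simp_rw [Finset.mul_sum]
    have h7 := (norm_sum_le _ _).trans (Finset.sum_le_sum h4)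
    rw [Finset.sum_add_distrib, ← Finset.mul_sum, ← Finset.mul_sum, ← wsum_zero B θ] at h7
    have hW : 0 ≤ ∑ i, wsum B 1 (b i) := Finset.sum_nonneg fun i _ => wsum_nonneg _ _ _
    have h8 : |α| * (1 / (4 * δ) * (M ^ 2 * (2 * ∑ i, wsum B 1 (b i)))) ≤
        1 / 2 * ∑ i, wsum B 1 (b i) := by
      have h9 : |α| * M ^ 2 / δ ≤ 1 := by rw [div_le_one hδ0, hδ]; linarith
      have h10 : |α| * (1 / (4 * δ) * (M ^ 2 * (2 * ∑ i, wsum B 1 (b i)))) =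
        (|α| * M ^ 2 / δ) * (1 / 2 * ∑ i, wsum B 1 (b i)) := by field_simp; ring
      rw [h10]
      exact mul_le_of_le_one_left (by positivity) h9
    have h11 : 1 / (4 * δ) * ∑ k ∈ B, ‖heatCoeff ζ (curlCoeff b) k‖ ^ 2 ≤
        1 / (4 * δ) * (M ^ 2 * (2 * ∑ i, wsum B 1 (b i))) :=
      mul_le_mul_of_nonneg_left h6 (by positivity)
    have h12 := mul_le_mul_of_nonneg_left (h7.trans (add_le_add_right h11 _))
      (mul_nonneg (abs_nonneg α) hμ.le)
    have h13 := mul_le_mul_of_nonneg_left h8 hμ.le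
    refine h12.trans ?_
    nlinarith
  rw [Complex.add_re]
  have h4 : 0 ≤ |α| * μ * δ * ∑ i, wsum B 0 (u i) :=
    mul_nonneg (by positivity) (Finset.sum_nonneg fun i _ => wsum_nonneg _ _ _)
  nlinarith

end Energy

end CalmedMHD

end

noncomputable section

namespace CalmedMHD

/-! ### The Galerkin system -/

/-- Solutions of the Galerkin system with modes in `B` on `[0, T]`. -/
structure IsGalerkin (B : Finset (Fin 2 → ℤ)) (ν μ κ g α : ℝ) (ζ : ℝ → ℝ) (T : ℝ)
    (u b : ℝ → Fin 2 → FSeries) (θ : ℝ → FSeries) : Prop where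
  trig : ∀ t ∈ Icc 0 T, IsTrig B (u t) (b t) (θ t)
  deriv_u : ∀ t ∈ Icc 0 T, ∀ i, ∀ k ∈ B, HasDerivWithinAt (fun t => u t i k)
    (-(ν * lapSymbol k) * u t i k + forceU g (u t) (b t) (θ t) i k) (Icc 0 T) t
  deriv_b : ∀ t ∈ Icc 0 T, ∀ i, ∀ k ∈ B, HasDerivWithinAt (fun t => b t i k)
    (-(μ * lapSymbol k) * b t i k + forceB (u t) (b t) i k) (Icc 0 T) t
  deriv_θ : ∀ t ∈ Icc 0 T, ∀ k ∈ B, HasDerivWithinAt (fun t => θ t k)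
    (-(κ * lapSymbol k) * θ t k + forceT α μ ζ (u t) (b t) (θ t) k) (Icc 0 T) t
  cont_u : ∀ i, ∀ k ∈ B, ContinuousOn (fun t => forceU g (u t) (b t) (θ t) i k) (Icc 0 T)
  cont_b : ∀ i, ∀ k ∈ B, ContinuousOn (fun t => forceB (u t) (b t) i k) (Icc 0 T)
  cont_θ : ∀ k ∈ B, ContinuousOn (fun t => forceT α μ ζ (u t) (b t) (θ t) k) (Icc 0 T)

theorem hasDerivWithinAt_norm_sq {c : ℝ → ℂ} {c' : ℂ} {s : Set ℝ} {t : ℝ}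
    (h : HasDerivWithinAt c c' s t) :
    HasDerivWithinAt (fun t => ‖c t‖ ^ 2) (2 * (conj (c t) * c').re) s t := by
  have := h.norm_sq
  rwa [Complex.inner, mul_comm c'] at this

variable {B : Finset (Fin 2 → ℤ)}

/-- Extension by zero of coefficients indexed by `B`. -/
def extend (x : B → ℂ) : FSeries := fun k => if h : k ∈ B then x ⟨k, h⟩ else 0

theorem extend_mem (x : B → ℂ) {k : Fin 2 → ℤ} (h : k ∈ B) : extend x k = x ⟨k, h⟩ := dif_pos h

theorem extend_notMem (x : B → ℂ) {k : Fin 2 → ℤ} (h : k ∉ B) : extend x k = 0 := dif_neg h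

theorem extend_restrict (c : FSeries) (k : Fin 2 → ℤ) :
    extend (fun k : B => c k) k = (if k ∈ B then 1 else 0) * c k := by
  unfold extend; split_ifs <;> simp

theorem extend_restrict_eq {c : FSeries} (hc : ∀ k ∉ B, c k = 0) :
    extend (fun k : B => c k) = c := by
  funext k
  rw [extend_restrict]
  split_ifs with h
  · simp
  · simp [hc k h]

theorem extend_add (x y : B → ℂ) : extend (x + y) = extend x + extend y := by
  funext k; unfold extend; simp only [Pi.add_apply]; split_ifs <;> simp

theorem extend_smul (r : ℝ) (x : B → ℂ) : extend (r • x) = fun k => (r : ℂ) * extend x k := by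
  funext k; unfold extend; split_ifs <;> simp

theorem extend_zero : extend (0 : B → ℂ) = 0 := by
  funext k; unfold extend; split_ifs <;> simp

theorem norm_extend_sub_le (x y : B → ℂ) (k : Fin 2 → ℤ) :
    ‖extend x k - extend y k‖ ≤ ‖x - y‖ := by
  by_cases h : k ∈ B
  · rw [extend_mem _ h, extend_mem _ h]
    exact norm_le_pi_norm (x - y) ⟨k, h⟩
  · rw [extend_notMem _ h, extend_notMem _ h, sub_zero, norm_zero]
    exact norm_nonneg _

/-- Coefficients of velocity, magnetic field and temperature with modes in `B`. -/
abbrev Modes (B : Finset (Fin 2 → ℤ)) : Type :=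
  (Fin 2 → B → ℂ) × (Fin 2 → B → ℂ) × (B → ℂ)

theorem isTrig_extend_iff (x : Modes B) :
    IsTrig B (fun i => extend (x.1 i)) (fun i => extend (x.2.1 i)) (extend x.2.2) ↔
      (∀ i, IsRealValued (extend (x.1 i))) ∧ (∀ i, IsRealValued (extend (x.2.1 i))) ∧
      IsRealValued (extend x.2.2) ∧ IsSolenoidal (fun i => extend (x.1 i)) ∧
      IsSolenoidal (fun i => extend (x.2.1 i)) :=
  ⟨fun h => ⟨h.real_u, h.real_b, h.real_θ, h.sol_u, h.sol_b⟩, fun h =>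
    ⟨fun _ _ hk => extend_notMem _ hk, fun _ _ hk => extend_notMem _ hk,
      fun _ hk => extend_notMem _ hk, h.1, h.2.1, h.2.2.1, h.2.2.2.1, h.2.2.2.2⟩⟩

/-- The real vector space of real solenoidal states with modes in `B`. -/
def galerkinSpace (B : Finset (Fin 2 → ℤ)) : Submodule ℝ (Modes B) where
  carrier := {x | IsTrig B (fun i => extend (x.1 i)) (fun i => extend (x.2.1 i)) (extend x.2.2)}
  zero_mem' := by
    have hs : IsSolenoidal 0 := ⟨fun i => rfl, fun k => by simp⟩
    simp only [mem_ofPred_eq, isTrig_extend_iff, Prod.fst_zero, Prod.snd_zero, Pi.zero_apply,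
      extend_zero]
    exact ⟨fun _ => isRealValued_zero, fun _ => isRealValued_zero, isRealValued_zero, hs, hs⟩
  add_mem' := by
    intro x y hx hy
    simp only [mem_ofPred_eq, isTrig_extend_iff, Prod.fst_add, Prod.snd_add, Pi.add_apply,
      extend_add] at hx hy ⊢
    exact ⟨fun i => (hx.1 i).add (hy.1 i), fun i => (hx.2.1 i).add (hy.2.1 i),
      hx.2.2.1.add hy.2.2.1, hx.2.2.2.1.add hy.2.2.2.1, hx.2.2.2.2.add hy.2.2.2.2⟩
  smul_mem' := by
    intro r x hx
    simp only [mem_ofPred_eq, isTrig_extend_iff, Prod.smul_fst, Prod.smul_snd, Pi.smul_apply,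
      extend_smul] at hx ⊢
    exact ⟨fun i => (hx.1 i).ofReal_mul r, fun i => (hx.2.1 i).ofReal_mul r,
      hx.2.2.1.ofReal_mul r, hx.2.2.2.1.const_mul _, hx.2.2.2.2.const_mul _⟩

theorem IsRealValued.extend_restrict (hB : ∀ k ∈ B, -k ∈ B) {c : FSeries} (hc : IsRealValued c) :
    IsRealValued (extend fun k : B => c k) := by
  intro k
  have h : -k ∈ B ↔ k ∈ B := ⟨fun h => by simpa using hB _ h, hB k⟩
  rw [CalmedMHD.extend_restrict, CalmedMHD.extend_restrict, hc k]
  simp only [h]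
  split_ifs <;> simp

theorem IsSolenoidal.extend_restrict {v : Fin 2 → FSeries} (hv : IsSolenoidal v) :
    IsSolenoidal fun i => extend fun k : B => v i k := by
  have := hv.const_mul fun k => if k ∈ B then 1 else 0
  convert this using 3
  exact CalmedMHD.extend_restrict _ _

theorem isRealValued_lapSymbol_mul {c : FSeries} (hc : IsRealValued c) (ν : ℝ) :
    IsRealValued fun k => -((ν : ℂ) * lapSymbol k) * c k := fun k => by
  simp [hc k, lapSymbol_neg]

theorem restrict_mem_galerkinSpace (hB : ∀ k ∈ B, -k ∈ B) {u b : Fin 2 → FSeries} {θ : FSeries}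
    (hu : ∀ i, IsRealValued (u i)) (hb : ∀ i, IsRealValued (b i)) (hθ : IsRealValued θ)
    (hus : IsSolenoidal u) (hbs : IsSolenoidal b) :
    ((fun i k => u i k, fun i k => b i k, fun k => θ k) : Modes B) ∈ galerkinSpace B :=
  (isTrig_extend_iff _).2 ⟨fun i => (hu i).extend_restrict hB, fun i => (hb i).extend_restrict hB,
    hθ.extend_restrict hB, hus.extend_restrict, hbs.extend_restrict⟩

/-- The velocity of a Galerkin state. -/
def velo (x : galerkinSpace B) : Fin 2 → FSeries := fun i => extend (x.1.1 i)

/-- The magnetic field of a Galerkin state. -/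
def magn (x : galerkinSpace B) : Fin 2 → FSeries := fun i => extend (x.1.2.1 i)

/-- The temperature of a Galerkin state. -/
def temp (x : galerkinSpace B) : FSeries := extend x.1.2.2

theorem isTrig_state (x : galerkinSpace B) : IsTrig B (velo x) (magn x) (temp x) := x.2

/-- The vector field of the Galerkin system. -/
def galerkinField (hB : ∀ k ∈ B, -k ∈ B) (ν μ κ g α : ℝ) (ζ : ℝ → ℝ) (x : galerkinSpace B) :
    galerkinSpace B :=
  ⟨(fun i k => -(ν * lapSymbol k) * velo x i k + forceU g (velo x) (magn x) (temp x) i k,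
    fun i k => -(μ * lapSymbol k) * magn x i k + forceB (velo x) (magn x) i k,
    fun k => -(κ * lapSymbol k) * temp x k + forceT α μ ζ (velo x) (magn x) (temp x) k), by
    have h := isTrig_state x
    have hl : ∀ c : FSeries, (∀ k ∉ B, c k = 0) → ∑' k, ‖c k‖ₑ ^ 2 < ⊤ := fun c hc => by
      rw [tsum_sq_of_support hc]; simp
    refine restrict_mem_galerkinSpace hB
      (u := fun i k => -(ν * lapSymbol k) * velo x i k + forceU g (velo x) (magn x) (temp x) i k)
      (b := fun i k => -(μ * lapSymbol k) * magn x i k + forceB (velo x) (magn x) i k)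
      (θ := fun k => -(κ * lapSymbol k) * temp x k + forceT α μ ζ (velo x) (magn x) (temp x) k)
      (fun i => ?_) (fun i => ?_) ?_ ?_ ?_
    · exact (isRealValued_lapSymbol_mul (h.real_u i) ν).add
        (isRealValued_forceU g h.real_u h.real_b h.real_θ i)
    · exact (isRealValued_lapSymbol_mul (h.real_b i) μ).add
        (isRealValued_forceB h.real_u h.real_b i)
    · exact (isRealValued_lapSymbol_mul h.real_θ κ).add
        (isRealValued_forceT α μ ζ h.real_u h.real_θ)
    · exact (h.sol_u.const_mul _).add (isSolenoidal_forceU g _ _ _)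
    -- No projection occurs in the induction equation; its nonlinear part is solenoidal by itself.
    · exact (h.sol_b.const_mul _).add (isSolenoidal_induction (fun i => hl _ (h.supp_u i))
        fun i => hl _ (h.supp_b i))⟩

/-! ### Local Lipschitz continuity of the Galerkin vector field -/

section Lipschitz

theorem lipOnBalls_velo (i : Fin 2) (k : Fin 2 → ℤ) :
    LipOnBalls fun x : galerkinSpace B => velo x i k :=
  LipOnBalls.of_le zero_le_one fun x y => by
    rw [one_mul]
    refine (norm_extend_sub_le _ _ k).trans ((norm_le_pi_norm (x.1.1 - y.1.1) i).trans ?_)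
    exact norm_fst_le (x.1 - y.1)

theorem lipOnBalls_magn (i : Fin 2) (k : Fin 2 → ℤ) :
    LipOnBalls fun x : galerkinSpace B => magn x i k :=
  LipOnBalls.of_le zero_le_one fun x y => by
    rw [one_mul]
    refine (norm_extend_sub_le _ _ k).trans ((norm_le_pi_norm (x.1.2.1 - y.1.2.1) i).trans ?_)
    exact (norm_fst_le (x.1.2 - y.1.2)).trans (norm_snd_le (x.1 - y.1))

theorem lipOnBalls_temp (k : Fin 2 → ℤ) : LipOnBalls fun x : galerkinSpace B => temp x k :=
  LipOnBalls.of_le zero_le_one fun x y => by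
    rw [one_mul]
    refine (norm_extend_sub_le _ _ k).trans ?_
    exact (norm_snd_le (x.1.2 - y.1.2)).trans (norm_snd_le (x.1 - y.1))

theorem lipOnBalls_divP {v : galerkinSpace B → Fin 2 → FSeries} {w : galerkinSpace B → FSeries}
    (hvs : ∀ x i, ∀ k ∉ B, v x i k = 0) (hv : ∀ i k, LipOnBalls fun x => v x i k)
    (hw : ∀ k, LipOnBalls fun x => w x k) (k : Fin 2 → ℤ) :
    LipOnBalls fun x => divP (v x) (w x) k := by
  simp only [divP_eq_sum (hvs _)]
  refine LipOnBalls.sum _ fun l _ => LipOnBalls.mul ?_ (hw _)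
  exact LipOnBalls.sum _ fun j _ => (hv j l).const_mul _

theorem lipOnBalls_leray {v : galerkinSpace B → Fin 2 → FSeries}
    (hv : ∀ i k, LipOnBalls fun x => v x i k) (i : Fin 2) (k : Fin 2 → ℤ) :
    LipOnBalls fun x => leray (v x) i k := by
  unfold leray
  split_ifs with h
  · exact LipOnBalls.const 0
  · simp only [div_eq_mul_inv]
    refine (hv i k).sub (LipOnBalls.mul (LipOnBalls.const_mul _ ?_) (LipOnBalls.const _))
    exact LipOnBalls.sum _ fun j _ => (hv j k).const_mul _

/-- The curl depends linearly on the state, so on a ball its finitely many coefficients are bounded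
and Lipschitz, and `norm_heatCoeff_sub_le` applies with these constants. -/
theorem lipOnBalls_heatCoeff {ζ : ℝ → ℝ} {M : ℝ} {L : ℝ≥0} (hM : ∀ x, |ζ x| ≤ M)
    (hL : LipschitzWith L ζ) (k : Fin 2 → ℤ) :
    LipOnBalls fun x : galerkinSpace B => heatCoeff ζ (curlCoeff (magn x)) k := by
  have hM0 : 0 ≤ M := (abs_nonneg _).trans (hM 0)
  have hc : ∀ l, LipOnBalls fun x : galerkinSpace B => curlCoeff (magn x) l := fun l =>
    ((lipOnBalls_magn 1 l).const_mul _).sub ((lipOnBalls_magn 0 l).const_mul _)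
  have hs : ∀ x : galerkinSpace B, ∀ k ∉ B, curlCoeff (magn x) k = 0 := fun x k hk => by
    simp [curlCoeff, (isTrig_state x).supp_b _ k hk]
  have hr : ∀ x : galerkinSpace B, IsRealValued (curlCoeff (magn x)) := fun x =>
    isRealValued_curlCoeff (isTrig_state x).real_b
  intro R
  choose C hC hb using fun l => (hc l).bounded R
  choose K hK hl using fun l => hc l R
  refine ⟨(M + L * ∑ l ∈ B, C l) * ∑ l ∈ B, K l, mul_nonneg (add_nonneg hM0 (mul_nonneg L.2
    (Finset.sum_nonneg fun l _ => hC l))) (Finset.sum_nonneg fun l _ => hK l), fun x y hx hy => ?_⟩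
  refine (norm_heatCoeff_sub_le hM hL (hr x) (hs x) (hr y) (hs y) k).trans ?_
  rw [mul_assoc]
  refine mul_le_mul ?_ ?_ (Finset.sum_nonneg fun _ _ => norm_nonneg _)
    (add_nonneg hM0 (mul_nonneg L.2 (Finset.sum_nonneg fun l _ => hC l)))
  · exact add_le_add_right (mul_le_mul_of_nonneg_left
      (Finset.sum_le_sum fun l _ => hb l y hy) L.2) M
  · rw [Finset.sum_mul]
    exact Finset.sum_le_sum fun l _ => hl l x y hx hy

theorem lipOnBalls_galerkinField {ζ : ℝ → ℝ} {M : ℝ} {L : ℝ≥0} (hM : ∀ x, |ζ x| ≤ M)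
    (hL : LipschitzWith L ζ) (hB : ∀ k ∈ B, -k ∈ B) (ν μ κ g α : ℝ) :
    LipOnBalls (galerkinField hB ν μ κ g α ζ) := by
  have hus : ∀ x : galerkinSpace B, ∀ i, ∀ k ∉ B, velo x i k = 0 := fun x =>
    (isTrig_state x).supp_u
  have hbs : ∀ x : galerkinSpace B, ∀ i, ∀ k ∉ B, magn x i k = 0 := fun x =>
    (isTrig_state x).supp_b
  have h : LipOnBalls fun x : galerkinSpace B => (galerkinField hB ν μ κ g α ζ x : Modes B) := by
    refine LipOnBalls.prodMk (LipOnBalls.pi fun i => LipOnBalls.pi fun k => ?_)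
      (LipOnBalls.prodMk (LipOnBalls.pi fun i => LipOnBalls.pi fun k => ?_)
        (LipOnBalls.pi fun k => ?_))
    · refine ((lipOnBalls_velo i _).const_mul _).add (((LipOnBalls.neg ?_).add ?_).add
        (LipOnBalls.const_mul _ ?_))
      · exact lipOnBalls_leray (fun i k => lipOnBalls_divP hus lipOnBalls_velo
          (lipOnBalls_velo i) k) i k
      · exact lipOnBalls_leray (fun i k => lipOnBalls_divP hbs lipOnBalls_magn
          (lipOnBalls_magn i) k) i k
      · refine lipOnBalls_leray (fun i k => ?_) i k
        fin_cases i
        · exact LipOnBalls.const 0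
        · exact lipOnBalls_temp k
    · exact ((lipOnBalls_magn i _).const_mul _).add
        ((lipOnBalls_divP hbs lipOnBalls_magn (lipOnBalls_velo i) k).sub
          (lipOnBalls_divP hus lipOnBalls_velo (lipOnBalls_magn i) k))
    · exact ((lipOnBalls_temp _).const_mul _).add
        ((lipOnBalls_divP hus lipOnBalls_velo lipOnBalls_temp k).neg.add
          ((lipOnBalls_heatCoeff hM hL k).const_mul _))
  exact h

end Lipschitz

/-! ### The energy balance and global solvability -/

theorem hasDerivWithinAt_wsum {c : ℝ → FSeries} {c' : FSeries} {S : Set ℝ} {t : ℝ} (s : ℕ)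
    (h : ∀ k ∈ B, HasDerivWithinAt (fun t => c t k) (c' k) S t) :
    HasDerivWithinAt (fun t => wsum B s (c t))
      (∑ k ∈ B, lapSymbol k ^ s * (2 * (conj (c t k) * c' k).re)) S t := by
  unfold wsum
  exact HasDerivWithinAt.fun_sum fun k hk => (hasDerivWithinAt_norm_sq (h k hk)).const_mul _

theorem sum_dissipation (s : ℕ) (χ ν : ℝ) (c f : FSeries) :
    ∑ k ∈ B, lapSymbol k ^ s * (2 * (conj (c k) * (χ * (-(ν * lapSymbol k) * c k + f k))).re) =
      2 * χ * (-ν * wsum B (s + 1) c + ∑ k ∈ B, lapSymbol k ^ s * (conj (c k) * f k).re) := by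
  unfold wsum
  rw [Finset.mul_sum, ← Finset.sum_add_distrib, Finset.mul_sum]
  refine Finset.sum_congr rfl fun k _ => ?_
  have h : conj (c k) * (χ * (-(ν * lapSymbol k) * c k + f k)) =
      ((χ * (-(ν * lapSymbol k)) : ℝ) : ℂ) * (conj (c k) * c k) + (χ : ℂ) * (conj (c k) * f k) := by
    push_cast; ring
  rw [h, Complex.add_re, Complex.re_ofReal_mul, Complex.re_ofReal_mul,
    ← Complex.normSq_eq_conj_mul_self, Complex.ofReal_re, Complex.normSq_eq_norm_sq]
  ring

/-- The total energy of a state. -/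
def energy (B : Finset (Fin 2 → ℤ)) (u b : Fin 2 → FSeries) (θ : FSeries) : ℝ :=
  ∑ i, wsum B 0 (u i) + ∑ i, wsum B 0 (b i) + wsum B 0 θ

theorem energy_nonneg (u b : Fin 2 → FSeries) (θ : FSeries) : 0 ≤ energy B u b θ :=
  add_nonneg (add_nonneg (Finset.sum_nonneg fun _ _ => wsum_nonneg _ _ _)
    (Finset.sum_nonneg fun _ _ => wsum_nonneg _ _ _)) (wsum_nonneg _ _ _)

theorem norm_sq_le_wsum (c : FSeries) {k : Fin 2 → ℤ} (hk : k ∈ B) : ‖c k‖ ^ 2 ≤ wsum B 0 c := by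
  rw [wsum_zero]
  exact Finset.single_le_sum (f := fun k => ‖c k‖ ^ 2) (fun _ _ => sq_nonneg _) hk

/-- The growth rate of the energy. -/
def energyRate (μ g α M : ℝ) : ℝ := 2 * (g + |α| * μ * (|α| * M ^ 2 + 1))

theorem energyRate_nonneg {μ g α M : ℝ} (hg : 0 < g) (hμ : 0 < μ) : 0 ≤ energyRate μ g α M := by
  unfold energyRate; positivity

/-- The derivative of the energy is twice the pairing, so the heating consumes μ of the 2μ in front
of the magnetic dissipation; the velocity and temperature keep theirs in full, hence the second
dissipative term. The factor χ serves both the cut-off system and, for χ = 1, the Galerkin system.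
-/
theorem exists_energy_deriv {ζ : ℝ → ℝ} {M : ℝ} {L : ℝ≥0} (hM : ∀ x, |ζ x| ≤ M)
    (hL : LipschitzWith L ζ) (hB : ∀ k ∈ B, -k ∈ B) {ν μ κ g α : ℝ} (hμ : 0 < μ)
    (hg : 0 < g) {u b : ℝ → Fin 2 → FSeries} {θ : ℝ → FSeries}
    {S : Set ℝ} {t χ : ℝ} (hχ : 0 ≤ χ) (htrig : IsTrig B (u t) (b t) (θ t))
    (hu : ∀ i, ∀ k ∈ B, HasDerivWithinAt (fun t => u t i k)
      (χ * (-(ν * lapSymbol k) * u t i k + forceU g (u t) (b t) (θ t) i k)) S t)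
    (hb : ∀ i, ∀ k ∈ B, HasDerivWithinAt (fun t => b t i k)
      (χ * (-(μ * lapSymbol k) * b t i k + forceB (u t) (b t) i k)) S t)
    (hθ : ∀ k ∈ B, HasDerivWithinAt (fun t => θ t k)
      (χ * (-(κ * lapSymbol k) * θ t k + forceT α μ ζ (u t) (b t) (θ t) k)) S t) :
    ∃ E' : ℝ, HasDerivWithinAt (fun t => energy B (u t) (b t) (θ t)) E' S t ∧
      E' + χ * (ν * ∑ i, wsum B 1 (u t i) + μ * ∑ i, wsum B 1 (b t i) + κ * wsum B 1 (θ t)) +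
        χ * (ν * ∑ i, wsum B 1 (u t i) + κ * wsum B 1 (θ t)) ≤
      χ * (energyRate μ g α M * energy B (u t) (b t) (θ t)) := by
  refine ⟨_, ((HasDerivWithinAt.fun_sum fun i _ => hasDerivWithinAt_wsum 0 (hu i)).add
    (HasDerivWithinAt.fun_sum fun i _ => hasDerivWithinAt_wsum 0 (hb i))).add
    (hasDerivWithinAt_wsum 0 hθ), ?_⟩
  have h := re_sum_force_le (θ := θ t) hM hL hB htrig (g := g) (α := α) (μ := μ) hg hμ
  simp only [Complex.re_sum, Complex.add_re, Fin.sum_univ_two, Finset.sum_add_distrib] at h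
  simp only [sum_dissipation]
  simp only [pow_zero, one_mul, Fin.sum_univ_two, zero_add]
  unfold energyRate energy
  have hE : (g + |α| * μ * (|α| * M ^ 2 + 1)) * (wsum B 0 (u t 0) + wsum B 0 (u t 1) +
      wsum B 0 (θ t)) ≤ (g + |α| * μ * (|α| * M ^ 2 + 1)) *
      (∑ i, wsum B 0 (u t i) + ∑ i, wsum B 0 (b t i) + wsum B 0 (θ t)) := by
    refine mul_le_mul_of_nonneg_left ?_ (by positivity)
    rw [Fin.sum_univ_two, Fin.sum_univ_two]
    have := wsum_nonneg B 0 (b t 0)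
    have := wsum_nonneg B 0 (b t 1)
    linarith
  have h2 := mul_le_mul_of_nonneg_left (h.trans (add_le_add_right hE _)) hχ
  simp only [Fin.sum_univ_two] at h2 ⊢
  nlinarith

/-- The state space carries the supremum norm over components and modes, which is below the ℓ² norm
measured by the energy. -/
theorem norm_le_sqrt_energy (x : galerkinSpace B) :
    ‖x‖ ≤ √(energy B (velo x) (magn x) (temp x)) := by
  have hu0 : ∀ i, wsum B 0 (velo x i) ≤ ∑ i, wsum B 0 (velo x i) := fun i =>
    Finset.single_le_sum (f := fun i => wsum B 0 (velo x i))
      (fun _ _ => wsum_nonneg _ _ _) (Finset.mem_univ i)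
  have hb0 : ∀ i, wsum B 0 (magn x i) ≤ ∑ i, wsum B 0 (magn x i) := fun i =>
    Finset.single_le_sum (f := fun i => wsum B 0 (magn x i))
      (fun _ _ => wsum_nonneg _ _ _) (Finset.mem_univ i)
  have hθ0 := wsum_nonneg B 0 (temp x)
  have hu1 := (wsum_nonneg B 0 (velo x 0)).trans (hu0 0)
  have hb1 := (wsum_nonneg B 0 (magn x 0)).trans (hb0 0)
  have hR0 : 0 ≤ √(energy B (velo x) (magn x) (temp x)) := Real.sqrt_nonneg _
  refine max_le ?_ (max_le ?_ ?_)
  · refine (pi_norm_le_iff_of_nonneg hR0).2 fun i => (pi_norm_le_iff_of_nonneg hR0).2 fun k => ?_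
    have h1 := norm_sq_le_wsum (velo x i) k.2
    rw [velo, extend_mem _ k.2] at h1
    refine Real.le_sqrt_of_sq_le (h1.trans ((hu0 i).trans ?_))
    unfold energy; linarith
  · refine (pi_norm_le_iff_of_nonneg hR0).2 fun i => (pi_norm_le_iff_of_nonneg hR0).2 fun k => ?_
    have h1 := norm_sq_le_wsum (magn x i) k.2
    rw [magn, extend_mem _ k.2] at h1
    refine Real.le_sqrt_of_sq_le (h1.trans ((hb0 i).trans ?_))
    unfold energy; linarith
  · refine (pi_norm_le_iff_of_nonneg hR0).2 fun k => ?_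
    have h1 := norm_sq_le_wsum (temp x) k.2
    rw [show temp x k = x.1.2.2 k from extend_mem _ k.2] at h1
    refine Real.le_sqrt_of_sq_le (h1.trans ?_)
    unfold energy; linarith

/-! ### Differentiation of single Fourier coefficients along a curve of states -/

section Coordinates

variable {S : Set ℝ} {t : ℝ} {x : ℝ → galerkinSpace B} {y : galerkinSpace B}

theorem hasDerivWithinAt_velo (h : HasDerivWithinAt x y S t) (ht : t ∈ S) (i : Fin 2)
    {k : Fin 2 → ℤ} (hk : k ∈ B) : HasDerivWithinAt (fun t => velo (x t) i k) (velo y i k) S t := by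
  have h1 := (((ContinuousLinearMap.proj (R := ℝ) (φ := fun _ : B => ℂ) ⟨k, hk⟩).comp
    ((ContinuousLinearMap.proj (R := ℝ) (φ := fun _ : Fin 2 => B → ℂ) i).comp
    (ContinuousLinearMap.fst ℝ _ ((Fin 2 → B → ℂ) × (B → ℂ))))).comp
      (galerkinSpace B).subtypeL).hasFDerivAt.comp_hasDerivWithinAt t h
  have h2 : ∀ y : galerkinSpace B, velo y i k = y.1.1 i ⟨k, hk⟩ := fun y => extend_mem _ hk
  exact (h1.congr_of_mem (fun t _ => h2 (x t)) ht).congr_deriv (h2 y).symm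

theorem hasDerivWithinAt_magn (h : HasDerivWithinAt x y S t) (ht : t ∈ S) (i : Fin 2)
    {k : Fin 2 → ℤ} (hk : k ∈ B) : HasDerivWithinAt (fun t => magn (x t) i k) (magn y i k) S t := by
  have h1 := (((ContinuousLinearMap.proj (R := ℝ) (φ := fun _ : B => ℂ) ⟨k, hk⟩).comp
    ((ContinuousLinearMap.proj (R := ℝ) (φ := fun _ : Fin 2 => B → ℂ) i).comp
    ((ContinuousLinearMap.fst ℝ _ (B → ℂ)).comp
      (ContinuousLinearMap.snd ℝ (Fin 2 → B → ℂ) _)))).comp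
      (galerkinSpace B).subtypeL).hasFDerivAt.comp_hasDerivWithinAt t h
  have h2 : ∀ y : galerkinSpace B, magn y i k = y.1.2.1 i ⟨k, hk⟩ := fun y => extend_mem _ hk
  exact (h1.congr_of_mem (fun t _ => h2 (x t)) ht).congr_deriv (h2 y).symm

theorem hasDerivWithinAt_temp (h : HasDerivWithinAt x y S t) (ht : t ∈ S)
    {k : Fin 2 → ℤ} (hk : k ∈ B) : HasDerivWithinAt (fun t => temp (x t) k) (temp y k) S t := by
  have h1 := (((ContinuousLinearMap.proj (R := ℝ) (φ := fun _ : B => ℂ) ⟨k, hk⟩).comp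
    ((ContinuousLinearMap.snd ℝ (Fin 2 → B → ℂ) _).comp
      (ContinuousLinearMap.snd ℝ (Fin 2 → B → ℂ) _))).comp
      (galerkinSpace B).subtypeL).hasFDerivAt.comp_hasDerivWithinAt t h
  have h2 : ∀ y : galerkinSpace B, temp y k = y.1.2.2 ⟨k, hk⟩ := fun y => extend_mem _ hk
  exact (h1.congr_of_mem (fun t _ => h2 (x t)) ht).congr_deriv (h2 y).symm

end Coordinates

theorem coords_smul_galerkinField (hB : ∀ k ∈ B, -k ∈ B) (ν μ κ g α : ℝ) (ζ : ℝ → ℝ) (χ : ℝ)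
    (x : galerkinSpace B) {k : Fin 2 → ℤ} (hk : k ∈ B) :
    (∀ i, velo (χ • galerkinField hB ν μ κ g α ζ x) i k = χ * (-(ν * lapSymbol k) * velo x i k +
      forceU g (velo x) (magn x) (temp x) i k)) ∧
    (∀ i, magn (χ • galerkinField hB ν μ κ g α ζ x) i k = χ * (-(μ * lapSymbol k) * magn x i k +
      forceB (velo x) (magn x) i k)) ∧
    temp (χ • galerkinField hB ν μ κ g α ζ x) k = χ * (-(κ * lapSymbol k) * temp x k +
      forceT α μ ζ (velo x) (magn x) (temp x) k) := by
  refine ⟨fun i => ?_, fun i => ?_, ?_⟩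
  · rw [velo, extend_mem _ hk, ← Complex.real_smul]; rfl
  · rw [magn, extend_mem _ hk, ← Complex.real_smul]; rfl
  · rw [temp, extend_mem _ hk, ← Complex.real_smul]; rfl

/-- Dropping the dissipation and using χ ≤ 1 gives a growth rate independent of χ, as required of an
a priori bound for cut-off fields. -/
theorem exists_energy_deriv_curve {ζ : ℝ → ℝ} {M : ℝ} {L : ℝ≥0} (hM : ∀ x, |ζ x| ≤ M)
    (hL : LipschitzWith L ζ) (hB : ∀ k ∈ B, -k ∈ B) {ν μ κ g α : ℝ} (hν : 0 < ν) (hμ : 0 < μ)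
    (hκ : 0 < κ) (hg : 0 < g) {S : Set ℝ} {t χ : ℝ} (ht : t ∈ S) (hχ : 0 ≤ χ ∧ χ ≤ 1)
    {x : ℝ → galerkinSpace B}
    (hx : HasDerivWithinAt x (χ • galerkinField hB ν μ κ g α ζ (x t)) S t) :
    ∃ E' : ℝ, HasDerivWithinAt
      (fun t => energy B (velo (x t)) (magn (x t)) (temp (x t))) E' S t ∧
      E' ≤ energyRate μ g α M * energy B (velo (x t)) (magn (x t)) (temp (x t)) := by
  have hc := fun k hk => coords_smul_galerkinField hB ν μ κ g α ζ χ (x t) (k := k) hk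
  obtain ⟨E', hE', hle⟩ := exists_energy_deriv (ν := ν) (κ := κ) hM hL hB hμ hg hχ.1
    (u := fun t => velo (x t)) (b := fun t => magn (x t)) (θ := fun t => temp (x t))
    (isTrig_state (x t))
    (fun i k hk => (hasDerivWithinAt_velo hx ht i hk).congr_deriv ((hc k hk).1 i))
    (fun i k hk => (hasDerivWithinAt_magn hx ht i hk).congr_deriv ((hc k hk).2.1 i))
    (fun k hk => (hasDerivWithinAt_temp hx ht hk).congr_deriv (hc k hk).2.2)
  refine ⟨E', hE', ?_⟩
  have h4 : χ * (energyRate μ g α M * energy B (velo (x t)) (magn (x t)) (temp (x t))) ≤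
      energyRate μ g α M * energy B (velo (x t)) (magn (x t)) (temp (x t)) :=
    mul_le_of_le_one_left (mul_nonneg (energyRate_nonneg hg hμ) (energy_nonneg _ _ _)) hχ.2
  have h5 : 0 ≤ ∑ i, wsum B 1 (velo (x t) i) := Finset.sum_nonneg fun _ _ => wsum_nonneg _ _ _
  have h6 : 0 ≤ ∑ i, wsum B 1 (magn (x t) i) := Finset.sum_nonneg fun _ _ => wsum_nonneg _ _ _
  have h7 := wsum_nonneg B 1 (temp (x t))
  have h9 := mul_nonneg hχ.1 (add_nonneg (add_nonneg (mul_nonneg hν.le h5) (mul_nonneg hμ.le h6))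
    (mul_nonneg hκ.le h7))
  have h10 := mul_nonneg hχ.1 (add_nonneg (mul_nonneg hν.le h5) (mul_nonneg hκ.le h7))
  linarith

/-- The field is locally Lipschitz, and Grönwall's inequality for the energy supplies the a priori
bound on the norm of the state. -/
theorem exists_galerkin {ζ : ℝ → ℝ} {M : ℝ} {L : ℝ≥0} (hM : ∀ x, |ζ x| ≤ M)
    (hL : LipschitzWith L ζ) (hB : ∀ k ∈ B, -k ∈ B) {ν μ κ g α : ℝ} (hν : 0 < ν) (hμ : 0 < μ)
    (hκ : 0 < κ) (hg : 0 < g) {T : ℝ} (hT : 0 ≤ T) {u₀ b₀ : Fin 2 → FSeries} {θ₀ : FSeries}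
    (h₀ : IsTrig B u₀ b₀ θ₀) :
    ∃ (u b : ℝ → Fin 2 → FSeries) (θ : ℝ → FSeries), u 0 = u₀ ∧ b 0 = b₀ ∧ θ 0 = θ₀ ∧
      IsGalerkin B ν μ κ g α ζ T u b θ := by
  set x₀ : galerkinSpace B := ⟨_, restrict_mem_galerkinSpace hB h₀.real_u h₀.real_b h₀.real_θ
    h₀.sol_u h₀.sol_b⟩ with hx₀
  obtain ⟨x, hx0, hx⟩ := exists_solution_of_apriori
    (lipOnBalls_galerkinField hM hL hB ν μ κ g α) hT x₀
    -- The square root of the energy bound from Grönwall's inequality; the initial energy is the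
    -- only trace of the solution in it.
    (R := √(Real.exp (∫ _ in (0 : ℝ)..T, energyRate μ g α M) *
      (energy B (velo x₀) (magn x₀) (temp x₀) + 0))) (by
      intro x χ hχ hx0 hx t ht
      choose! E' hE' hle using fun t ht =>
        exists_energy_deriv_curve hM hL hB hν hμ hκ hg ht (hχ t) (hx t ht)
      have hG := gronwall_dissipation (D := fun _ => 0) (f := fun _ => 0) hE' continuousOn_const
        continuousOn_const continuousOn_const (fun _ _ => energyRate_nonneg hg hμ)
        (fun _ _ => le_rfl) (fun _ _ => le_rfl) (fun _ _ => energy_nonneg _ _ _)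
        (fun t ht => by rw [add_zero, add_zero]; exact hle t ht) le_rfl (F := 0) (by simp) ht
      rw [intervalIntegral.integral_zero, add_zero, hx0] at hG
      exact (norm_le_sqrt_energy (x t)).trans (Real.sqrt_le_sqrt hG))
  refine ⟨fun t => velo (x t), fun t => magn (x t), fun t => temp (x t), ?_, ?_, ?_, ?_⟩
  · funext i
    simp only [hx0, velo, hx₀]
    exact extend_restrict_eq (h₀.supp_u i)
  · funext i
    simp only [hx0, magn, hx₀]
    exact extend_restrict_eq (h₀.supp_b i)
  · simp only [hx0, temp, hx₀]
    exact extend_restrict_eq h₀.supp_θ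
  · have hc := fun t k hk => coords_smul_galerkinField hB ν μ κ g α ζ 1 (x t) (k := k) hk
    have hxcont : ContinuousOn x (Icc 0 T) := fun t ht => (hx t ht).continuousWithinAt
    have hxc : ∀ {p : galerkinSpace B → ℂ}, LipOnBalls p →
        ContinuousOn (fun t => p (x t)) (Icc 0 T) := fun hp => hp.continuous.comp_continuousOn hxcont
    have hfc : ∀ {p : galerkinSpace B → ℂ}, LipOnBalls p →
        ContinuousOn (fun t => p (galerkinField hB ν μ κ g α ζ (x t))) (Icc 0 T) := fun hp =>
      (hp.continuous.comp (lipOnBalls_galerkinField hM hL hB ν μ κ g α).continuous).comp_continuousOn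
        hxcont
    simp only [Complex.ofReal_one, one_mul, one_smul] at hc
    refine ⟨fun t _ => isTrig_state (x t),
      fun t ht i k hk => (hasDerivWithinAt_velo (hx t ht) ht i hk).congr_deriv ((hc t k hk).1 i),
      fun t ht i k hk => (hasDerivWithinAt_magn (hx t ht) ht i hk).congr_deriv ((hc t k hk).2.1 i),
      fun t ht k hk => (hasDerivWithinAt_temp (hx t ht) ht hk).congr_deriv (hc t k hk).2.2,
      fun i k hk => ?_, fun i k hk => ?_, fun k hk => ?_⟩
    · refine ((hfc (lipOnBalls_velo i k)).add ((hxc (lipOnBalls_velo i k)).const_mul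
        (ν * lapSymbol k : ℂ))).congr fun t ht => ?_
      simp only [Pi.add_apply]
      rw [(hc t k hk).1 i]
      ring
    · refine ((hfc (lipOnBalls_magn i k)).add ((hxc (lipOnBalls_magn i k)).const_mul
        (μ * lapSymbol k : ℂ))).congr fun t ht => ?_
      simp only [Pi.add_apply]
      rw [(hc t k hk).2.1 i]
      ring
    · refine ((hfc (lipOnBalls_temp k)).add ((hxc (lipOnBalls_temp k)).const_mul
        (κ * lapSymbol k : ℂ))).congr fun t ht => ?_
      simp only [Pi.add_apply]
      rw [(hc t k hk).2.2]
      ring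

end CalmedMHD

end

noncomputable section

namespace CalmedMHD

/-! ### Estimates of the nonlinear terms for trigonometric polynomials -/

/-- The weighted sums of squares of velocity and magnetic field. -/
def zsum (B : Finset (Fin 2 → ℤ)) (s : ℕ) (u b : Fin 2 → FSeries) : ℝ :=
  ∑ i, wsum B s (u i) + ∑ i, wsum B s (b i)

theorem zsum_nonneg (B : Finset (Fin 2 → ℤ)) (s : ℕ) (u b : Fin 2 → FSeries) : 0 ≤ zsum B s u b :=
  add_nonneg (Finset.sum_nonneg fun _ _ => wsum_nonneg _ _ _)
    (Finset.sum_nonneg fun _ _ => wsum_nonneg _ _ _)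

/-- The size of the coefficients of velocity and magnetic field. -/
def amp (u b : Fin 2 → FSeries) (k : Fin 2 → ℤ) : ℝ := ∑ j, ‖u j k‖ + ∑ j, ‖b j k‖

/-- The convolution that bounds the quadratic terms. -/
def ampConv (B : Finset (Fin 2 → ℤ)) (u b : Fin 2 → FSeries) (k : Fin 2 → ℤ) : ℝ :=
  ∑ l ∈ B, amp u b l * (freq (k - l) * amp u b (k - l))

variable {B : Finset (Fin 2 → ℤ)} {u b : Fin 2 → FSeries} {θ : FSeries}

theorem amp_nonneg (k : Fin 2 → ℤ) : 0 ≤ amp u b k := by unfold amp; positivity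

theorem sum_norm_left_le_amp (k : Fin 2 → ℤ) : ∑ j, ‖u j k‖ ≤ amp u b k :=
  le_add_of_nonneg_right (by positivity)

theorem sum_norm_right_le_amp (k : Fin 2 → ℤ) : ∑ j, ‖b j k‖ ≤ amp u b k :=
  le_add_of_nonneg_left (by positivity)

theorem norm_left_le_amp (i : Fin 2) (k : Fin 2 → ℤ) : ‖u i k‖ ≤ amp u b k :=
  (Finset.single_le_sum (f := fun j => ‖u j k‖) (fun _ _ => norm_nonneg _)
    (Finset.mem_univ i)).trans (sum_norm_left_le_amp k)

theorem norm_right_le_amp (i : Fin 2) (k : Fin 2 → ℤ) : ‖b i k‖ ≤ amp u b k :=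
  (Finset.single_le_sum (f := fun j => ‖b j k‖) (fun _ _ => norm_nonneg _)
    (Finset.mem_univ i)).trans (sum_norm_right_le_amp k)

theorem ampConv_nonneg (k : Fin 2 → ℤ) : 0 ≤ ampConv B u b k :=
  Finset.sum_nonneg fun l _ => mul_nonneg (amp_nonneg l)
    (mul_nonneg (freq_nonneg _) (amp_nonneg _))

/-- Cauchy–Schwarz over the four scalar components, hence the factor 4. -/
theorem sum_amp_sq_le (s : ℕ) :
    ∑ k ∈ B, lapSymbol k ^ s * amp u b k ^ 2 ≤ 4 * zsum B s u b := by
  have h : ∀ k ∈ B, lapSymbol k ^ s * amp u b k ^ 2 ≤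
      4 * (∑ i, lapSymbol k ^ s * ‖u i k‖ ^ 2 + ∑ i, lapSymbol k ^ s * ‖b i k‖ ^ 2) := by
    intro k _
    rw [← Finset.mul_sum, ← Finset.mul_sum, ← mul_add, mul_left_comm]
    refine mul_le_mul_of_nonneg_left ?_ (pow_nonneg (lapSymbol_nonneg k) _)
    simp only [amp, Fin.sum_univ_two]
    nlinarith [sq_nonneg (‖u 0 k‖ - ‖u 1 k‖), sq_nonneg (‖b 0 k‖ - ‖b 1 k‖),
      sq_nonneg (‖u 0 k‖ - ‖b 0 k‖), sq_nonneg (‖u 0 k‖ - ‖b 1 k‖),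
      sq_nonneg (‖u 1 k‖ - ‖b 0 k‖), sq_nonneg (‖u 1 k‖ - ‖b 1 k‖)]
  refine (Finset.sum_le_sum h).trans (le_of_eq ?_)
  rw [← Finset.mul_sum, Finset.sum_add_distrib, zsum, Finset.sum_comm,
    Finset.sum_comm (s := B) (t := Finset.univ) (f := fun k i => lapSymbol k ^ s * ‖b i k‖ ^ 2)]
  rfl

theorem amp_eq_zero (h : IsTrig B u b θ) {k : Fin 2 → ℤ} (hk : k ∉ B) : amp u b k = 0 := by
  simp [amp, h.supp_u _ k hk, h.supp_b _ k hk]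

/-- Solenoidality puts the derivative on w. With both factors dominated by the common amplitude, all
four quadratic terms share a single bound. -/
theorem norm_divP_le_ampConv {v : Fin 2 → FSeries} {w : FSeries}
    (hv : ∀ i, ∀ k ∉ B, v i k = 0) (hs : IsSolenoidal v) (hva : ∀ k, ∑ j, ‖v j k‖ ≤ amp u b k)
    (hwa : ∀ k, ‖w k‖ ≤ amp u b k) (k : Fin 2 → ℤ) : ‖divP v w k‖ ≤ ampConv B u b k := by
  refine (norm_divP_le_of_support hv hs w k).trans (Finset.sum_le_sum fun l _ => ?_)
  exact mul_le_mul (hva l) (mul_le_mul_of_nonneg_left (hwa _) (freq_nonneg _))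
    (mul_nonneg (freq_nonneg _) (norm_nonneg _)) (amp_nonneg l)

/-- Each component meets a difference of two quadratic terms, which gives the factor 2; the
component norms then add up to the amplitude. -/
theorem re_force_le (h : IsTrig B u b θ) {g : ℝ} (hg : 0 < g) (k : Fin 2 → ℤ) :
    (∑ i, conj (u i k) * forceU g u b θ i k + ∑ i, conj (b i k) * forceB u b i k).re ≤
      2 * (amp u b k * ampConv B u b k) + g * (amp u b k * ‖θ k‖) := by
  have huu := fun i => norm_divP_le_ampConv h.supp_u h.sol_u sum_norm_left_le_amp
    (norm_left_le_amp (u := u) (b := b) i) k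
  have hub := fun i => norm_divP_le_ampConv h.supp_u h.sol_u sum_norm_left_le_amp
    (norm_right_le_amp (u := u) (b := b) i) k
  have hbu := fun i => norm_divP_le_ampConv h.supp_b h.sol_b sum_norm_right_le_amp
    (norm_left_le_amp (u := u) (b := b) i) k
  have hbb := fun i => norm_divP_le_ampConv h.supp_b h.sol_b sum_norm_right_le_amp
    (norm_right_le_amp (u := u) (b := b) i) k
  rw [sum_conj_mul_forceU g h.sol_u]
  refine (Complex.re_le_norm _).trans ?_
  have h1 : ∀ z x y : ℂ, ‖x‖ ≤ ampConv B u b k → ‖y‖ ≤ ampConv B u b k →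
      ‖conj z * (x - y)‖ ≤ ‖z‖ * (2 * ampConv B u b k) := by
    intro z x y hx hy
    rw [norm_mul, Complex.norm_conj]
    refine mul_le_mul_of_nonneg_left ((norm_sub_le _ _).trans ?_) (norm_nonneg _)
    linarith
  have h2 : ‖(g * (conj (u 1 k) * θ k) : ℂ)‖ ≤ g * (amp u b k * ‖θ k‖) := by
    rw [norm_mul, norm_mul, Complex.norm_conj, Complex.norm_real, Real.norm_eq_abs,
      abs_of_pos hg]
    exact mul_le_mul_of_nonneg_left (mul_le_mul_of_nonneg_right (norm_left_le_amp 1 k)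
      (norm_nonneg _)) hg.le
  have h3 := (norm_sum_le _ _).trans (Finset.sum_le_sum fun i (_ : i ∈ Finset.univ) =>
    h1 (u i k) _ _ (hbb i) (huu i))
  have h4 := (norm_sum_le _ _).trans (Finset.sum_le_sum fun i (_ : i ∈ Finset.univ) =>
    h1 (b i k) _ _ (hbu i) (hub i))
  refine (norm_add_le _ _).trans ((add_le_add ((norm_add_le _ _).trans (add_le_add h3 h2))
    h4).trans (le_of_eq ?_))
  rw [← Finset.sum_mul, ← Finset.sum_mul, amp]
  ring

/-- Young's inequality with the amplitude in ℓ¹ and its gradient in ℓ², followed by Agmon's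
inequality. The constant is 128 · 4 · 4. -/
theorem sum_ampConv_sq_le (h : IsTrig B u b θ) {ρ : ℝ} (hρ : 1 ≤ ρ) :
    ∑ k ∈ B, ampConv B u b k ^ 2 ≤
      2048 * (zsum B 1 u b * (ρ * zsum B 0 u b + zsum B 2 u b / ρ)) := by
  have hρ0 : 0 < ρ := by linarith
  have h1 := sum_sq_conv_le B (a := amp u b) (c := fun k => freq k * amp u b k) amp_nonneg
    fun k hk => by rw [amp_eq_zero h hk, mul_zero]
  simp only [mul_pow, freq_sq] at h1
  have h2 := sq_sum_le_agmon hρ B (amp u b)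
  have h30 := sum_amp_sq_le (B := B) (u := u) (b := b) 0
  have h31 := sum_amp_sq_le (B := B) (u := u) (b := b) 1
  have h32 := sum_amp_sq_le (B := B) (u := u) (b := b) 2
  simp only [pow_zero, one_mul, pow_one] at h30 h31
  have h4 : (∑ k ∈ B, amp u b k) ^ 2 ≤ 512 * (ρ * zsum B 0 u b + zsum B 2 u b / ρ) := by
    refine h2.trans ?_
    have h5 := mul_le_mul_of_nonneg_left h30 hρ0.le
    have h6 := div_le_div_of_nonneg_right h32 hρ0.le
    rw [mul_div_assoc] at h6
    linarith
  refine h1.trans ((mul_le_mul h4 h31 (Finset.sum_nonneg fun k _ => mul_nonneg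
    (lapSymbol_nonneg k) (sq_nonneg _)) ?_).trans (le_of_eq (by ring)))
  have := zsum_nonneg B 0 u b
  have := zsum_nonneg B 2 u b
  positivity

/-- The triangle inequality |k| ≤ |l| + |k - l| gives the extra derivative to one of the two
factors. If it falls on the first, Agmon's inequality is used for the gradient with parameter ρ,
since the top norm occurs there; otherwise ρ = 1 suffices. -/
theorem sum_lapSymbol_ampConv_sq_le (h : IsTrig B u b θ) {ρ : ℝ} (hρ : 1 ≤ ρ) :
    ∑ k ∈ B, lapSymbol k * ampConv B u b k ^ 2 ≤
      4096 * ((ρ * zsum B 1 u b + zsum B 3 u b / ρ) * zsum B 1 u b +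
        (zsum B 0 u b + zsum B 2 u b) * zsum B 2 u b) := by
  have hρ0 : 0 < ρ := by linarith
  have hz0 := zsum_nonneg B 0 u b
  have hz1 := zsum_nonneg B 1 u b
  have hz2 := zsum_nonneg B 2 u b
  have hz3 := zsum_nonneg B 3 u b
  have hsplit : ∀ k ∈ B, lapSymbol k * ampConv B u b k ^ 2 ≤
      2 * (∑ l ∈ B, (freq l * amp u b l) * (freq (k - l) * amp u b (k - l))) ^ 2 +
      2 * (∑ l ∈ B, amp u b l * (lapSymbol (k - l) * amp u b (k - l))) ^ 2 := by
    intro k _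
    have h1 : freq k * ampConv B u b k ≤
        ∑ l ∈ B, (freq l * amp u b l) * (freq (k - l) * amp u b (k - l)) +
        ∑ l ∈ B, amp u b l * (lapSymbol (k - l) * amp u b (k - l)) := by
      rw [ampConv, Finset.mul_sum, ← Finset.sum_add_distrib]
      refine Finset.sum_le_sum fun l _ => ?_
      have h2 := mul_le_mul_of_nonneg_right (freq_le_add_sub k l)
        (mul_nonneg (amp_nonneg (u := u) (b := b) l) (mul_nonneg (freq_nonneg (k - l))
          (amp_nonneg (u := u) (b := b) (k - l))))
      refine h2.trans (le_of_eq ?_)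
      rw [← freq_sq (k - l)]
      ring
    have h2 := pow_le_pow_left₀ (mul_nonneg (freq_nonneg k) (ampConv_nonneg k)) h1 2
    rw [mul_pow, freq_sq] at h2
    refine h2.trans (add_sq_le.trans (le_of_eq (by ring)))
  refine (Finset.sum_le_sum hsplit).trans ?_
  rw [Finset.sum_add_distrib, ← Finset.mul_sum, ← Finset.mul_sum]
  have h1 := sum_sq_conv_le B (a := fun k => freq k * amp u b k)
    (c := fun k => freq k * amp u b k) (fun k => mul_nonneg (freq_nonneg k) (amp_nonneg k))
    fun k hk => by rw [amp_eq_zero h hk, mul_zero]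
  have h2 := sum_sq_conv_le B (a := amp u b) (c := fun k => lapSymbol k * amp u b k) amp_nonneg
    fun k hk => by rw [amp_eq_zero h hk, mul_zero]
  have h3 := sq_sum_le_agmon hρ B (fun k => freq k * amp u b k)
  have h4 := sq_sum_le_agmon le_rfl B (amp u b)
  simp only [mul_pow, freq_sq] at h1 h2 h3 h4
  have h30 := sum_amp_sq_le (B := B) (u := u) (b := b) 0
  have h31 := sum_amp_sq_le (B := B) (u := u) (b := b) 1
  have h32 := sum_amp_sq_le (B := B) (u := u) (b := b) 2
  have h33 := sum_amp_sq_le (B := B) (u := u) (b := b) 3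
  simp only [pow_zero, one_mul, pow_one] at h30 h31
  have h3' : (∑ k ∈ B, freq k * amp u b k) ^ 2 ≤
      512 * (ρ * zsum B 1 u b + zsum B 3 u b / ρ) := by
    refine h3.trans ?_
    have h5 := mul_le_mul_of_nonneg_left h31 hρ0.le
    have h7 : ∑ k ∈ B, lapSymbol k ^ 2 * (lapSymbol k * amp u b k ^ 2) ≤ 4 * zsum B 3 u b := by
      refine le_trans (le_of_eq (Finset.sum_congr rfl fun k _ => by ring)) h33
    have h6 := div_le_div_of_nonneg_right h7 hρ0.le
    rw [mul_div_assoc] at h6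
    linarith
  have h4' : (∑ k ∈ B, amp u b k) ^ 2 ≤ 512 * (zsum B 0 u b + zsum B 2 u b) := by
    rw [div_one, one_mul] at h4
    linarith
  have h1' := h1.trans (mul_le_mul h3' h31 (Finset.sum_nonneg fun k _ => mul_nonneg
    (lapSymbol_nonneg k) (sq_nonneg _)) (by positivity))
  have h2' := h2.trans (mul_le_mul h4' h32 (Finset.sum_nonneg fun k _ => mul_nonneg
    (pow_nonneg (lapSymbol_nonneg k) _) (sq_nonneg _)) (by positivity))
  linarith

/-! ### Differential inequalities -/

theorem weighted_young {c x y : ℝ} (hc : 0 < c) (l : ℝ) :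
    l * (x * y) ≤ c * (l ^ 2 * x ^ 2) + 1 / (4 * c) * y ^ 2 := by
  have h : c * (l ^ 2 * x ^ 2) + 1 / (4 * c) * y ^ 2 - l * (x * y) =
      1 / (4 * c) * (2 * c * l * x - y) ^ 2 := by field_simp; ring
  have : 0 ≤ 1 / (4 * c) * (2 * c * l * x - y) ^ 2 := by positivity
  linarith

/-- In the pairing with weight r + 1 one power of the symbol stays with the amplitude, so that it
reaches the dissipated norm, and the forcing is measured with weight r only. -/
theorem exists_zsum_deriv {ν μ g c₀ : ℝ} (hc₀ : 0 < c₀) (hcν : c₀ ≤ ν) (hcμ : c₀ ≤ μ)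
    (hg : 0 < g) {u b : ℝ → Fin 2 → FSeries} {θ : ℝ → FSeries} {S : Set ℝ} {t : ℝ}
    (htrig : IsTrig B (u t) (b t) (θ t))
    (hu : ∀ i, ∀ k ∈ B, HasDerivWithinAt (fun t => u t i k)
      (-(ν * lapSymbol k) * u t i k + forceU g (u t) (b t) (θ t) i k) S t)
    (hb : ∀ i, ∀ k ∈ B, HasDerivWithinAt (fun t => b t i k)
      (-(μ * lapSymbol k) * b t i k + forceB (u t) (b t) i k) S t) (r : ℕ) :
    ∃ Z' : ℝ, HasDerivWithinAt (fun t => zsum B (r + 1) (u t) (b t)) Z' S t ∧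
      Z' + 3 / 2 * c₀ * zsum B (r + 2) (u t) (b t) ≤
        64 / c₀ * ∑ k ∈ B, lapSymbol k ^ r * ampConv B (u t) (b t) k ^ 2 +
        16 * g ^ 2 / c₀ * wsum B r (θ t) := by
  have hu' : ∀ i, ∀ k ∈ B, HasDerivWithinAt (fun t => u t i k)
      (((1 : ℝ) : ℂ) * (-(ν * lapSymbol k) * u t i k + forceU g (u t) (b t) (θ t) i k)) S t := by
    simpa using hu
  have hb' : ∀ i, ∀ k ∈ B, HasDerivWithinAt (fun t => b t i k)
      (((1 : ℝ) : ℂ) * (-(μ * lapSymbol k) * b t i k + forceB (u t) (b t) i k)) S t := by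
    simpa using hb
  refine ⟨_, (HasDerivWithinAt.fun_sum fun i _ => hasDerivWithinAt_wsum (r + 1) (hu' i)).add
    (HasDerivWithinAt.fun_sum fun i _ => hasDerivWithinAt_wsum (r + 1) (hb' i)), ?_⟩
  simp only [sum_dissipation]
  have hpair : ∑ k ∈ B, lapSymbol k ^ (r + 1) * (∑ i, conj (u t i k) *
      forceU g (u t) (b t) (θ t) i k + ∑ i, conj (b t i k) * forceB (u t) (b t) i k).re ≤
      c₀ / 16 * (∑ k ∈ B, lapSymbol k ^ (r + 2) * amp (u t) (b t) k ^ 2) +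
      32 / c₀ * ∑ k ∈ B, lapSymbol k ^ r * ampConv B (u t) (b t) k ^ 2 +
        8 * g ^ 2 / c₀ * wsum B r (θ t) := by
    rw [wsum, Finset.mul_sum, Finset.mul_sum, Finset.mul_sum, ← Finset.sum_add_distrib,
      ← Finset.sum_add_distrib]
    refine Finset.sum_le_sum fun k _ => ?_
    have hl := pow_nonneg (lapSymbol_nonneg k) r
    have h1 := mul_le_mul_of_nonneg_left (re_force_le htrig hg k)
      (pow_nonneg (lapSymbol_nonneg k) (r + 1))
    -- The weights c₀/64, used twice, and c₀/(32 g), multiplied by g, make the amplitude cost c₀/16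
    -- in total. After the factor 4 of `sum_amp_sq_le` and the 2 from differentiating squares this
    -- is c₀/2, so 3/2 of the dissipation 2c₀ is left.
    have h2 := weighted_young (x := amp (u t) (b t) k) (y := ampConv B (u t) (b t) k)
      (show 0 < c₀ / 64 by positivity) (lapSymbol k)
    have h3 := weighted_young (x := amp (u t) (b t) k) (y := ‖θ t k‖)
      (show 0 < c₀ / (32 * g) by positivity) (lapSymbol k)
    have h2' := mul_le_mul_of_nonneg_left h2 hl
    have h3' := mul_le_mul_of_nonneg_left (mul_le_mul_of_nonneg_left h3 hg.le) hl
    refine h1.trans ?_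
    have e1 : g * (c₀ / (32 * g) * (lapSymbol k ^ 2 * amp (u t) (b t) k ^ 2) +
        1 / (4 * (c₀ / (32 * g))) * ‖θ t k‖ ^ 2) =
        c₀ / 32 * (lapSymbol k ^ 2 * amp (u t) (b t) k ^ 2) + 8 * g ^ 2 / c₀ * ‖θ t k‖ ^ 2 := by
      field_simp; ring
    have e2 : 1 / (4 * (c₀ / 64)) = 16 / c₀ := by field_simp; ring
    rw [e1] at h3'
    rw [e2] at h2'
    have e3 : lapSymbol k ^ (r + 1) * (2 * (amp (u t) (b t) k * ampConv B (u t) (b t) k) +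
        g * (amp (u t) (b t) k * ‖θ t k‖)) =
        2 * (lapSymbol k ^ r * (lapSymbol k * (amp (u t) (b t) k * ampConv B (u t) (b t) k))) +
        lapSymbol k ^ r * (g * (lapSymbol k * (amp (u t) (b t) k * ‖θ t k‖))) := by ring
    rw [e3]
    refine (add_le_add (mul_le_mul_of_nonneg_left h2' zero_le_two) h3').trans (le_of_eq ?_)
    ring
  have hamp := sum_amp_sq_le (B := B) (u := u t) (b := b t) (r + 2)
  have hsum : ∑ k ∈ B, lapSymbol k ^ (r + 1) * (∑ i, conj (u t i k) *
      forceU g (u t) (b t) (θ t) i k + ∑ i, conj (b t i k) * forceB (u t) (b t) i k).re =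
      ∑ i, ∑ k ∈ B, lapSymbol k ^ (r + 1) * (conj (u t i k) *
        forceU g (u t) (b t) (θ t) i k).re +
      ∑ i, ∑ k ∈ B, lapSymbol k ^ (r + 1) * (conj (b t i k) * forceB (u t) (b t) i k).re := by
    simp only [Complex.add_re, mul_add, Finset.sum_add_distrib, Fin.sum_univ_two]
  rw [hsum] at hpair
  have hdu : c₀ * ∑ i, wsum B (r + 2) (u t i) ≤ ν * ∑ i, wsum B (r + 2) (u t i) :=
    mul_le_mul_of_nonneg_right hcν (Finset.sum_nonneg fun _ _ => wsum_nonneg _ _ _)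
  have hdb : c₀ * ∑ i, wsum B (r + 2) (b t i) ≤ μ * ∑ i, wsum B (r + 2) (b t i) :=
    mul_le_mul_of_nonneg_right hcμ (Finset.sum_nonneg fun _ _ => wsum_nonneg _ _ _)
  have hamp' := mul_le_mul_of_nonneg_left hamp (show 0 ≤ c₀ / 16 by positivity)
  have e4 : 64 / c₀ = 2 * (32 / c₀) := by ring
  have e5 : 16 * g ^ 2 / c₀ = 2 * (8 * g ^ 2 / c₀) := by ring
  rw [e4, e5]
  unfold zsum at hamp' ⊢
  simp only [Fin.sum_univ_two, mul_add, mul_one] at *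
  linarith

end CalmedMHD

end

noncomputable section

namespace CalmedMHD

/-! ### Uniform bounds for the Galerkin solutions -/

section Bounds

variable {B : Finset (Fin 2 → ℤ)} {ν μ κ g α T : ℝ} {ζ : ℝ → ℝ} {u b : ℝ → Fin 2 → FSeries}
  {θ : ℝ → FSeries}

theorem IsGalerkin.continuousOn_u (h : IsGalerkin B ν μ κ g α ζ T u b θ) (i : Fin 2)
    (k : Fin 2 → ℤ) : ContinuousOn (fun t => u t i k) (Icc 0 T) := by
  by_cases hk : k ∈ B
  · exact fun t ht => (h.deriv_u t ht i k hk).continuousWithinAt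
  · exact continuousOn_const.congr fun t ht => (h.trig t ht).supp_u i k hk

theorem IsGalerkin.continuousOn_b (h : IsGalerkin B ν μ κ g α ζ T u b θ) (i : Fin 2)
    (k : Fin 2 → ℤ) : ContinuousOn (fun t => b t i k) (Icc 0 T) := by
  by_cases hk : k ∈ B
  · exact fun t ht => (h.deriv_b t ht i k hk).continuousWithinAt
  · exact continuousOn_const.congr fun t ht => (h.trig t ht).supp_b i k hk

theorem IsGalerkin.continuousOn_θ (h : IsGalerkin B ν μ κ g α ζ T u b θ)
    (k : Fin 2 → ℤ) : ContinuousOn (fun t => θ t k) (Icc 0 T) := by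
  by_cases hk : k ∈ B
  · exact fun t ht => (h.deriv_θ t ht k hk).continuousWithinAt
  · exact continuousOn_const.congr fun t ht => (h.trig t ht).supp_θ k hk

theorem continuousOn_wsum {c : ℝ → FSeries} {S : Set ℝ}
    (h : ∀ k, ContinuousOn (fun t => c t k) S) (s : ℕ) :
    ContinuousOn (fun t => wsum B s (c t)) S := by
  unfold wsum
  exact continuousOn_finsetSum _ fun k _ => continuousOn_const.mul ((h k).norm.pow 2)

theorem IsGalerkin.continuousOn_zsum (h : IsGalerkin B ν μ κ g α ζ T u b θ) (s : ℕ) :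
    ContinuousOn (fun t => zsum B s (u t) (b t)) (Icc 0 T) := by
  unfold zsum
  exact (continuousOn_finsetSum _ fun i _ => continuousOn_wsum (h.continuousOn_u i) s).add
    (continuousOn_finsetSum _ fun i _ => continuousOn_wsum (h.continuousOn_b i) s)

/-- Here c₀ is a common lower bound for the three diffusivities, so that all dissipation terms can
be kept in one integral. -/
theorem IsGalerkin.exists_energy_bound {M : ℝ} {L : ℝ≥0} (hM : ∀ x, |ζ x| ≤ M)
    (hL : LipschitzWith L ζ) (hB : ∀ k ∈ B, -k ∈ B) {c₀ : ℝ} (hc₀ : 0 < c₀) (hcν : c₀ ≤ ν)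
    (hcμ : c₀ ≤ μ) (hcκ : c₀ ≤ κ) (hg : 0 < g)
    (h : IsGalerkin B ν μ κ g α ζ T u b θ) {t : ℝ} (ht : t ∈ Icc 0 T) :
    energy B (u t) (b t) (θ t) +
        ∫ s in (0 : ℝ)..t, c₀ * (zsum B 1 (u s) (b s) + wsum B 1 (θ s)) ≤
      Real.exp (T * energyRate μ g α M) * energy B (u 0) (b 0) (θ 0) := by
  have hμ : 0 < μ := hc₀.trans_le hcμ
  have hν : 0 < ν := hc₀.trans_le hcν
  have hκ : 0 < κ := hc₀.trans_le hcκ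
  have hE : ∀ t ∈ Icc 0 T, ∃ E' : ℝ, HasDerivWithinAt
      (fun t => energy B (u t) (b t) (θ t)) E' (Icc 0 T) t ∧
      E' + c₀ * (zsum B 1 (u t) (b t) + wsum B 1 (θ t)) ≤
        energyRate μ g α M * energy B (u t) (b t) (θ t) + 0 := by
    intro t ht
    obtain ⟨E', hE', hle⟩ := exists_energy_deriv (α := α) (M := M) (κ := κ) (ν := ν) hM hL hB hμ hg
      zero_le_one (h.trig t ht) (by simpa using h.deriv_u t ht) (by simpa using h.deriv_b t ht)
      (by simpa using h.deriv_θ t ht)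
    refine ⟨E', hE', ?_⟩
    have h5 : 0 ≤ ∑ i, wsum B 1 (u t i) := Finset.sum_nonneg fun _ _ => wsum_nonneg _ _ _
    have h6 : 0 ≤ ∑ i, wsum B 1 (b t i) := Finset.sum_nonneg fun _ _ => wsum_nonneg _ _ _
    have h7 := wsum_nonneg B 1 (θ t)
    have h8 := mul_le_mul_of_nonneg_right hcν h5
    have h9 := mul_le_mul_of_nonneg_right hcμ h6
    have h10 := mul_le_mul_of_nonneg_right hcκ h7
    have h11 := mul_nonneg hν.le h5
    have h12 := mul_nonneg hκ.le h7
    unfold zsum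
    linarith
  choose! E' hE' hle using hE
  have hG := gronwall_dissipation (F := 0) hE' continuousOn_const continuousOn_const
    (continuousOn_const.mul ((h.continuousOn_zsum 1).add (continuousOn_wsum h.continuousOn_θ 1)))
    (fun _ _ => energyRate_nonneg hg hμ) (fun _ _ => le_rfl)
    (fun t _ => mul_nonneg hc₀.le (add_nonneg (zsum_nonneg _ _ _ _) (wsum_nonneg _ _ _)))
    (fun _ _ => energy_nonneg _ _ _) hle le_rfl (by simp) ht
  simpa using hG

/-- The nonlinearity may use up a further c₀/2 of the dissipation; Grönwall's inequality then still
retains c₀ of it. -/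
theorem IsGalerkin.exists_zsum_bound {c₀ : ℝ} (hc₀ : 0 < c₀) (hcν : c₀ ≤ ν)
    (hcμ : c₀ ≤ μ) (hg : 0 < g) (h : IsGalerkin B ν μ κ g α ζ T u b θ)
    {r : ℕ} {a f : ℝ → ℝ} {A F : ℝ} (ha : ContinuousOn a (Icc 0 T)) (hf : ContinuousOn f (Icc 0 T))
    (ha0 : ∀ t ∈ Icc 0 T, 0 ≤ a t) (hf0 : ∀ t ∈ Icc 0 T, 0 ≤ f t)
    (hN : ∀ t ∈ Icc 0 T, 64 / c₀ * ∑ k ∈ B, lapSymbol k ^ r * ampConv B (u t) (b t) k ^ 2 +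
      16 * g ^ 2 / c₀ * wsum B r (θ t) ≤ a t * zsum B (r + 1) (u t) (b t) + f t +
        c₀ / 2 * zsum B (r + 2) (u t) (b t))
    (hA : ∫ s in (0 : ℝ)..T, a s ≤ A) (hF : ∫ s in (0 : ℝ)..T, f s ≤ F) {t : ℝ}
    (ht : t ∈ Icc 0 T) :
    zsum B (r + 1) (u t) (b t) + ∫ s in (0 : ℝ)..t, c₀ * zsum B (r + 2) (u s) (b s) ≤
      Real.exp A * (zsum B (r + 1) (u 0) (b 0) + F) := by
  choose! Z' hZ' hle using fun t ht => exists_zsum_deriv hc₀ hcν hcμ hg (h.trig t ht)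
    (h.deriv_u t ht) (h.deriv_b t ht) r
  refine gronwall_dissipation (D := fun t => c₀ * zsum B (r + 2) (u t) (b t)) hZ' ha hf (continuousOn_const.mul (h.continuousOn_zsum (r + 2)))
    ha0 hf0 (fun t _ => mul_nonneg hc₀.le (zsum_nonneg _ _ _ _)) (fun _ _ => zsum_nonneg _ _ _ _)
    (fun t ht => ?_) hA hF ht
  have h1 := hle t ht
  have h2 := hN t ht
  linarith

theorem mul_integral_le_of_le {T c C I : ℝ} {X a : ℝ → ℝ} (hT : 0 ≤ T) (hX : ContinuousOn X (Icc 0 T))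
    (ha : ContinuousOn a (Icc 0 T)) (hle : ∀ t ∈ Icc 0 T, a t ≤ C + c * X t) (hc : 0 ≤ c)
    (hI : ∫ s in (0 : ℝ)..T, X s ≤ I) : ∫ s in (0 : ℝ)..T, a s ≤ T * C + c * I := by
  have hXi : IntervalIntegrable X volume 0 T := by
    rw [← uIcc_of_le hT] at hX; exact hX.intervalIntegrable
  have hai : IntervalIntegrable a volume 0 T := by
    rw [← uIcc_of_le hT] at ha; exact ha.intervalIntegrable
  refine (intervalIntegral.integral_mono_on hT hai (intervalIntegrable_const.add
    (hXi.const_mul c)) hle).trans ?_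
  rw [intervalIntegral.integral_add intervalIntegrable_const (hXi.const_mul c),
    intervalIntegral.integral_const, intervalIntegral.integral_const_mul, sub_zero, smul_eq_mul]
  exact add_le_add_right (mul_le_mul_of_nonneg_left hI hc) _

set_option maxHeartbeats 1000000 in
/-- Bounds of Galerkin solutions that do not depend on the set of modes. -/
theorem exists_uniform_bound {M : ℝ} {L : ℝ≥0} (hM : ∀ x, |ζ x| ≤ M)
    (hL : LipschitzWith L ζ) (hν : 0 < ν) (hμ : 0 < μ) (hκ : 0 < κ) (hg : 0 < g) (hT : 0 < T)
    (α I : ℝ) :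
    ∃ C : ℝ, 0 ≤ C ∧ ∀ (B : Finset (Fin 2 → ℤ)) (u b : ℝ → Fin 2 → FSeries) (θ : ℝ → FSeries),
      (∀ k ∈ B, -k ∈ B) → IsGalerkin B ν μ κ g α ζ T u b θ →
      energy B (u 0) (b 0) (θ 0) ≤ I → zsum B 1 (u 0) (b 0) ≤ I → zsum B 2 (u 0) (b 0) ≤ I →
      (∀ t ∈ Icc 0 T, energy B (u t) (b t) (θ t) ≤ C ∧ zsum B 2 (u t) (b t) ≤ C) ∧
      ∫ t in (0 : ℝ)..T, zsum B 3 (u t) (b t) ≤ C ∧ ∫ t in (0 : ℝ)..T, wsum B 1 (θ t) ≤ C := by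
  obtain ⟨c₀, hc₀, hcν, hcμ, hcκ⟩ : ∃ c₀ : ℝ, 0 < c₀ ∧ c₀ ≤ ν ∧ c₀ ≤ μ ∧ c₀ ≤ κ :=
    ⟨min ν (min μ κ), by positivity, min_le_left _ _, (min_le_right _ _).trans (min_le_left _ _),
      (min_le_right _ _).trans (min_le_right _ _)⟩
  -- C₀ bounds the energy and D₀ the time integral of the squared gradients. The absolute value of I
  -- makes the constants nonnegative without assuming it of I.
  set C₀ := Real.exp (T * energyRate μ g α M) * |I| with hC₀
  have hC₀0 : 0 ≤ C₀ := by positivity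
  set D₀ := C₀ / c₀ with hD₀
  have hD₀0 : 0 ≤ D₀ := by positivity
  -- The factor in front of the H² term is 64 · 2048 / c₀ = 2^17 / c₀; divided by K₁ it becomes
  -- exactly the admissible c₀/2. A₁ and F₁ are the integrals of the resulting rate and source.
  set K₁ := 2 ^ 18 / c₀ ^ 2 with hK₁
  have hK₁0 : 0 < K₁ := by positivity
  set A₁ := T * (2 ^ 17 / c₀ * C₀) + 2 ^ 17 / c₀ * C₀ * K₁ * D₀ with hA₁
  set F₁ := T * (16 * g ^ 2 / c₀ * C₀) with hF₁
  set C₁ := Real.exp A₁ * (|I| + F₁) with hC₁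
  have hC₁0 : 0 ≤ C₁ := by positivity
  set A₂ := T * (2 ^ 18 / c₀ * C₀) + 2 ^ 18 / c₀ * (C₁ / c₀) with hA₂
  -- The same balance one level up, where the factor is 64 · 4096 / c₀ = 2^18 / c₀.
  set K₂ := 2 ^ 19 / c₀ ^ 2 with hK₂
  have hK₂0 : 0 < K₂ := by positivity
  set F₂ := T * (2 ^ 18 / c₀ * ((1 + K₂ * C₁) * C₁ ^ 2)) + 16 * g ^ 2 / c₀ * D₀ with hF₂
  set C₂ := Real.exp A₂ * (|I| + F₂) with hC₂
  have hC₂0 : 0 ≤ C₂ := by positivity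
  have hC₂' : 0 ≤ C₂ / c₀ := by positivity
  refine ⟨C₀ + D₀ + C₂ + C₂ / c₀, by positivity, fun B u b θ hB h h0 h1 h2 => ?_⟩
  have hTm : T ∈ Icc 0 T := ⟨hT.le, le_rfl⟩
  have hII := le_abs_self I
  have hcz := fun s => h.continuousOn_zsum s
  have hcθ := fun s => continuousOn_wsum (B := B) h.continuousOn_θ s
  have hint : ∀ X : ℝ → ℝ, ContinuousOn X (Icc 0 T) → IntervalIntegrable X volume 0 T :=
    fun X hX => by rw [← uIcc_of_le hT.le] at hX; exact hX.intervalIntegrable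
  have hpos : ∀ X : ℝ → ℝ, (∀ t, 0 ≤ X t) → ∀ t ∈ Icc 0 T, 0 ≤ ∫ s in (0 : ℝ)..t, X s :=
    fun X hX t ht => intervalIntegral.integral_nonneg ht.1 fun s _ => hX s
  have hdiv : ∀ X : ℝ → ℝ, ∀ C : ℝ, ∫ s in (0 : ℝ)..T, c₀ * X s ≤ C →
      ∫ s in (0 : ℝ)..T, X s ≤ C / c₀ := by
    intro X C hX
    rw [intervalIntegral.integral_const_mul] at hX
    rwa [le_div_iff₀ hc₀, mul_comm]
  -- the basic energy bound
  have hE := fun t ht => (h.exists_energy_bound hM hL hB hc₀ hcν hcμ hcκ hg (t := t) ht).trans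
    (mul_le_mul_of_nonneg_left (h0.trans hII) (Real.exp_pos _).le)
  have hEt : ∀ t ∈ Icc 0 T, energy B (u t) (b t) (θ t) ≤ C₀ := fun t ht => by
    have h3 := hpos (fun s => c₀ * (zsum B 1 (u s) (b s) + wsum B 1 (θ s)))
      (fun s => mul_nonneg hc₀.le (add_nonneg (zsum_nonneg _ _ _ _) (wsum_nonneg _ _ _))) t ht
    have h4 := hE t ht
    linarith
  have hz0 : ∀ t ∈ Icc 0 T, zsum B 0 (u t) (b t) ≤ C₀ := fun t ht => by
    have h3 := hEt t ht
    have h4 := wsum_nonneg B 0 (θ t)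
    unfold energy at h3
    unfold zsum
    linarith
  have hθ0 : ∀ t ∈ Icc 0 T, wsum B 0 (θ t) ≤ C₀ := fun t ht => by
    have h3 := hEt t ht
    have h4 := zsum_nonneg B 0 (u t) (b t)
    unfold energy at h3
    unfold zsum at h4
    linarith
  have hI1 : ∫ s in (0 : ℝ)..T, (zsum B 1 (u s) (b s) + wsum B 1 (θ s)) ≤ D₀ := by
    refine hdiv _ _ ?_
    have h3 := hE T hTm
    have h4 := energy_nonneg (B := B) (u T) (b T) (θ T)
    linarith
  rw [intervalIntegral.integral_add (hint _ (hcz 1)) (hint _ (hcθ 1))] at hI1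
  have hIz := hpos (fun s => zsum B 1 (u s) (b s)) (fun s => zsum_nonneg _ _ _ _) T hTm
  have hIθ := hpos (fun s => wsum B 1 (θ s)) (fun s => wsum_nonneg _ _ _) T hTm
  have hIz1 : ∫ s in (0 : ℝ)..T, zsum B 1 (u s) (b s) ≤ D₀ := by linarith
  have hIθ1 : ∫ s in (0 : ℝ)..T, wsum B 1 (θ s) ≤ D₀ := by linarith
  -- the `H¹` bound
  have hH1 := fun t ht => h.exists_zsum_bound hc₀ hcν hcμ hg (r := 0) (A := A₁) (F := F₁) (t := t)
    (a := fun t => 2 ^ 17 / c₀ * C₀ * (1 + K₁ * zsum B 1 (u t) (b t)))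
    (f := fun t => 16 * g ^ 2 / c₀ * wsum B 0 (θ t))
    (continuousOn_const.mul (continuousOn_const.add (continuousOn_const.mul (hcz 1))))
    (continuousOn_const.mul (hcθ 0))
    (fun t _ => by have := zsum_nonneg B 1 (u t) (b t); positivity)
    (fun t _ => by have := wsum_nonneg B 0 (θ t); positivity)
    (fun t ht => by
      have hz1 := zsum_nonneg B 1 (u t) (b t)
      have hz2 := zsum_nonneg B 2 (u t) (b t)
      -- Agmon's parameter follows the solution: the H¹ norm divided by ρ is at most 1/K₁, which
      -- makes the H² term absorbable, and the rate, proportional to ρ, stays integrable by the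
      -- energy dissipation.
      set ρ := 1 + K₁ * zsum B 1 (u t) (b t) with hρ
      have hρ1 : 1 ≤ ρ := by rw [hρ]; have := mul_nonneg hK₁0.le hz1; linarith
      have h3 := sum_ampConv_sq_le (h.trig t ht) hρ1
      simp only [pow_zero, one_mul]
      have h4 : zsum B 1 (u t) (b t) / ρ ≤ 1 / K₁ := by
        rw [div_le_div_iff₀ (by linarith) hK₁0, hρ]; linarith
      have h5 := mul_le_mul_of_nonneg_left h3 (show 0 ≤ 64 / c₀ by positivity)
      have h6 := mul_le_mul_of_nonneg_right h4 hz2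
      have h7 : 64 / c₀ * 2048 * (1 / K₁ * zsum B 2 (u t) (b t)) =
          c₀ / 2 * zsum B 2 (u t) (b t) := by
        rw [hK₁]; field_simp; ring
      have h8 := mul_le_mul_of_nonneg_left h6 (show 0 ≤ 64 / c₀ * 2048 by positivity)
      have h9 := mul_le_mul_of_nonneg_left (hz0 t ht)
        (show 0 ≤ 2 ^ 17 / c₀ * ρ * zsum B 1 (u t) (b t) by positivity)
      have h10 : 64 / c₀ * (2048 * (zsum B 1 (u t) (b t) * (ρ * zsum B 0 (u t) (b t) +
          zsum B 2 (u t) (b t) / ρ))) = 2 ^ 17 / c₀ * ρ * zsum B 1 (u t) (b t) *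
          zsum B 0 (u t) (b t) + 64 / c₀ * 2048 * (zsum B 1 (u t) (b t) / ρ *
          zsum B 2 (u t) (b t)) := by ring
      rw [h10] at h5
      simp only [zero_add]
      linarith)
    (mul_integral_le_of_le hT.le (hcz 1) (continuousOn_const.mul (continuousOn_const.add
      (continuousOn_const.mul (hcz 1)))) (fun t _ => le_of_eq (by ring)) (by positivity) hIz1)
    ((mul_integral_le_of_le (X := fun _ => 0) (c := 0) hT.le continuousOn_const
      (continuousOn_const.mul (hcθ 0)) (fun t ht => by
        rw [zero_mul, add_zero]
        exact mul_le_mul_of_nonneg_left (hθ0 t ht) (by positivity)) le_rfl le_rfl).trans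
      (by rw [zero_mul, add_zero])) ht
  simp only [zero_add] at hH1
  have hmono : Real.exp A₁ * (zsum B 1 (u 0) (b 0) + F₁) ≤ C₁ :=
    mul_le_mul_of_nonneg_left (by linarith) (Real.exp_pos _).le
  have hz1 : ∀ t ∈ Icc 0 T, zsum B 1 (u t) (b t) ≤ C₁ := fun t ht => by
    have h3 := hpos (fun s => c₀ * zsum B 2 (u s) (b s))
      (fun s => mul_nonneg hc₀.le (zsum_nonneg _ _ _ _)) t ht
    have h4 := (hH1 t ht).trans hmono
    linarith
  have hIz2 : ∫ s in (0 : ℝ)..T, zsum B 2 (u s) (b s) ≤ C₁ / c₀ := by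
    refine hdiv _ _ ?_
    have h3 := (hH1 T hTm).trans hmono
    have h4 := zsum_nonneg B 1 (u T) (b T)
    linarith
  -- the `H²` bound
  have hH2 := fun t ht => h.exists_zsum_bound hc₀ hcν hcμ hg (r := 1) (A := A₂) (F := F₂) (t := t)
    (a := fun t => 2 ^ 18 / c₀ * (zsum B 0 (u t) (b t) + zsum B 2 (u t) (b t)))
    (f := fun t => 2 ^ 18 / c₀ * ((1 + K₂ * zsum B 1 (u t) (b t)) * zsum B 1 (u t) (b t) ^ 2) +
      16 * g ^ 2 / c₀ * wsum B 1 (θ t))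
    (continuousOn_const.mul ((hcz 0).add (hcz 2)))
    ((continuousOn_const.mul ((continuousOn_const.add (continuousOn_const.mul (hcz 1))).mul
      ((hcz 1).pow 2))).add (continuousOn_const.mul (hcθ 1)))
    (fun t _ => by
      have := zsum_nonneg B 0 (u t) (b t)
      have := zsum_nonneg B 2 (u t) (b t)
      positivity)
    (fun t _ => by
      have := wsum_nonneg B 1 (θ t)
      have := zsum_nonneg B 1 (u t) (b t)
      positivity)
    (fun t ht => by
      have hz1 := zsum_nonneg B 1 (u t) (b t)
      have hz3 := zsum_nonneg B 3 (u t) (b t)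
      -- Again ρ makes the top term, now H³, absorbable. What it costs is a power of the H¹ norm,
      -- already bounded; the H² norm enters the rate and is integrable by the previous level.
      set ρ := 1 + K₂ * zsum B 1 (u t) (b t) with hρ
      have hρ1 : 1 ≤ ρ := by rw [hρ]; have := mul_nonneg hK₂0.le hz1; linarith
      have h3 := sum_lapSymbol_ampConv_sq_le (h.trig t ht) hρ1
      simp only [pow_one]
      have h4 : zsum B 1 (u t) (b t) / ρ ≤ 1 / K₂ := by
        rw [div_le_div_iff₀ (by linarith) hK₂0, hρ]; linarith
      have h5 := mul_le_mul_of_nonneg_left h3 (show 0 ≤ 64 / c₀ by positivity)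
      have h6 := mul_le_mul_of_nonneg_right h4 hz3
      have h7 : 64 / c₀ * 4096 * (1 / K₂ * zsum B 3 (u t) (b t)) =
          c₀ / 2 * zsum B 3 (u t) (b t) := by
        rw [hK₂]; field_simp; ring
      have h8 := mul_le_mul_of_nonneg_left h6 (show 0 ≤ 64 / c₀ * 4096 by positivity)
      have h10 : 64 / c₀ * (4096 * ((ρ * zsum B 1 (u t) (b t) + zsum B 3 (u t) (b t) / ρ) *
          zsum B 1 (u t) (b t) + (zsum B 0 (u t) (b t) + zsum B 2 (u t) (b t)) *
          zsum B 2 (u t) (b t))) = 2 ^ 18 / c₀ * (ρ * zsum B 1 (u t) (b t) ^ 2) +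
          64 / c₀ * 4096 * (zsum B 1 (u t) (b t) / ρ * zsum B 3 (u t) (b t)) +
          2 ^ 18 / c₀ * (zsum B 0 (u t) (b t) + zsum B 2 (u t) (b t)) * zsum B 2 (u t) (b t) := by
        ring
      rw [h10] at h5
      simp only [Nat.reduceAdd]
      linarith)
    (mul_integral_le_of_le hT.le (hcz 2) (continuousOn_const.mul ((hcz 0).add (hcz 2)))
      (fun t ht => by
        rw [mul_add]
        exact add_le_add_left (mul_le_mul_of_nonneg_left (hz0 t ht) (by positivity)) _)
      (by positivity) hIz2)
    (mul_integral_le_of_le hT.le (hcθ 1)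
      ((continuousOn_const.mul ((continuousOn_const.add (continuousOn_const.mul (hcz 1))).mul
        ((hcz 1).pow 2))).add (continuousOn_const.mul (hcθ 1)))
      (fun t ht => by
        have h3 := zsum_nonneg B 1 (u t) (b t)
        have h4 := hz1 t ht
        refine add_le_add_left (mul_le_mul_of_nonneg_left ?_ (by positivity)) _
        gcongr)
      (by positivity) hIθ1) ht
  simp only [Nat.reduceAdd] at hH2
  have hmono2 : Real.exp A₂ * (zsum B 2 (u 0) (b 0) + F₂) ≤ C₂ :=
    mul_le_mul_of_nonneg_left (by linarith) (Real.exp_pos _).le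
  refine ⟨fun t ht => ⟨by linarith [hEt t ht], ?_⟩, ?_, by linarith⟩
  · have h3 := hpos (fun s => c₀ * zsum B 3 (u s) (b s))
      (fun s => mul_nonneg hc₀.le (zsum_nonneg _ _ _ _)) t ht
    have h4 := (hH2 t ht).trans hmono2
    linarith
  · have h5 : ∫ s in (0 : ℝ)..T, zsum B 3 (u s) (b s) ≤ C₂ / c₀ := by
      refine hdiv _ _ ?_
      have h3 := (hH2 T hTm).trans hmono2
      have h4 := zsum_nonneg B 2 (u T) (b T)
      linarith
    linarith

end Bounds

end CalmedMHD

end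

noncomputable section

namespace CalmedMHD

/-! ### Compactness and passage to the limit -/

/-- An Arzelà–Ascoli argument: compactness of a countable product of closed balls yields a
subsequence converging at all rational times for all indices, and the common Lipschitz bounds carry
the convergence to every time. -/
theorem exists_subseq_tendsto {ι : Type*} [Countable ι] {T : ℝ} (hT : 0 ≤ T)
    {x : ℕ → ι → ℝ → ℂ} {C K : ι → ℝ} (hb : ∀ n i, ∀ t ∈ Icc 0 T, ‖x n i t‖ ≤ C i)
    (hl : ∀ n i, ∀ s ∈ Icc 0 T, ∀ t ∈ Icc 0 T, ‖x n i s - x n i t‖ ≤ K i * |s - t|) :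
    ∃ φ : ℕ → ℕ, StrictMono φ ∧ ∃ y : ι → ℝ → ℂ, ∀ i, ∀ t ∈ Icc 0 T,
      Tendsto (fun n => x (φ n) i t) atTop (𝓝 (y i t)) := by
  -- Rational times are projected to the interval, so that they need not be restricted to it.
  set X : ℕ → ι × ℚ → ℂ := fun n p => x n p.1 (projIcc 0 T hT (p.2 : ℝ))
  have hS : IsCompact (univ.pi fun p : ι × ℚ => Metric.closedBall (0 : ℂ) (C p.1)) :=
    isCompact_univ_pi fun p => isCompact_closedBall _ _
  obtain ⟨a, -, φ, hφ, ha⟩ := hS.tendsto_subseq (x := X) fun n p _ => by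
    rw [mem_closedBall_zero_iff]
    exact hb n p.1 _ (projIcc 0 T hT _).2
  have hcau : ∀ i, ∀ t ∈ Icc 0 T, CauchySeq fun n => x (φ n) i t := by
    intro i t ht
    rw [Metric.cauchySeq_iff]
    intro ε hε
    have hK : 0 < 4 * (|K i| + 1) := by positivity
    obtain ⟨q, hq1, hq2⟩ := exists_rat_btwn (show t < t + ε / (4 * (|K i| + 1)) by
      linarith [div_pos hε hK])
    obtain ⟨r, hr⟩ : ∃ r : ℝ, r = ↑(projIcc 0 T hT (q : ℝ)) := ⟨_, rfl⟩
    have hrt : |r - t| ≤ ε / (4 * (|K i| + 1)) := by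
      -- The projection is nonexpansive and fixes t.
      have h1 : |r - t| ≤ |(q : ℝ) - t| := by
        have := abs_projIcc_sub_projIcc (h := hT) (c := (q : ℝ)) (d := t)
        rwa [projIcc_of_mem hT ht, ← hr] at this
      have h2 : |(q : ℝ) - t| = q - t := abs_of_nonneg (by linarith)
      linarith
    have hKr : ∀ n, ‖x n i r - x n i t‖ ≤ ε / 4 := fun n =>
      calc ‖x n i r - x n i t‖ ≤ K i * |r - t| := hl n i r (hr ▸ (projIcc 0 T hT _).2) t ht
        _ ≤ (|K i| + 1) * (ε / (4 * (|K i| + 1))) := by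
            gcongr
            linarith [le_abs_self (K i)]
        _ = ε / 4 := by field_simp
    have hq := (tendsto_pi_nhds.1 ha (i, q)).cauchySeq
    obtain ⟨N, hN⟩ := (Metric.cauchySeq_iff.1 hq) (ε / 2) (by positivity)
    refine ⟨N, fun m hm n hn => ?_⟩
    have h1 := hN m hm n hn
    simp only [X, Function.comp_apply, dist_eq_norm, ← hr] at h1 ⊢
    have h2 := hKr (φ m)
    have h3 := hKr (φ n)
    rw [norm_sub_rev] at h2
    calc ‖x (φ m) i t - x (φ n) i t‖ = ‖(x (φ m) i t - x (φ m) i r) +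
          (x (φ m) i r - x (φ n) i r) + (x (φ n) i r - x (φ n) i t)‖ := by ring_nf
      _ ≤ _ := norm_add₃_le
      _ < ε := by linarith
  choose! y hy using fun i t ht => cauchySeq_tendsto_of_complete (hcau i t ht)
  exact ⟨φ, hφ, y, fun i t ht => hy i t ht⟩

/-! ### Lower semicontinuity of the Sobolev norms -/

theorem sobNormSq_le_liminf {s : ℝ} {c : ℕ → FSeries} {d : FSeries}
    (h : ∀ k, Tendsto (fun n => c n k) atTop (𝓝 (d k))) :
    sobNormSq s d ≤ liminf (fun n => sobNormSq s (c n)) atTop := by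
  rw [sobNormSq, ENNReal.tsum_eq_iSup_sum]
  refine iSup_le fun S => ?_
  have hS : Tendsto (fun n => ∑ k ∈ S, ENNReal.ofReal ((1 + lapSymbol k) ^ s) * ‖c n k‖ₑ ^ 2) atTop
      (𝓝 (∑ k ∈ S, ENNReal.ofReal ((1 + lapSymbol k) ^ s) * ‖d k‖ₑ ^ 2)) :=
    tendsto_finsetSum _ fun k _ => ENNReal.Tendsto.const_mul
      (ENNReal.Tendsto.pow (h k).enorm) (Or.inr ENNReal.ofReal_ne_top)
  rw [← hS.liminf_eq]
  exact liminf_le_liminf (Eventually.of_forall fun n => ENNReal.sum_le_tsum S)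

theorem sobNormSq_le_of_tendsto {s : ℝ} {c : ℕ → FSeries} {d : FSeries} {R : ℝ≥0∞}
    (h : ∀ k, Tendsto (fun n => c n k) atTop (𝓝 (d k))) (hR : ∀ n, sobNormSq s (c n) ≤ R) :
    sobNormSq s d ≤ R :=
  (sobNormSq_le_liminf h).trans (liminf_le_of_le (by isBoundedDefault) fun b hb => by
    obtain ⟨n, hn⟩ := hb.exists
    exact hn.trans (hR n))

theorem aemeasurable_sobNormSq {s : ℝ} {c : ℝ → FSeries} {m : Measure ℝ}
    (h : ∀ k, AEStronglyMeasurable (fun t => c t k) m) :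
    AEMeasurable (fun t => sobNormSq s (c t)) m :=
  AEMeasurable.tsum fun k => ((h k).enorm.pow_const 2).const_mul _

/-- Fatou's lemma in time on top of lower semicontinuity in the frequencies. Time-integrated bounds
thus survive coefficientwise convergence. -/
theorem lintegral_sobNormSq_le_of_tendsto {s : ℝ} {m : Measure ℝ} {c : ℕ → ℝ → FSeries}
    {d : ℝ → FSeries} {R : ℝ≥0∞} (hc : ∀ n k, AEStronglyMeasurable (fun t => c n t k) m)
    (h : ∀ᵐ t ∂m, ∀ k, Tendsto (fun n => c n t k) atTop (𝓝 (d t k)))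
    (hR : ∀ n, ∫⁻ t, sobNormSq s (c n t) ∂m ≤ R) : ∫⁻ t, sobNormSq s (d t) ∂m ≤ R :=
  calc ∫⁻ t, sobNormSq s (d t) ∂m
      ≤ ∫⁻ t, liminf (fun n => sobNormSq s (c n t)) atTop ∂m :=
        lintegral_mono_ae (h.mono fun t ht => sobNormSq_le_liminf ht)
    _ ≤ liminf (fun n => ∫⁻ t, sobNormSq s (c n t) ∂m) atTop :=
        lintegral_liminf_le' fun n => aemeasurable_sobNormSq (hc n)
    _ ≤ R := liminf_le_of_le (by isBoundedDefault) fun b hb => by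
        obtain ⟨n, hn⟩ := hb.exists
        exact hn.trans (hR n)

/-! ### Elementary properties of the Sobolev norms -/

theorem one_le_one_add_lapSymbol (k : Fin 2 → ℤ) : 1 ≤ 1 + lapSymbol k := by
  linarith [lapSymbol_nonneg k]

theorem sobNormSq_mono {r s : ℝ} (h : r ≤ s) (c : FSeries) : sobNormSq r c ≤ sobNormSq s c :=
  ENNReal.tsum_le_tsum fun k => by
    gcongr
    exact one_le_one_add_lapSymbol k

theorem sobNormSq_zero_eq (c : FSeries) : sobNormSq 0 c = ∑' k, ‖c k‖ₑ ^ 2 := by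
  simp [sobNormSq]

theorem tsum_sq_le_sobNormSq {s : ℝ} (hs : 0 ≤ s) (c : FSeries) :
    ∑' k, ‖c k‖ₑ ^ 2 ≤ sobNormSq s c :=
  (sobNormSq_zero_eq c).symm.le.trans (sobNormSq_mono hs c)

theorem tsum_lt_top_of_sobNormSq {c : FSeries} (h : sobNormSq 2 c < ⊤) : ∑' k, ‖c k‖ₑ < ⊤ := by
  have h1 : (∑' k, ‖c k‖ₑ) ^ 2 < ⊤ :=
    (sq_tsum_le_sobNormSq c).trans_lt (ENNReal.mul_lt_top (by simp) h)
  exact (ENNReal.pow_lt_top_iff.1 h1).resolve_right two_ne_zero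

theorem enorm_add_sq_le (a b : ℂ) : ‖a + b‖ₑ ^ 2 ≤ 2 * (‖a‖ₑ ^ 2 + ‖b‖ₑ ^ 2) := by
  have h : ‖a + b‖ ^ 2 ≤ 2 * (‖a‖ ^ 2 + ‖b‖ ^ 2) := by
    nlinarith [norm_add_le a b, norm_nonneg (a + b), norm_nonneg a, norm_nonneg b,
      sq_nonneg (‖a‖ - ‖b‖)]
  have := ENNReal.ofReal_le_ofReal h
  rwa [ENNReal.ofReal_mul (by norm_num), ENNReal.ofReal_add (by positivity) (by positivity),
    ENNReal.ofReal_pow (norm_nonneg _), ENNReal.ofReal_pow (norm_nonneg _),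
    ENNReal.ofReal_pow (norm_nonneg _), ofReal_norm, ofReal_norm, ofReal_norm,
    ENNReal.ofReal_ofNat] at this

theorem sobNormSq_add_le (s : ℝ) (c d : FSeries) :
    sobNormSq s (c + d) ≤ 2 * (sobNormSq s c + sobNormSq s d) := by
  simp only [sobNormSq, ← ENNReal.tsum_add, ← ENNReal.tsum_mul_left]
  refine ENNReal.tsum_le_tsum fun k => ?_
  calc _ ≤ ENNReal.ofReal ((1 + lapSymbol k) ^ s) * (2 * (‖c k‖ₑ ^ 2 + ‖d k‖ₑ ^ 2)) := by
        gcongr; exact enorm_add_sq_le _ _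
    _ = _ := by ring

theorem sobNormSq_neg (s : ℝ) (c : FSeries) : sobNormSq s (-c) = sobNormSq s c := by
  simp [sobNormSq]

theorem sobNormSq_sub_le (s : ℝ) (c d : FSeries) :
    sobNormSq s (c - d) ≤ 2 * (sobNormSq s c + sobNormSq s d) := by
  rw [sub_eq_add_neg, ← sobNormSq_neg s d]
  exact sobNormSq_add_le s c (-d)

theorem sobNormSq_const_mul (s : ℝ) (a : ℂ) (c : FSeries) :
    sobNormSq s (fun k => a * c k) = ‖a‖ₑ ^ 2 * sobNormSq s c := by
  simp only [sobNormSq, ← ENNReal.tsum_mul_left, enorm_mul]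
  exact tsum_congr fun k => by ring

/-- The frequencies with both coordinates in `[-n, n]`. -/
def box (n : ℕ) : Finset (Fin 2 → ℤ) := Fintype.piFinset fun _ => Finset.Icc (-(n : ℤ)) n

theorem mem_box {n : ℕ} {k : Fin 2 → ℤ} : k ∈ box n ↔ ∀ j, |k j| ≤ n := by
  simp [box, abs_le]

theorem neg_mem_box {n : ℕ} {k : Fin 2 → ℤ} (h : k ∈ box n) : -k ∈ box n :=
  mem_box.2 fun j => by simpa using mem_box.1 h j

theorem exists_mem_box (k : Fin 2 → ℤ) : ∃ N, ∀ n ≥ N, k ∈ box n := by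
  refine ⟨(∑ j, |k j|).toNat, fun n hn => mem_box.2 fun j => ?_⟩
  have h := Finset.single_le_sum (f := fun j => |k j|) (fun j _ => abs_nonneg _) (Finset.mem_univ j)
  omega

theorem le_lapSymbol_of_notMem_box {n : ℕ} {k : Fin 2 → ℤ} (h : k ∉ box n) :
    (n : ℝ) ≤ lapSymbol k := by
  rw [mem_box] at h
  push Not at h
  obtain ⟨j, hj⟩ := h
  have h1 : (n : ℝ) ≤ |(k j : ℝ)| := by
    have : ((n : ℤ) : ℝ) ≤ ((|k j| : ℤ) : ℝ) := by exact_mod_cast hj.le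
    simpa using this
  have h2 : (1 : ℝ) ≤ |(k j : ℝ)| := by
    have : ((1 : ℤ) : ℝ) ≤ ((|k j| : ℤ) : ℝ) := by exact_mod_cast (by omega : (1 : ℤ) ≤ |k j|)
    simpa using this
  have h3 := two_pi_abs_le_freq k j
  have h4 : |(k j : ℝ)| ≤ freq k := by nlinarith [Real.pi_gt_three]
  rw [← freq_sq]
  nlinarith

/-- Bounded sequences in `H^1` converging coefficientwise converge strongly in `L²`. -/
theorem tendsto_tsum_sq_sub {c : ℕ → FSeries} {d : FSeries} {R : ℝ≥0∞} (hR : R ≠ ⊤)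
    (h : ∀ k, Tendsto (fun n => c n k) atTop (𝓝 (d k))) (hb : ∀ n, sobNormSq 1 (c n) ≤ R) :
    Tendsto (fun n => ∑' k, ‖c n k - d k‖ₑ ^ 2) atTop (𝓝 0) := by
  have hd : sobNormSq 1 d ≤ R := sobNormSq_le_of_tendsto h hb
  have hR4 : 2 * (R + R) ≠ ⊤ := by finiteness
  -- Outside the box of size N the H¹ weight is at least N, so the tail is at most 1/N times the H¹
  -- bound, uniformly in n. Inside there are finitely many modes.
  have hsplit : ∀ N n, ∑' k, ‖c n k - d k‖ₑ ^ 2 ≤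
      ∑ k ∈ box N, ‖c n k - d k‖ₑ ^ 2 + (2 * (R + R)) / (N : ℝ≥0∞) := by
    intro N n
    have h1 : ∀ k, ‖c n k - d k‖ₑ ^ 2 ≤ (if k ∈ box N then ‖c n k - d k‖ₑ ^ 2 else 0) +
        (N : ℝ≥0∞)⁻¹ * (ENNReal.ofReal ((1 + lapSymbol k) ^ (1 : ℝ)) * ‖(c n - d) k‖ₑ ^ 2) := by
      intro k
      split_ifs with hk
      · exact le_self_add
      · rw [zero_add, ← mul_assoc, Pi.sub_apply]
        -- For N = 0 the factor N⁻¹ is infinite and the estimate is vacuous, except that infinity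
        -- times zero has to be examined.
        rcases Nat.eq_zero_or_pos N with rfl | hN
        · simp only [Nat.cast_zero, ENNReal.inv_zero]
          rw [ENNReal.top_mul (by
            rw [Real.rpow_one, Ne, ENNReal.ofReal_eq_zero]; linarith [one_le_one_add_lapSymbol k])]
          by_cases hz : ‖c n k - d k‖ₑ ^ 2 = 0
          · simp [hz]
          · simp [ENNReal.top_mul hz]
        refine le_mul_of_one_le_left' ?_
        rw [Real.rpow_one]
        have : (N : ℝ≥0∞) ≤ ENNReal.ofReal (1 + lapSymbol k) := by
          rw [← ENNReal.ofReal_natCast]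
          exact ENNReal.ofReal_le_ofReal (by linarith [le_lapSymbol_of_notMem_box hk])
        calc (1 : ℝ≥0∞) = (N : ℝ≥0∞)⁻¹ * N :=
              (ENNReal.inv_mul_cancel (by positivity) (by simp)).symm
          _ ≤ _ := by gcongr
    calc _ ≤ _ := ENNReal.tsum_le_tsum h1
      _ = ∑ k ∈ box N, ‖c n k - d k‖ₑ ^ 2 + (N : ℝ≥0∞)⁻¹ * sobNormSq 1 (c n - d) := by
          rw [ENNReal.tsum_add, ENNReal.tsum_mul_left, sobNormSq]
          congr 1
          rw [tsum_eq_sum (s := box N) fun k hk => if_neg hk]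
          exact Finset.sum_congr rfl fun k hk => if_pos hk
      _ ≤ _ := by
          rw [div_eq_mul_inv, mul_comm (2 * (R + R))]
          gcongr
          exact (sobNormSq_sub_le _ _ _).trans (by gcongr; exact hb n)
  rw [ENNReal.tendsto_nhds_zero]
  intro ε hε
  have ht : Tendsto (fun N : ℕ => (2 * (R + R)) / (N : ℝ≥0∞)) atTop (𝓝 0) := by
    have := ENNReal.Tendsto.const_mul (a := 2 * (R + R)) ENNReal.tendsto_inv_nat_nhds_zero
      (Or.inr hR4)
    simpa [div_eq_mul_inv] using this
  have hε2 : 0 < ε / 2 := ENNReal.half_pos hε.ne'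
  obtain ⟨N, hN⟩ := ((ENNReal.tendsto_nhds_zero.1 ht) (ε / 2) hε2).exists
  have hf : Tendsto (fun n => ∑ k ∈ box N, ‖c n k - d k‖ₑ ^ 2) atTop (𝓝 0) := by
    have : Tendsto (fun n => ∑ k ∈ box N, ‖c n k - d k‖ₑ ^ 2) atTop
        (𝓝 (∑ k ∈ box N, ‖d k - d k‖ₑ ^ 2)) :=
      tendsto_finsetSum _ fun k _ => ENNReal.Tendsto.pow ((h k).sub_const (d k)).enorm
    simpa using this
  filter_upwards [(ENNReal.tendsto_nhds_zero.1 hf) (ε / 2) hε2] with n hn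
  calc _ ≤ _ := hsplit N n
    _ ≤ ε / 2 + ε / 2 := by gcongr
    _ = ε := ENNReal.add_halves ε

end CalmedMHD

end

noncomputable section

namespace CalmedMHD

/-! ### Linear equations for a single Fourier mode -/

/-- The initial value and the forcing, as they enter the energy inequality of the mode equation
`c' = -κ l c + h`. -/
def modeData (T κ l : ℝ) (c h : ℝ → ℂ) : ℝ≥0∞ :=
  ‖c 0‖ₑ ^ 2 + ENNReal.ofReal (κ * (1 + l))⁻¹ * ∫⁻ t in Ioo 0 T, ‖h t + κ * c t‖ₑ ^ 2

/-- Weak solutions of `c' = -κ l c + h` with the energy inequality. -/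
structure IsModeSolution (T κ l : ℝ) (c h : ℝ → ℂ) : Prop where
  cont : ContinuousOn c (Icc 0 T)
  meas : AEStronglyMeasurable h (volume.restrict (Ioo 0 T))
  weak : ∀ φ : ℝ → ℝ, ContDiff ℝ ∞ φ → HasCompactSupport φ → tsupport φ ⊆ Ioo 0 T →
    ∫ t in Ioo 0 T, ((deriv φ t : ℝ) : ℂ) * c t =
      -∫ t in Ioo 0 T, ((φ t : ℝ) : ℂ) * (-(κ * l) * c t + h t)
  bound : ∀ t ∈ Icc 0 T, ‖c t‖ₑ ^ 2 ≤ modeData T κ l c h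
  bound_integral : ENNReal.ofReal (κ * (1 + l)) * ∫⁻ t in Ioo 0 T, ‖c t‖ₑ ^ 2 ≤ modeData T κ l c h

theorem enorm_sq_eq (z : ℂ) : ‖z‖ₑ ^ 2 = ENNReal.ofReal (‖z‖ ^ 2) := by
  rw [ENNReal.ofReal_pow (norm_nonneg _), ofReal_norm]

theorem lintegral_enorm_sq_eq {T : ℝ} (hT : 0 ≤ T) {f : ℝ → ℂ} (hf : ContinuousOn f (Icc 0 T)) :
    ∫⁻ t in Ioo 0 T, ‖f t‖ₑ ^ 2 = ENNReal.ofReal (∫ t in (0 : ℝ)..T, ‖f t‖ ^ 2) := by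
  have hi : IntegrableOn (fun t => ‖f t‖ ^ 2) (Ioo 0 T) :=
    ((hf.norm.pow 2).integrableOn_Icc).mono_set Ioo_subset_Icc_self
  rw [intervalIntegral.integral_of_le hT, integral_Ioc_eq_integral_Ioo,
    ofReal_integral_eq_lintegral_ofReal hi (ae_of_all _ fun t => sq_nonneg _)]
  simp only [enorm_sq_eq]

/-- The equation is read as c' = -κ(1 + l)c + (h + κc). The shift keeps the damping positive at
frequency zero and matches the weight 1 + l of the Sobolev norms; Young's inequality does the rest.
-/
theorem mode_rate_le {κ l : ℝ} (hκ : 0 < κ) (hl : 0 ≤ l) (c h : ℂ) :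
    2 * (conj c * (-(κ * l) * c + h)).re + κ * (1 + l) * ‖c‖ ^ 2 ≤
      (κ * (1 + l))⁻¹ * ‖h + κ * c‖ ^ 2 := by
  set m := κ * (1 + l) with hm
  have hm0 : 0 < m := by positivity
  have h1 : (conj c * (-(κ * l) * c + h)).re = -m * ‖c‖ ^ 2 + (conj c * (h + κ * c)).re := by
    have : conj c * (-(κ * l) * c + h) = -(m : ℂ) * (conj c * c) + conj c * (h + κ * c) := by
      rw [hm]; push_cast; ring
    rw [this, Complex.conj_mul', Complex.add_re]
    congr 1
    rw [← Complex.ofReal_pow, ← Complex.ofReal_neg, ← Complex.ofReal_mul, Complex.ofReal_re]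
  have h2 : (conj c * (h + κ * c)).re ≤ ‖c‖ * ‖h + κ * c‖ :=
    (Complex.re_le_norm _).trans (by rw [norm_mul, RCLike.norm_conj])
  have h3 : 2 * (‖c‖ * ‖h + κ * c‖) ≤ m * ‖c‖ ^ 2 + m⁻¹ * ‖h + κ * c‖ ^ 2 := by
    have := mul_nonneg (inv_pos.2 hm0).le (sq_nonneg (m * ‖c‖ - ‖h + κ * c‖))
    have h4 : m⁻¹ * (m * ‖c‖ - ‖h + κ * c‖) ^ 2 =
        m * ‖c‖ ^ 2 + m⁻¹ * ‖h + κ * c‖ ^ 2 - 2 * (‖c‖ * ‖h + κ * c‖) := by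
      field_simp
      ring
    linarith
  rw [h1]
  linarith

theorem eq_zero_of_tsupport {T : ℝ} {φ : ℝ → ℝ} (h : tsupport φ ⊆ Ioo 0 T) :
    φ 0 = 0 ∧ φ T = 0 :=
  ⟨image_eq_zero_of_notMem_tsupport fun h0 => (h h0).1.false,
    image_eq_zero_of_notMem_tsupport fun h0 => (h h0).2.false⟩

/-- Both bounds come from Grönwall's inequality with zero rate; the weak form is integration by
parts, the boundary terms vanishing by the support of the test function. -/
theorem isModeSolution_of_hasDerivWithinAt {T κ l : ℝ} (hT : 0 < T) (hκ : 0 < κ) (hl : 0 ≤ l)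
    {c h : ℝ → ℂ} (hc : ∀ t ∈ Icc 0 T, HasDerivWithinAt c (-(κ * l) * c t + h t) (Icc 0 T) t)
    (hh : ContinuousOn h (Icc 0 T)) : IsModeSolution T κ l c h := by
  have hcc : ContinuousOn c (Icc 0 T) := fun t ht => (hc t ht).continuousWithinAt
  have hw : ContinuousOn (fun t => h t + κ * c t) (Icc 0 T) := hh.add (hcc.const_mul _)
  have hm : 0 < κ * (1 + l) := by positivity
  have hdata : modeData T κ l c h = ENNReal.ofReal
      (‖c 0‖ ^ 2 + ∫ t in (0 : ℝ)..T, (κ * (1 + l))⁻¹ * ‖h t + κ * c t‖ ^ 2) := by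
    have h0 : 0 ≤ ∫ t in (0 : ℝ)..T, ‖h t + κ * c t‖ ^ 2 :=
      intervalIntegral.integral_nonneg hT.le fun _ _ => sq_nonneg _
    rw [modeData, lintegral_enorm_sq_eq hT.le hw, enorm_sq_eq, ← ENNReal.ofReal_mul (by positivity),
      intervalIntegral.integral_const_mul, ENNReal.ofReal_add (by positivity) (by positivity)]
  have hG : ∀ t ∈ Icc 0 T, ‖c t‖ ^ 2 + ∫ s in (0 : ℝ)..t, κ * (1 + l) * ‖c s‖ ^ 2 ≤
      ‖c 0‖ ^ 2 + ∫ t in (0 : ℝ)..T, (κ * (1 + l))⁻¹ * ‖h t + κ * c t‖ ^ 2 := by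
    intro t ht
    have := gronwall_dissipation (T := T) (A := 0) (Y := fun t => ‖c t‖ ^ 2)
      (Y' := fun t => 2 * (conj (c t) * (-(κ * l) * c t + h t)).re) (a := fun _ => 0)
      (f := fun t => (κ * (1 + l))⁻¹ * ‖h t + κ * c t‖ ^ 2)
      (D := fun t => κ * (1 + l) * ‖c t‖ ^ 2) (fun t ht => hasDerivWithinAt_norm_sq (hc t ht))
      continuousOn_const (continuousOn_const.mul (hw.norm.pow 2))
      (continuousOn_const.mul (hcc.norm.pow 2)) (fun _ _ => le_rfl) (fun _ _ => by positivity)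
      (fun _ _ => by positivity) (fun _ _ => by positivity)
      (fun t _ => by
        rw [zero_mul, zero_add]
        exact mode_rate_le hκ hl (c t) (h t)) (by simp) le_rfl ht
    simpa using this
  refine ⟨hcc, (hh.mono Ioo_subset_Icc_self).aestronglyMeasurable measurableSet_Ioo, ?_, ?_, ?_⟩
  · intro φ hφ _ hsupp
    obtain ⟨h0, h1⟩ := eq_zero_of_tsupport hsupp
    have hφ1 : Continuous (deriv φ) := hφ.continuous_deriv (by simp)
    have hd1 : ContinuousOn (fun t => ((deriv φ t : ℝ) : ℂ) * c t) (Icc 0 T) :=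
      (Complex.continuous_ofReal.comp hφ1).continuousOn.mul hcc
    have hd2 : ContinuousOn (fun t => ((φ t : ℝ) : ℂ) * (-(κ * l) * c t + h t)) (Icc 0 T) :=
      (Complex.continuous_ofReal.comp hφ.continuous).continuousOn.mul ((hcc.const_mul _).add hh)
    have hFTC := intervalIntegral.integral_eq_sub_of_hasDerivAt_of_le hT.le
      (f := fun t => ((φ t : ℝ) : ℂ) * c t)
      (f' := fun t => ((deriv φ t : ℝ) : ℂ) * c t + ((φ t : ℝ) : ℂ) * (-(κ * l) * c t + h t))
      ((Complex.continuous_ofReal.comp hφ.continuous).continuousOn.mul hcc)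
      (fun t ht => by
        have hφd : HasDerivAt φ (deriv φ t) t :=
          ((hφ.differentiable (by simp)) t).hasDerivAt
        exact hφd.ofReal_comp.mul
          ((hc t (Ioo_subset_Icc_self ht)).hasDerivAt (Icc_mem_nhds ht.1 ht.2)))
      ((hd1.add hd2).intervalIntegrable_of_Icc hT.le)
    rw [h0, h1, intervalIntegral.integral_of_le hT.le, integral_Ioc_eq_integral_Ioo,
      integral_add ((hd1.integrableOn_Icc).mono_set Ioo_subset_Icc_self)
        ((hd2.integrableOn_Icc).mono_set Ioo_subset_Icc_self)] at hFTC
    simp only [Complex.ofReal_zero, zero_mul, sub_zero] at hFTC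
    exact eq_neg_of_add_eq_zero_left hFTC
  · intro t ht
    rw [hdata, enorm_sq_eq]
    refine ENNReal.ofReal_le_ofReal (le_trans ?_ (hG t ht))
    have : 0 ≤ ∫ s in (0 : ℝ)..t, κ * (1 + l) * ‖c s‖ ^ 2 :=
      intervalIntegral.integral_nonneg ht.1 fun _ _ => by positivity
    linarith
  · rw [hdata, lintegral_enorm_sq_eq hT.le hcc, ← ENNReal.ofReal_mul hm.le,
      ← intervalIntegral.integral_const_mul]
    refine ENNReal.ofReal_le_ofReal (le_trans ?_ (hG T (right_mem_Icc.2 hT.le)))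
    have : 0 ≤ ‖c T‖ ^ 2 := by positivity
    linarith

/-- For a single mode everything is bounded uniformly in n and t, so dominated convergence passes to
the limit in the weak form and in both sides of the energy inequalities. The forcing need only
converge at almost every time, which is all that is available for the heating. -/
theorem IsModeSolution.of_tendsto {T κ l : ℝ} (hT : 0 < T) (hκ : 0 < κ) (hl : 0 ≤ l) {c h : ℕ → ℝ → ℂ}
    {d f : ℝ → ℂ} (hs : ∀ n, IsModeSolution T κ l (c n) (h n)) {C K F : ℝ}
    (hC : ∀ n, ∀ t ∈ Icc 0 T, ‖c n t‖ ≤ C) (hF : ∀ n, ∀ t ∈ Icc 0 T, ‖h n t‖ ≤ F)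
    (hK : ∀ n, ∀ s ∈ Icc 0 T, ∀ t ∈ Icc 0 T, ‖c n s - c n t‖ ≤ K * |s - t|)
    (hc : ∀ t ∈ Icc 0 T, Tendsto (fun n => c n t) atTop (𝓝 (d t)))
    (hh : ∀ᵐ t ∂volume.restrict (Ioo 0 T), Tendsto (fun n => h n t) atTop (𝓝 (f t))) :
    IsModeSolution T κ l d f := by
  have hmem : ∀ᵐ t ∂volume.restrict (Ioo 0 T), t ∈ Icc 0 T :=
    (ae_restrict_mem measurableSet_Ioo).mono fun t ht => Ioo_subset_Icc_self ht
  have h0 : (0 : ℝ) ∈ Icc 0 T := left_mem_Icc.2 hT.le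
  have hC0 : 0 ≤ C := (norm_nonneg _).trans (hC 0 0 h0)
  have hF0 : 0 ≤ F := (norm_nonneg _).trans (hF 0 0 h0)
  have hcm : ∀ n, AEStronglyMeasurable (c n) (volume.restrict (Ioo 0 T)) := fun n =>
    ((hs n).cont.mono Ioo_subset_Icc_self).aestronglyMeasurable measurableSet_Ioo
  have hvm : ∀ n, AEStronglyMeasurable (fun t => -(κ * l) * c n t + h n t)
      (volume.restrict (Ioo 0 T)) := fun n => ((hcm n).const_mul _).add (hs n).meas
  have hwm : ∀ n, AEStronglyMeasurable (fun t => h n t + κ * c n t)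
      (volume.restrict (Ioo 0 T)) := fun n => (hs n).meas.add ((hcm n).const_mul _)
  have hfin : volume (Ioo 0 T) ≠ ⊤ := by simp
  have hdata : Tendsto (fun n => modeData T κ l (c n) (h n)) atTop (𝓝 (modeData T κ l d f)) := by
    refine (ENNReal.Tendsto.pow (hc 0 h0).enorm).add (ENNReal.Tendsto.const_mul ?_
      (Or.inr ENNReal.ofReal_ne_top))
    refine tendsto_lintegral_of_dominated_convergence' (fun _ => ENNReal.ofReal ((F + κ * C) ^ 2))
      (fun n => (hwm n).enorm.pow_const 2) (fun n => ?_) ?_ ?_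
    · filter_upwards [hmem] with t ht
      rw [enorm_sq_eq]
      refine ENNReal.ofReal_le_ofReal (pow_le_pow_left₀ (norm_nonneg _) ?_ 2)
      refine (norm_add_le _ _).trans (add_le_add (hF n t ht) ?_)
      rw [norm_mul, Complex.norm_of_nonneg hκ.le]
      exact mul_le_mul_of_nonneg_left (hC n t ht) hκ.le
    · simp [ENNReal.mul_eq_top]
    · filter_upwards [hmem, hh] with t ht hht
      exact ENNReal.Tendsto.pow (hht.add ((hc t ht).const_mul _)).enorm
  have hL : Tendsto (fun n => ∫⁻ t in Ioo 0 T, ‖c n t‖ₑ ^ 2) atTop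
      (𝓝 (∫⁻ t in Ioo 0 T, ‖d t‖ₑ ^ 2)) := by
    refine tendsto_lintegral_of_dominated_convergence' (fun _ => ENNReal.ofReal (C ^ 2))
      (fun n => (hcm n).enorm.pow_const 2) (fun n => ?_) ?_ ?_
    · filter_upwards [hmem] with t ht
      rw [enorm_sq_eq]
      exact ENNReal.ofReal_le_ofReal (pow_le_pow_left₀ (norm_nonneg _) (hC n t ht) 2)
    · simp [ENNReal.mul_eq_top]
    · filter_upwards [hmem] with t ht
      exact ENNReal.Tendsto.pow (hc t ht).enorm
  have hdK : ∀ s ∈ Icc 0 T, ∀ t ∈ Icc 0 T, ‖d s - d t‖ ≤ K * |s - t| := fun s hs' t ht =>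
    le_of_tendsto ((hc s hs').sub (hc t ht)).norm (Eventually.of_forall fun n => hK n s hs' t ht)
  refine ⟨?_, aestronglyMeasurable_of_tendsto_ae atTop (fun n => (hs n).meas) hh, ?_, ?_, ?_⟩
  · refine (LipschitzOnWith.of_dist_le_mul (K := K.toNNReal) fun s hs' t ht => ?_).continuousOn
    rw [dist_eq_norm, Real.dist_eq]
    exact (hdK s hs' t ht).trans (by gcongr; exact Real.le_coe_toNNReal K)
  · intro φ hφ hcs hsupp
    have hφ1 : Continuous (deriv φ) := hφ.continuous_deriv (by simp)
    obtain ⟨P, hP⟩ := hφ.continuous.bounded_above_of_compact_support hcs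
    obtain ⟨Q, hQ⟩ := hφ1.bounded_above_of_compact_support hcs.deriv
    have hP0 : 0 ≤ P := (norm_nonneg _).trans (hP 0)
    have hQ0 : 0 ≤ Q := (norm_nonneg _).trans (hQ 0)
    have ht1 : Tendsto (fun n => ∫ t in Ioo 0 T, ((deriv φ t : ℝ) : ℂ) * c n t) atTop
        (𝓝 (∫ t in Ioo 0 T, ((deriv φ t : ℝ) : ℂ) * d t)) := by
      refine tendsto_integral_of_dominated_convergence (fun _ => Q * C)
        (fun n => (Complex.continuous_ofReal.comp hφ1).aestronglyMeasurable.mul (hcm n))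
        (integrableOn_const hfin) (fun n => ?_) ?_
      · filter_upwards [hmem] with t ht
        rw [norm_mul, Complex.norm_real]
        exact mul_le_mul (hQ t) (hC n t ht) (norm_nonneg _) hQ0
      · filter_upwards [hmem] with t ht
        exact (hc t ht).const_mul _
    have ht2 : Tendsto (fun n => ∫ t in Ioo 0 T, ((φ t : ℝ) : ℂ) * (-(κ * l) * c n t + h n t)) atTop
        (𝓝 (∫ t in Ioo 0 T, ((φ t : ℝ) : ℂ) * (-(κ * l) * d t + f t))) := by
      refine tendsto_integral_of_dominated_convergence (fun _ => P * (κ * l * C + F))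
        (fun n => (Complex.continuous_ofReal.comp hφ.continuous).aestronglyMeasurable.mul (hvm n))
        (integrableOn_const hfin) (fun n => ?_) ?_
      · filter_upwards [hmem] with t ht
        rw [norm_mul, Complex.norm_real]
        refine mul_le_mul (hP t) ?_ (norm_nonneg _) hP0
        refine (norm_add_le _ _).trans (add_le_add ?_ (hF n t ht))
        rw [norm_mul, norm_neg, ← Complex.ofReal_mul, Complex.norm_of_nonneg (by positivity)]
        exact mul_le_mul_of_nonneg_left (hC n t ht) (by positivity)
      · filter_upwards [hmem, hh] with t ht hht
        exact (((hc t ht).const_mul _).add hht).const_mul _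
    refine tendsto_nhds_unique ht1 ?_
    simp only [fun n => (hs n).weak φ hφ hcs hsupp]
    exact ht2.neg
  · exact fun t ht => le_of_tendsto_of_tendsto' (ENNReal.Tendsto.pow (hc t ht).enorm) hdata
      fun n => (hs n).bound t ht
  · exact le_of_tendsto_of_tendsto' (ENNReal.Tendsto.const_mul hL (Or.inr ENNReal.ofReal_ne_top))
      hdata fun n => (hs n).bound_integral

end CalmedMHD

end

noncomputable section

namespace CalmedMHD

/-! ### States bounded in `H^2 × H^2 × L²` -/

/-- Admissible states with velocity and magnetic field bounded in `H^2` and temperature bounded in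
`L²`. -/
structure IsBoundedState (C : ℝ≥0) (u b : Fin 2 → FSeries) (θ : FSeries) : Prop where
  real_u : ∀ i, IsRealValued (u i)
  real_b : ∀ i, IsRealValued (b i)
  real_θ : IsRealValued θ
  sol_u : IsSolenoidal u
  sol_b : IsSolenoidal b
  bound_u : ∀ i, sobNormSq 2 (u i) ≤ C
  bound_b : ∀ i, sobNormSq 2 (b i) ≤ C
  bound_θ : ∑' k, ‖θ k‖ₑ ^ 2 ≤ C

theorem isRealValued_of_tendsto {c : ℕ → FSeries} {d : FSeries}
    (h : ∀ k, Tendsto (fun n => c n k) atTop (𝓝 (d k))) (hc : ∀ n, IsRealValued (c n)) :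
    IsRealValued d := fun k =>
  tendsto_nhds_unique (h (-k)) (by
    simp only [fun n => hc n k]
    exact (Complex.continuous_conj.tendsto _).comp (h k))

theorem isSolenoidal_of_tendsto {v : ℕ → Fin 2 → FSeries} {w : Fin 2 → FSeries}
    (h : ∀ i k, Tendsto (fun n => v n i k) atTop (𝓝 (w i k))) (hv : ∀ n, IsSolenoidal (v n)) :
    IsSolenoidal w := by
  refine ⟨fun i => tendsto_nhds_unique (h i 0) (by simp [fun n => (hv n).1 i]), fun k => ?_⟩
  have h1 : Tendsto (fun n => ∑ j, (2 * Real.pi * Complex.I * (k j : ℂ)) * v n j k) atTop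
      (𝓝 (∑ j, (2 * Real.pi * Complex.I * (k j : ℂ)) * w j k)) :=
    tendsto_finsetSum _ fun j _ => (h j k).const_mul _
  exact tendsto_nhds_unique h1 (by simp [fun n => (hv n).2 k])

theorem tsum_sq_le_of_tendsto {c : ℕ → FSeries} {d : FSeries} {R : ℝ≥0∞}
    (h : ∀ k, Tendsto (fun n => c n k) atTop (𝓝 (d k))) (hR : ∀ n, ∑' k, ‖c n k‖ₑ ^ 2 ≤ R) :
    ∑' k, ‖d k‖ₑ ^ 2 ≤ R := by
  rw [← sobNormSq_zero_eq]
  exact sobNormSq_le_of_tendsto h fun n => (sobNormSq_zero_eq _).le.trans (hR n)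

theorem IsBoundedState.of_tendsto {C : ℝ≥0} {u b : ℕ → Fin 2 → FSeries} {θ : ℕ → FSeries}
    {v w : Fin 2 → FSeries} {η : FSeries} (h : ∀ n, IsBoundedState C (u n) (b n) (θ n))
    (hu : ∀ i k, Tendsto (fun n => u n i k) atTop (𝓝 (v i k)))
    (hb : ∀ i k, Tendsto (fun n => b n i k) atTop (𝓝 (w i k)))
    (hθ : ∀ k, Tendsto (fun n => θ n k) atTop (𝓝 (η k))) : IsBoundedState C v w η where
  real_u i := isRealValued_of_tendsto (hu i) fun n => (h n).real_u i
  real_b i := isRealValued_of_tendsto (hb i) fun n => (h n).real_b i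
  real_θ := isRealValued_of_tendsto hθ fun n => (h n).real_θ
  sol_u := isSolenoidal_of_tendsto hu fun n => (h n).sol_u
  sol_b := isSolenoidal_of_tendsto hb fun n => (h n).sol_b
  bound_u i := sobNormSq_le_of_tendsto (hu i) fun n => (h n).bound_u i
  bound_b i := sobNormSq_le_of_tendsto (hb i) fun n => (h n).bound_b i
  bound_θ := tsum_sq_le_of_tendsto hθ fun n => (h n).bound_θ

theorem norm_le_of_enorm_le {z : ℂ} {r : ℝ} (hr : 0 ≤ r) (h : ‖z‖ₑ ≤ ENNReal.ofReal r) :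
    ‖z‖ ≤ r := by
  rw [← ofReal_norm] at h
  exact (ENNReal.ofReal_le_ofReal_iff hr).1 h

theorem norm_sq_le_of_tsum_sq_le {c : FSeries} {r : ℝ} (hr : 0 ≤ r)
    (h : ∑' k, ‖c k‖ₑ ^ 2 ≤ ENNReal.ofReal r) (k : Fin 2 → ℤ) : ‖c k‖ ^ 2 ≤ r := by
  have := (ENNReal.le_tsum k).trans h
  rw [enorm_sq_eq] at this
  exact (ENNReal.ofReal_le_ofReal_iff hr).1 this

/-- From x² ≤ r follows x ≤ r + 1, a crude bound that avoids square roots. -/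
theorem norm_le_of_tsum_sq_le {c : FSeries} {r : ℝ} (hr : 0 ≤ r)
    (h : ∑' k, ‖c k‖ₑ ^ 2 ≤ ENNReal.ofReal r) (k : Fin 2 → ℤ) : ‖c k‖ ≤ r + 1 := by
  nlinarith [norm_sq_le_of_tsum_sq_le hr h k, sq_nonneg (‖c k‖ - 1), norm_nonneg (c k)]

theorem tsum_sq_sub_right (c : FSeries) (k : Fin 2 → ℤ) :
    ∑' l, ‖c (k - l)‖ₑ ^ 2 = ∑' l, ‖c l‖ₑ ^ 2 :=
  (Equiv.subLeft k).tsum_eq fun l => ‖c l‖ₑ ^ 2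

theorem sq_tsum_conv_le (a c : FSeries) (k : Fin 2 → ℤ) :
    (∑' l, ‖a l‖ₑ * ‖c (k - l)‖ₑ) ^ 2 ≤ (∑' l, ‖a l‖ₑ ^ 2) * ∑' l, ‖c l‖ₑ ^ 2 := by
  refine (ennreal_tsum_mul_sq_le _ _).trans_eq ?_
  rw [tsum_sq_sub_right]

/-- Cauchy–Schwarz in the convolution. Such bounds, growing in k but uniform in time and in the
approximation, give the equicontinuity of each mode. -/
theorem norm_divP_le {C : ℝ≥0} {v : Fin 2 → FSeries} {w : FSeries}
    (hv : ∀ i, ∑' k, ‖v i k‖ₑ ^ 2 ≤ C) (hw : ∑' k, ‖w k‖ₑ ^ 2 ≤ C) (k : Fin 2 → ℤ) :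
    ‖divP v w k‖ ≤ freq k * (2 * C) := by
  refine norm_le_of_enorm_le (by have := freq_nonneg k; positivity)
    ((enorm_divP_le_freq_mul v w k).trans ?_)
  rw [ENNReal.ofReal_mul (freq_nonneg k), ENNReal.ofReal_mul (by norm_num),
    ENNReal.ofReal_coe_nnreal, ENNReal.ofReal_ofNat]
  gcongr
  simp only [Finset.sum_mul]
  rw [Summable.tsum_finsetSum fun _ _ => ENNReal.summable]
  have h1 : ∀ j ∈ Finset.univ, ∑' l, ‖v j l‖ₑ * ‖w (k - l)‖ₑ ≤ C := fun j _ => by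
    refine (ENNReal.pow_le_pow_left_iff two_ne_zero).1 ((sq_tsum_conv_le _ _ k).trans ?_)
    rw [sq]
    exact mul_le_mul' (hv j) hw
  refine (Finset.sum_le_sum h1).trans_eq ?_
  simp

theorem IsBoundedState.sq_u {C : ℝ≥0} {u b : Fin 2 → FSeries} {θ : FSeries}
    (h : IsBoundedState C u b θ) (i : Fin 2) : ∑' k, ‖u i k‖ₑ ^ 2 ≤ C :=
  (tsum_sq_le_sobNormSq (by norm_num) _).trans (h.bound_u i)

theorem IsBoundedState.sq_b {C : ℝ≥0} {u b : Fin 2 → FSeries} {θ : FSeries}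
    (h : IsBoundedState C u b θ) (i : Fin 2) : ∑' k, ‖b i k‖ₑ ^ 2 ≤ C :=
  (tsum_sq_le_sobNormSq (by norm_num) _).trans (h.bound_b i)

theorem norm_leray_le_of_le {v : Fin 2 → FSeries} {r : ℝ} {k : Fin 2 → ℤ} (h : ∀ i, ‖v i k‖ ≤ r)
    (i : Fin 2) : ‖leray v i k‖ ≤ 4 * r := by
  refine (norm_leray_le v i k).trans ?_
  rw [Fin.sum_univ_two]
  linarith [h 0, h 1]

theorem IsBoundedState.norm_forceU_le {C : ℝ≥0} {u b : Fin 2 → FSeries} {θ : FSeries}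
    (h : IsBoundedState C u b θ) {g : ℝ} (hg : 0 < g) (i : Fin 2) (k : Fin 2 → ℤ) :
    ‖forceU g u b θ i k‖ ≤ 16 * (freq k * C) + 4 * g * (C + 1) := by
  have h1 := norm_leray_le_of_le (fun i => norm_divP_le h.sq_u (h.sq_u i) k) i
  have h2 := norm_leray_le_of_le (fun i => norm_divP_le h.sq_b (h.sq_b i) k) i
  have h3 : ‖leray ![0, θ] i k‖ ≤ 4 * (C + 1) := by
    refine norm_leray_le_of_le (fun i => ?_) i
    have := norm_le_of_tsum_sq_le C.2 (by simpa using h.bound_θ) k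
    fin_cases i
    · simp; positivity
    · simpa using this
  have h4 : ‖(g : ℂ) * leray ![0, θ] i k‖ ≤ g * (4 * (C + 1)) := by
    rw [norm_mul, Complex.norm_of_nonneg hg.le]
    gcongr
  refine (norm_add₃_le).trans ?_
  rw [norm_neg]
  linarith

theorem IsBoundedState.norm_forceB_le {C : ℝ≥0} {u b : Fin 2 → FSeries} {θ : FSeries}
    (h : IsBoundedState C u b θ) (i : Fin 2) (k : Fin 2 → ℤ) :
    ‖forceB u b i k‖ ≤ 4 * (freq k * C) := by
  have h1 := norm_divP_le h.sq_b (h.sq_u i) k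
  have h2 := norm_divP_le h.sq_u (h.sq_b i) k
  refine (norm_sub_le _ _).trans ?_
  linarith

/-- The curl costs one derivative, that is one factor of the symbol. -/
theorem sobNormSq_curlCoeff_le (s : ℝ) (b : Fin 2 → FSeries) :
    sobNormSq s (curlCoeff b) ≤ 2 * ∑ i, sobNormSq (s + 1) (b i) := by
  simp only [sobNormSq, ← ENNReal.tsum_mul_left,
    ← Summable.tsum_finsetSum fun _ _ => ENNReal.summable]
  refine ENNReal.tsum_le_tsum fun k => ?_
  have hk := lapSymbol_nonneg k
  have h1 : (1 + lapSymbol k) ^ s * ‖curlCoeff b k‖ ^ 2 ≤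
      2 * ∑ i, (1 + lapSymbol k) ^ (s + 1) * ‖b i k‖ ^ 2 := by
    rw [Real.rpow_add_one (by positivity), ← Finset.mul_sum]
    have h0 : 0 ≤ ∑ i, ‖b i k‖ ^ 2 := by positivity
    calc _ ≤ (1 + lapSymbol k) ^ s * (2 * (lapSymbol k * ∑ i, ‖b i k‖ ^ 2)) := by
          gcongr; exact norm_curlCoeff_sq_le b k
      _ ≤ (1 + lapSymbol k) ^ s * (2 * ((1 + lapSymbol k) * ∑ i, ‖b i k‖ ^ 2)) := by
          gcongr; linarith
      _ = _ := by ring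
  have := ENNReal.ofReal_le_ofReal h1
  rw [ENNReal.ofReal_mul (by positivity), ENNReal.ofReal_mul (by norm_num),
    ENNReal.ofReal_sum_of_nonneg fun _ _ => by positivity] at this
  simp only [enorm_sq_eq]
  refine this.trans_eq ?_
  rw [ENNReal.ofReal_ofNat]
  exact congrArg _ (Finset.sum_congr rfl fun i _ => ENNReal.ofReal_mul (by positivity))

theorem IsBoundedState.sobNormSq_curl {C : ℝ≥0} {u b : Fin 2 → FSeries} {θ : FSeries}
    (h : IsBoundedState C u b θ) : sobNormSq 1 (curlCoeff b) ≤ 4 * C := by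
  refine (sobNormSq_curlCoeff_le 1 b).trans ?_
  have h1 : ∀ i ∈ Finset.univ, sobNormSq (1 + 1) (b i) ≤ C := fun i _ => by
    norm_num
    exact h.bound_b i
  calc _ ≤ 2 * ∑ i : Fin 2, (C : ℝ≥0∞) := by gcongr; exact h1 _ (Finset.mem_univ _)
    _ = 4 * C := by simp; ring

theorem IsBoundedState.sq_curl {C : ℝ≥0} {u b : Fin 2 → FSeries} {θ : FSeries}
    (h : IsBoundedState C u b θ) : ∑' k, ‖curlCoeff b k‖ₑ ^ 2 ≤ 4 * C :=
  (tsum_sq_le_sobNormSq zero_le_one _).trans h.sobNormSq_curl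

theorem IsBoundedState.norm_forceT_le {C : ℝ≥0} {u b : Fin 2 → FSeries} {θ : FSeries}
    (h : IsBoundedState C u b θ) {ζ : ℝ → ℝ} {M : ℝ} {L : ℝ≥0} (hM : ∀ x, |ζ x| ≤ M)
    (hL : LipschitzWith L ζ) (α μ : ℝ) (k : Fin 2 → ℤ) :
    ‖forceT α μ ζ u b θ k‖ ≤ freq k * (2 * C) + |α * μ| * (M ^ 2 * (4 * C) + 1) := by
  have hM0 : 0 ≤ M := (abs_nonneg _).trans (hM 0)
  have h1 := norm_divP_le h.sq_u h.bound_θ k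
  have hS : ∑' k, ‖heatCoeff ζ (curlCoeff b) k‖ₑ ^ 2 ≤ ENNReal.ofReal (M ^ 2 * (4 * C)) := by
    refine (tsum_sq_heatCoeff_le hM hL (isRealValued_curlCoeff h.real_b)
      (h.sq_curl.trans_lt (by finiteness))).trans ?_
    rw [ENNReal.ofReal_mul (by positivity), ENNReal.ofReal_pow hM0,
      ENNReal.ofReal_mul (by norm_num), ENNReal.ofReal_coe_nnreal, ENNReal.ofReal_ofNat]
    gcongr
    exact h.sq_curl
  have h2 := norm_le_of_tsum_sq_le (by positivity) hS k
  refine (norm_add_le _ _).trans (add_le_add (by rwa [norm_neg]) ?_)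
  rw [norm_mul, ← Complex.ofReal_mul, Complex.norm_real, Real.norm_eq_abs]
  gcongr

/-- Product of a strongly and a weakly convergent sequence. The strong difference is handled by
Cauchy–Schwarz; what remains has the fixed factor a', whose absolute summability permits dominated
convergence. -/
theorem tendsto_conv {a : ℕ → FSeries} {a' : FSeries} {c : ℕ → FSeries} {c' : FSeries} {R : ℝ≥0}
    (ha : Tendsto (fun n => ∑' k, ‖a n k - a' k‖ₑ ^ 2) atTop (𝓝 0)) (ha1 : ∑' k, ‖a' k‖ₑ < ⊤)
    (ha2 : ∀ n, ∑' k, ‖a n k‖ₑ ^ 2 ≤ R) (ha2' : ∑' k, ‖a' k‖ₑ ^ 2 ≤ R)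
    (hc : ∀ k, Tendsto (fun n => c n k) atTop (𝓝 (c' k))) (hR : ∀ n, ∑' k, ‖c n k‖ₑ ^ 2 ≤ R)
    (k : Fin 2 → ℤ) :
    Tendsto (fun n => ∑' l, a n l * c n (k - l)) atTop (𝓝 (∑' l, a' l * c' (k - l))) := by
  have hRt : (R : ℝ≥0∞) < ⊤ := ENNReal.coe_lt_top
  have hd : ∀ n, ∑' l, a n l * c n (k - l) =
      ∑' l, (a n l - a' l) * c n (k - l) + ∑' l, a' l * c n (k - l) := by
    intro n
    have hs1 := summable_conv ((ha2 n).trans_lt hRt) ((hR n).trans_lt hRt) k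
    have hs2 := summable_conv (ha2'.trans_lt hRt) ((hR n).trans_lt hRt) k
    simp only [sub_mul]
    rw [Summable.tsum_sub hs1 hs2, sub_add_cancel]
  simp only [hd]
  rw [← zero_add (∑' l, a' l * c' (k - l))]
  refine Tendsto.add ?_ ?_
  · rw [tendsto_zero_iff_enorm_tendsto_zero]
    have h1 : Tendsto (fun n => ((∑' k, ‖a n k - a' k‖ₑ ^ 2) * R) ^ (1 / 2 : ℝ)) atTop (𝓝 0) := by
      have := (ENNReal.Tendsto.mul_const ha (Or.inr hRt.ne)).ennrpow_const (1 / 2)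
      simpa using this
    refine tendsto_of_tendsto_of_tendsto_of_le_of_le tendsto_const_nhds h1 (fun _ => zero_le)
      fun n => ?_
    have h2 : ‖∑' l, (a n l - a' l) * c n (k - l)‖ₑ ^ 2 ≤ (∑' k, ‖a n k - a' k‖ₑ ^ 2) * R :=
      calc _ ≤ (∑' l, ‖(a n - a') l‖ₑ * ‖c n (k - l)‖ₑ) ^ 2 := by
            gcongr
            exact (enorm_tsum_le _).trans_eq (tsum_congr fun l => enorm_mul _ _)
        _ ≤ _ := (sq_tsum_conv_le (a n - a') (c n) k).trans (by gcongr; exacts [le_rfl, hR n])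
    calc _ = (‖∑' l, (a n l - a' l) * c n (k - l)‖ₑ ^ 2) ^ (1 / 2 : ℝ) := by
          rw [← ENNReal.rpow_natCast, ← ENNReal.rpow_mul]; norm_num
      _ ≤ _ := by gcongr
  · have hsum : Summable fun l => ‖a' l‖ * ((R : ℝ) + 1) := by
      refine Summable.mul_right _ ?_
      have : Summable fun l => (‖a' l‖₊ : ℝ≥0) := ENNReal.tsum_coe_ne_top_iff_summable.1 ha1.ne
      exact NNReal.summable_coe.2 this
    refine tendsto_tsum_of_dominated_convergence hsum (fun l => (hc (k - l)).const_mul _)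
      (Eventually.of_forall fun n l => ?_)
    rw [norm_mul]
    gcongr
    exact norm_le_of_tsum_sq_le R.2 (by simpa using hR n) _

theorem tendsto_divP {C : ℝ≥0} {v : ℕ → Fin 2 → FSeries} {v' : Fin 2 → FSeries}
    {w : ℕ → FSeries} {w' : FSeries} (hv : ∀ i k, Tendsto (fun n => v n i k) atTop (𝓝 (v' i k)))
    (hw : ∀ k, Tendsto (fun n => w n k) atTop (𝓝 (w' k))) (hvC : ∀ n i, sobNormSq 2 (v n i) ≤ C)
    (hwC : ∀ n, ∑' k, ‖w n k‖ₑ ^ 2 ≤ C) (k : Fin 2 → ℤ) :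
    Tendsto (fun n => divP (v n) (w n) k) atTop (𝓝 (divP v' w' k)) := by
  have hC : (C : ℝ≥0∞) < ⊤ := ENNReal.coe_lt_top
  have hv' : ∀ i, sobNormSq 2 (v' i) ≤ C := fun i => sobNormSq_le_of_tendsto (hv i) fun n => hvC n i
  have h2 : ∀ n i, ∑' k, ‖v n i k‖ₑ ^ 2 ≤ C := fun n i =>
    (tsum_sq_le_sobNormSq (by norm_num) _).trans (hvC n i)
  have h2' : ∀ i, ∑' k, ‖v' i k‖ₑ ^ 2 ≤ C := fun i =>
    (tsum_sq_le_sobNormSq (by norm_num) _).trans (hv' i)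
  rw [divP_eq_sum_tsum (fun i => (h2' i).trans_lt hC) ((tsum_sq_le_of_tendsto hw hwC).trans_lt hC)]
  simp only [fun n => divP_eq_sum_tsum (fun i => (h2 n i).trans_lt hC) ((hwC n).trans_lt hC) k]
  refine tendsto_finsetSum _ fun j _ => Tendsto.const_mul _ ?_
  exact tendsto_conv (tendsto_tsum_sq_sub hC.ne (hv j)
    fun n => (sobNormSq_mono (by norm_num) _).trans (hvC n j))
    (tsum_lt_top_of_sobNormSq ((hv' j).trans_lt hC)) (fun n => h2 n j) (h2' j) hw hwC k

/-! ### Continuity of the forcing under coefficientwise convergence -/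

section Convergence

variable {C : ℝ≥0} {u b : ℕ → Fin 2 → FSeries} {θ : ℕ → FSeries}
  {v w : Fin 2 → FSeries} {η : FSeries}

theorem tendsto_leray {a : ℕ → Fin 2 → FSeries} {a' : Fin 2 → FSeries}
    (h : ∀ i k, Tendsto (fun n => a n i k) atTop (𝓝 (a' i k))) (i : Fin 2) (k : Fin 2 → ℤ) :
    Tendsto (fun n => leray (a n) i k) atTop (𝓝 (leray a' i k)) := by
  unfold leray
  split_ifs with hk
  · exact tendsto_const_nhds
  · exact (h i k).sub (((tendsto_finsetSum _ fun j _ => (h j k).const_mul _).const_mul _).div_const _)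

theorem tendsto_forceU (h : ∀ n, IsBoundedState C (u n) (b n) (θ n))
    (hu : ∀ i k, Tendsto (fun n => u n i k) atTop (𝓝 (v i k)))
    (hb : ∀ i k, Tendsto (fun n => b n i k) atTop (𝓝 (w i k)))
    (hθ : ∀ k, Tendsto (fun n => θ n k) atTop (𝓝 (η k))) (g : ℝ) (i : Fin 2) (k : Fin 2 → ℤ) :
    Tendsto (fun n => forceU g (u n) (b n) (θ n) i k) atTop (𝓝 (forceU g v w η i k)) := by
  refine ((tendsto_leray (fun i k => ?_) i k).neg.add (tendsto_leray (fun i k => ?_) i k)).add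
    ((tendsto_leray (fun i k => ?_) i k).const_mul _)
  · exact tendsto_divP hu (hu i) (fun n => (h n).bound_u) (fun n => (h n).sq_u i) k
  · exact tendsto_divP hb (hb i) (fun n => (h n).bound_b) (fun n => (h n).sq_b i) k
  · fin_cases i
    · exact tendsto_const_nhds
    · exact hθ k

theorem tendsto_forceB (h : ∀ n, IsBoundedState C (u n) (b n) (θ n))
    (hu : ∀ i k, Tendsto (fun n => u n i k) atTop (𝓝 (v i k)))
    (hb : ∀ i k, Tendsto (fun n => b n i k) atTop (𝓝 (w i k))) (i : Fin 2) (k : Fin 2 → ℤ) :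
    Tendsto (fun n => forceB (u n) (b n) i k) atTop (𝓝 (forceB v w i k)) :=
  (tendsto_divP hb (hu i) (fun n => (h n).bound_b) (fun n => (h n).sq_u i) k).sub
    (tendsto_divP hu (hb i) (fun n => (h n).bound_u) (fun n => (h n).sq_b i) k)

/-- The H¹ bound upgrades the convergence to L², and the asymmetric difference estimate needs
absolutely summable coefficients of the limit only. Weak convergence alone would not suffice for
this nonlinearity. -/
theorem tendsto_heatCoeff {ζ : ℝ → ℝ} {M : ℝ} {L : ℝ≥0} (hM : ∀ x, |ζ x| ≤ M)
    (hL : LipschitzWith L ζ) {c : ℕ → FSeries} {d : FSeries} (hc : ∀ n, IsRealValued (c n))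
    {R : ℝ≥0} (hcR : ∀ n, sobNormSq 1 (c n) ≤ R)
    (h : ∀ k, Tendsto (fun n => c n k) atTop (𝓝 (d k))) (hd : ∑' k, ‖d k‖ₑ < ⊤) (k : Fin 2 → ℤ) :
    Tendsto (fun n => heatCoeff ζ (c n) k) atTop (𝓝 (heatCoeff ζ d k)) := by
  have hR : (R : ℝ≥0∞) < ⊤ := ENNReal.coe_lt_top
  have hdR : sobNormSq 1 d ≤ R := sobNormSq_le_of_tendsto h hcR
  rw [← tendsto_sub_nhds_zero_iff, tendsto_zero_iff_enorm_tendsto_zero]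
  set A := ENNReal.ofReal (M + L * (∑' k, ‖d k‖ₑ).toReal) ^ 2
  have h1 : Tendsto (fun n => (A * ∑' k, ‖c n k - d k‖ₑ ^ 2) ^ (1 / 2 : ℝ)) atTop (𝓝 0) := by
    have := (ENNReal.Tendsto.const_mul (a := A) (tendsto_tsum_sq_sub hR.ne h hcR)
      (Or.inr (by finiteness))).ennrpow_const (1 / 2)
    simpa using this
  refine tendsto_of_tendsto_of_tendsto_of_le_of_le tendsto_const_nhds h1 (fun _ => zero_le)
    fun n => ?_
  have h2 : ‖heatCoeff ζ (c n) k - heatCoeff ζ d k‖ₑ ^ 2 ≤ A * ∑' k, ‖c n k - d k‖ₑ ^ 2 :=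
    (ENNReal.le_tsum (f := fun k => ‖heatCoeff ζ (c n) k - heatCoeff ζ d k‖ₑ ^ 2) k).trans
      (tsum_sq_heatCoeff_sub_le hM hL (hc n)
        ((tsum_sq_le_sobNormSq zero_le_one _).trans_lt ((hcR n).trans_lt hR))
        (isRealValued_of_tendsto h hc)
        ((tsum_sq_le_sobNormSq zero_le_one _).trans_lt (hdR.trans_lt hR)) hd)
  calc _ = (‖heatCoeff ζ (c n) k - heatCoeff ζ d k‖ₑ ^ 2) ^ (1 / 2 : ℝ) := by
        rw [← ENNReal.rpow_natCast, ← ENNReal.rpow_mul]; norm_num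
    _ ≤ _ := by gcongr

/-- The curl of an H³ field lies in H², hence in the Wiener algebra. -/
theorem tsum_curlCoeff_lt_top {b : Fin 2 → FSeries} (h : ∀ i, sobNormSq 3 (b i) < ⊤) :
    ∑' k, ‖curlCoeff b k‖ₑ < ⊤ := by
  refine tsum_lt_top_of_sobNormSq ((sobNormSq_curlCoeff_le 2 b).trans_lt ?_)
  norm_num
  exact ENNReal.mul_lt_top (by simp) (ENNReal.add_lt_top.2 ⟨h 0, h 1⟩)

theorem tendsto_forceT {ζ : ℝ → ℝ} {M : ℝ} {L : ℝ≥0} (hM : ∀ x, |ζ x| ≤ M)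
    (hL : LipschitzWith L ζ) (h : ∀ n, IsBoundedState C (u n) (b n) (θ n))
    (hu : ∀ i k, Tendsto (fun n => u n i k) atTop (𝓝 (v i k)))
    (hb : ∀ i k, Tendsto (fun n => b n i k) atTop (𝓝 (w i k)))
    (hθ : ∀ k, Tendsto (fun n => θ n k) atTop (𝓝 (η k))) (hw : ∀ i, sobNormSq 3 (w i) < ⊤)
    (α μ : ℝ) (k : Fin 2 → ℤ) :
    Tendsto (fun n => forceT α μ ζ (u n) (b n) (θ n) k) atTop (𝓝 (forceT α μ ζ v w η k)) := by
  refine (tendsto_divP hu hθ (fun n => (h n).bound_u) (fun n => (h n).bound_θ) k).neg.add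
    (Tendsto.const_mul _ ?_)
  refine tendsto_heatCoeff hM hL (R := 4 * C) (fun n => isRealValued_curlCoeff (h n).real_b)
    (fun n => by simpa using (h n).sobNormSq_curl) (fun k => ?_) (tsum_curlCoeff_lt_top hw) k
  exact ((hb 1 k).const_mul _).sub ((hb 0 k).const_mul _)

end Convergence

end CalmedMHD

end

noncomputable section

namespace CalmedMHD

/-! ### The limit of the Galerkin approximations -/

theorem sobNormSq_of_support {B : Finset (Fin 2 → ℤ)} {c : FSeries} (hc : ∀ k ∉ B, c k = 0)
    (s : ℝ) : sobNormSq s c = ENNReal.ofReal (∑ k ∈ B, (1 + lapSymbol k) ^ s * ‖c k‖ ^ 2) := by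
  have hk : ∀ k, 0 ≤ 1 + lapSymbol k := fun k => zero_le_one.trans (one_le_one_add_lapSymbol k)
  rw [sobNormSq, tsum_eq_sum (s := B) fun k h => by simp [hc k h],
    ENNReal.ofReal_sum_of_nonneg fun k _ => by have := hk k; positivity]
  refine Finset.sum_congr rfl fun k _ => ?_
  rw [enorm_sq_eq, ENNReal.ofReal_mul (Real.rpow_nonneg (hk k) _)]

theorem one_add_pow_le {x : ℝ} (hx : 0 ≤ x) :
    (1 + x) ^ 2 ≤ 2 * (1 + x ^ 2) ∧ (1 + x) ^ 3 ≤ 4 * (1 + x ^ 3) := by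
  constructor
  · nlinarith [sq_nonneg (x - 1)]
  · nlinarith [mul_nonneg (add_nonneg zero_le_one hx) (sq_nonneg (x - 1))]

theorem sobNormSq_two_le_wsum {B : Finset (Fin 2 → ℤ)} {c : FSeries} (hc : ∀ k ∉ B, c k = 0) :
    sobNormSq 2 c ≤ ENNReal.ofReal (2 * (wsum B 0 c + wsum B 2 c)) := by
  rw [sobNormSq_of_support hc]
  refine ENNReal.ofReal_le_ofReal ?_
  simp only [wsum, ← Finset.sum_add_distrib, Finset.mul_sum]
  refine Finset.sum_le_sum fun k _ => ?_
  rw [Real.rpow_ofNat]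
  nlinarith [mul_le_mul_of_nonneg_right (one_add_pow_le (lapSymbol_nonneg k)).1 (sq_nonneg ‖c k‖)]

theorem sobNormSq_three_le_wsum {B : Finset (Fin 2 → ℤ)} {c : FSeries} (hc : ∀ k ∉ B, c k = 0) :
    sobNormSq 3 c ≤ ENNReal.ofReal (4 * (wsum B 0 c + wsum B 3 c)) := by
  rw [sobNormSq_of_support hc]
  refine ENNReal.ofReal_le_ofReal ?_
  simp only [wsum, ← Finset.sum_add_distrib, Finset.mul_sum]
  refine Finset.sum_le_sum fun k _ => ?_
  rw [Real.rpow_ofNat]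
  nlinarith [mul_le_mul_of_nonneg_right (one_add_pow_le (lapSymbol_nonneg k)).2 (sq_nonneg ‖c k‖)]

theorem sobNormSq_one_le_wsum {B : Finset (Fin 2 → ℤ)} {c : FSeries} (hc : ∀ k ∉ B, c k = 0) :
    sobNormSq 1 c ≤ ENNReal.ofReal (wsum B 0 c + wsum B 1 c) := by
  rw [sobNormSq_of_support hc]
  refine ENNReal.ofReal_le_ofReal ?_
  simp only [wsum, ← Finset.sum_add_distrib]
  refine Finset.sum_le_sum fun k _ => ?_
  rw [Real.rpow_one]
  exact le_of_eq (by ring)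

theorem wsum_le_toReal {B : Finset (Fin 2 → ℤ)} {c d : FSeries} (hd : sobNormSq 2 d < ⊤)
    (h : ∀ k ∈ B, c k = d k) {s : ℕ} (hs : s ≤ 2) : wsum B s c ≤ (sobNormSq 2 d).toReal := by
  rw [← ENNReal.ofReal_le_iff_le_toReal hd.ne, wsum,
    ENNReal.ofReal_sum_of_nonneg fun k _ => by have := lapSymbol_nonneg k; positivity]
  refine (Finset.sum_le_sum fun k hk => ?_).trans (ENNReal.sum_le_tsum B)
  have h0 := lapSymbol_nonneg k
  rw [enorm_sq_eq, ← ENNReal.ofReal_mul (by positivity), h k hk]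
  refine ENNReal.ofReal_le_ofReal ?_
  gcongr
  rw [Real.rpow_ofNat]
  calc lapSymbol k ^ s ≤ (1 + lapSymbol k) ^ s := by gcongr; linarith
    _ ≤ (1 + lapSymbol k) ^ 2 := pow_le_pow_right₀ (one_le_one_add_lapSymbol k) hs

theorem wsum_le_zsum_u (B : Finset (Fin 2 → ℤ)) (s : ℕ) (u b : Fin 2 → FSeries) (i : Fin 2) :
    wsum B s (u i) ≤ zsum B s u b := by
  have h1 := Finset.single_le_sum (f := fun i => wsum B s (u i)) (fun i _ => wsum_nonneg _ _ _)
    (Finset.mem_univ i)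
  have h2 : 0 ≤ ∑ i, wsum B s (b i) := Finset.sum_nonneg fun i _ => wsum_nonneg _ _ _
  unfold zsum
  linarith

theorem zsum_comm (B : Finset (Fin 2 → ℤ)) (s : ℕ) (u b : Fin 2 → FSeries) :
    zsum B s u b = zsum B s b u := add_comm _ _

theorem wsum_le_zsum_b (B : Finset (Fin 2 → ℤ)) (s : ℕ) (u b : Fin 2 → FSeries) (i : Fin 2) :
    wsum B s (b i) ≤ zsum B s u b := by
  rw [zsum_comm]
  exact wsum_le_zsum_u B s b u i

theorem energy_eq (B : Finset (Fin 2 → ℤ)) (u b : Fin 2 → FSeries) (θ : FSeries) :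
    energy B u b θ = zsum B 0 u b + wsum B 0 θ := rfl

/-- The factor 4 comes from (1 + x)² ≤ 2(1 + x²) applied with two quantities that are each at most
C. -/
theorem IsTrig.isBoundedState {B : Finset (Fin 2 → ℤ)} {u b : Fin 2 → FSeries} {θ : FSeries}
    (h : IsTrig B u b θ) {C : ℝ≥0} (hE : energy B u b θ ≤ C) (hZ : zsum B 2 u b ≤ C) :
    IsBoundedState (4 * C) u b θ := by
  rw [energy_eq] at hE
  have h0 := wsum_nonneg B 0 θ
  have h1 := zsum_nonneg B 0 u b
  have hC : ∀ r : ℝ, r ≤ 4 * C → ENNReal.ofReal r ≤ ((4 * C : ℝ≥0) : ℝ≥0∞) := fun r hr => by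
    rw [← ENNReal.ofReal_coe_nnreal]
    exact ENNReal.ofReal_le_ofReal (by push_cast; exact hr)
  refine ⟨h.real_u, h.real_b, h.real_θ, h.sol_u, h.sol_b, fun i => ?_, fun i => ?_, ?_⟩
  · refine (sobNormSq_two_le_wsum (h.supp_u i)).trans (hC _ ?_)
    linarith [wsum_le_zsum_u B 0 u b i, wsum_le_zsum_u B 2 u b i]
  · refine (sobNormSq_two_le_wsum (h.supp_b i)).trans (hC _ ?_)
    linarith [wsum_le_zsum_b B 0 u b i, wsum_le_zsum_b B 2 u b i]
  · rw [tsum_sq_of_support h.supp_θ, ← wsum_zero]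
    refine hC _ ?_
    linarith [C.2]

/-- Truncation to the frequencies in a box. -/
def truncate (n : ℕ) (c : FSeries) : FSeries := fun k => if k ∈ box n then c k else 0

theorem truncate_of_mem {n : ℕ} {c : FSeries} {k : Fin 2 → ℤ} (h : k ∈ box n) :
    truncate n c k = c k := if_pos h

theorem isRealValued_truncate {c : FSeries} (hc : IsRealValued c) (n : ℕ) :
    IsRealValued (truncate n c) := fun k => by
  have : -k ∈ box n ↔ k ∈ box n := ⟨fun h => by simpa using neg_mem_box h, neg_mem_box⟩
  simp only [truncate, this]
  split_ifs
  · exact hc k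
  · simp

theorem isSolenoidal_truncate {v : Fin 2 → FSeries} (hv : IsSolenoidal v) (n : ℕ) :
    IsSolenoidal fun i => truncate n (v i) := by
  convert hv.const_mul (fun k => if k ∈ box n then 1 else 0) using 3 with i k
  simp [truncate]

theorem isTrig_truncate {u b : Fin 2 → FSeries} {θ : FSeries} (hu : MemVs 2 u) (hb : MemVs 2 b)
    (hθ : MemHs 2 θ) (n : ℕ) : IsTrig (box n) (fun i => truncate n (u i))
      (fun i => truncate n (b i)) (truncate n θ) where
  supp_u _ _ hk := if_neg hk
  supp_b _ _ hk := if_neg hk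
  supp_θ _ hk := if_neg hk
  real_u i := isRealValued_truncate (hu.1 i).1 n
  real_b i := isRealValued_truncate (hb.1 i).1 n
  real_θ := isRealValued_truncate hθ.1 n
  sol_u := isSolenoidal_truncate hu.2 n
  sol_b := isSolenoidal_truncate hb.2 n

/-- The mean value inequality, the right-hand side of the mode equation being bounded. -/
theorem lipschitz_of_mode {T a C F : ℝ} (ha : 0 ≤ a) {c h : ℝ → ℂ}
    (hc : ∀ t ∈ Icc 0 T, HasDerivWithinAt c (-a * c t + h t) (Icc 0 T) t)
    (hC : ∀ t ∈ Icc 0 T, ‖c t‖ ≤ C) (hF : ∀ t ∈ Icc 0 T, ‖h t‖ ≤ F) :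
    ∀ s ∈ Icc 0 T, ∀ t ∈ Icc 0 T, ‖c s - c t‖ ≤ (a * C + F) * |s - t| := by
  intro s hs t ht
  refine (convex_Icc 0 T).norm_image_sub_le_of_norm_hasDerivWithin_le hc (fun r hr => ?_) ht hs
  refine (norm_add_le _ _).trans (add_le_add ?_ (hF r hr))
  rw [norm_mul, norm_neg, Complex.norm_of_nonneg ha]
  exact mul_le_mul_of_nonneg_left (hC r hr) ha

theorem lintegral_sobNormSq_le {T s : ℝ} (hT : 0 ≤ T) {c : ℝ → FSeries} {f : ℝ → ℝ}
    (hf : ContinuousOn f (Icc 0 T)) (hf0 : ∀ t ∈ Icc 0 T, 0 ≤ f t)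
    (h : ∀ t ∈ Icc 0 T, sobNormSq s (c t) ≤ ENNReal.ofReal (f t)) :
    ∫⁻ t in Ioo 0 T, sobNormSq s (c t) ≤ ENNReal.ofReal (∫ t in (0 : ℝ)..T, f t) := by
  have hi : IntegrableOn f (Ioo 0 T) := hf.integrableOn_Icc.mono_set Ioo_subset_Icc_self
  rw [intervalIntegral.integral_of_le hT, integral_Ioc_eq_integral_Ioo,
    ofReal_integral_eq_lintegral_ofReal hi ((ae_restrict_mem measurableSet_Ioo).mono
      fun t ht => hf0 t (Ioo_subset_Icc_self ht))]
  exact setLIntegral_mono' measurableSet_Ioo fun t ht => h t (Ioo_subset_Icc_self ht)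

/-! ### Construction of a solution as a limit of Galerkin approximations -/

section Approximation

variable {ν μ κ g α T : ℝ} {ζ : ℝ → ℝ} {M : ℝ} {L : ℝ≥0}

/-- The Galerkin approximations, uniformly bounded. -/
theorem exists_galerkin_sequence (hM : ∀ x, |ζ x| ≤ M) (hL : LipschitzWith L ζ) (hν : 0 < ν)
    (hμ : 0 < μ) (hκ : 0 < κ) (hg : 0 < g) (hT : 0 < T) (α : ℝ) {u₀ b₀ : Fin 2 → FSeries}
    {θ₀ : FSeries} (hu₀ : MemVs 2 u₀) (hb₀ : MemVs 2 b₀) (hθ₀ : MemHs 2 θ₀) :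
    ∃ (C : ℝ≥0) (R : ℝ≥0) (u b : ℕ → ℝ → Fin 2 → FSeries) (θ : ℕ → ℝ → FSeries), ∀ n,
      IsGalerkin (box n) ν μ κ g α ζ T (u n) (b n) (θ n) ∧
      (u n 0 = fun i => truncate n (u₀ i)) ∧ (b n 0 = fun i => truncate n (b₀ i)) ∧
      θ n 0 = truncate n θ₀ ∧
      (∀ t ∈ Icc 0 T, IsBoundedState C (u n t) (b n t) (θ n t)) ∧
      (∀ i, ∫⁻ t in Ioo 0 T, sobNormSq 3 (u n t i) ≤ R) ∧
      (∀ i, ∫⁻ t in Ioo 0 T, sobNormSq 3 (b n t i) ≤ R) ∧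
      ∫⁻ t in Ioo 0 T, sobNormSq 1 (θ n t) ≤ R := by
  set N : FSeries → ℝ := fun c => (sobNormSq 2 c).toReal
  set I : ℝ := ∑ i, N (u₀ i) + ∑ i, N (b₀ i) + N θ₀
  have hN : ∀ c, 0 ≤ N c := fun c => ENNReal.toReal_nonneg
  obtain ⟨C, hC0, hC⟩ := exists_uniform_bound (κ := κ) (ν := ν) hM hL hν hμ hκ hg hT α I
  choose u b θ hu hb hθ hG using fun n =>
    exists_galerkin hM hL (fun k hk => neg_mem_box hk) hν hμ hκ hg hT.le (α := α)
      (isTrig_truncate hu₀ hb₀ hθ₀ n)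
  have hz : ∀ n s, s ≤ 2 → zsum (box n) s (u n 0) (b n 0) ≤ ∑ i, N (u₀ i) + ∑ i, N (b₀ i) := by
    intro n s hs
    rw [hu, hb]
    exact add_le_add
      (Finset.sum_le_sum fun i _ => wsum_le_toReal (hu₀.1 i).2 (fun k hk => truncate_of_mem hk) hs)
      (Finset.sum_le_sum fun i _ => wsum_le_toReal (hb₀.1 i).2 (fun k hk => truncate_of_mem hk) hs)
  have hI : ∀ n, energy (box n) (u n 0) (b n 0) (θ n 0) ≤ I := fun n => by
    rw [energy_eq]
    refine add_le_add (hz n 0 (by norm_num)) ?_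
    rw [hθ]
    exact wsum_le_toReal hθ₀.2 (fun k hk => truncate_of_mem hk) (by norm_num)
  have hbd := fun n => hC (box n) (u n) (b n) (θ n) (fun k hk => neg_mem_box hk) (hG n) (hI n)
    ((hz n 1 (by norm_num)).trans (le_add_of_nonneg_right (hN _)))
    ((hz n 2 le_rfl).trans (le_add_of_nonneg_right (hN _)))
  have hE0 : ∀ n, ∀ t ∈ Icc 0 T, zsum (box n) 0 (u n t) (b n t) ≤ C ∧ wsum (box n) 0 (θ n t) ≤ C :=
    fun n t ht => by
      have h1 := ((hbd n).1 t ht).1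
      rw [energy_eq] at h1
      have := zsum_nonneg (box n) 0 (u n t) (b n t)
      have := wsum_nonneg (box n) 0 (θ n t)
      constructor <;> linarith
  have hzint : ∀ n, ∫ t in (0 : ℝ)..T, 4 * (C + zsum (box n) 3 (u n t) (b n t)) ≤
      4 * (T * C + C) := fun n => by
    have hi : IntervalIntegrable (fun t => zsum (box n) 3 (u n t) (b n t)) volume 0 T :=
      ((hG n).continuousOn_zsum 3).intervalIntegrable_of_Icc hT.le
    rw [intervalIntegral.integral_const_mul,
      intervalIntegral.integral_add intervalIntegrable_const hi, intervalIntegral.integral_const,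
      sub_zero, smul_eq_mul]
    linarith [(hbd n).2.1]
  have hR : ∀ r : ℝ, r ≤ 4 * (T * C + C) →
      ENNReal.ofReal r ≤ ((4 * (T * C + C)).toNNReal : ℝ≥0∞) := fun r hr =>
    ENNReal.ofReal_le_ofReal hr
  refine ⟨4 * C.toNNReal, (4 * (T * C + C)).toNNReal, u, b, θ, fun n => ⟨hG n, hu n, hb n, hθ n,
    fun t ht => ?_, fun i => ?_, fun i => ?_, ?_⟩⟩
  · exact ((hG n).trig t ht).isBoundedState (((hbd n).1 t ht).1.trans (Real.le_coe_toNNReal C))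
      (((hbd n).1 t ht).2.trans (Real.le_coe_toNNReal C))
  · refine (lintegral_sobNormSq_le hT.le (f := fun t => 4 * (C + zsum (box n) 3 (u n t) (b n t)))
      (continuousOn_const.mul (continuousOn_const.add ((hG n).continuousOn_zsum 3))) (fun t _ => ?_) fun t ht => ?_).trans
      (hR _ (hzint n))
    · have := zsum_nonneg (box n) 3 (u n t) (b n t)
      positivity
    · refine (sobNormSq_three_le_wsum (((hG n).trig t ht).supp_u i)).trans
        (ENNReal.ofReal_le_ofReal ?_)
      linarith [wsum_le_zsum_u (box n) 0 (u n t) (b n t) i,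
        wsum_le_zsum_u (box n) 3 (u n t) (b n t) i, (hE0 n t ht).1]
  · refine (lintegral_sobNormSq_le hT.le (f := fun t => 4 * (C + zsum (box n) 3 (u n t) (b n t)))
      (continuousOn_const.mul (continuousOn_const.add ((hG n).continuousOn_zsum 3))) (fun t _ => ?_) fun t ht => ?_).trans
      (hR _ (hzint n))
    · have := zsum_nonneg (box n) 3 (u n t) (b n t)
      positivity
    · refine (sobNormSq_three_le_wsum (((hG n).trig t ht).supp_b i)).trans
        (ENNReal.ofReal_le_ofReal ?_)
      linarith [wsum_le_zsum_b (box n) 0 (u n t) (b n t) i,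
        wsum_le_zsum_b (box n) 3 (u n t) (b n t) i, (hE0 n t ht).1]
  · have hcw : ContinuousOn (fun t => wsum (box n) 1 (θ n t)) (Icc 0 T) :=
      continuousOn_wsum (hG n).continuousOn_θ 1
    refine (lintegral_sobNormSq_le hT.le (continuousOn_const.add hcw) (f := fun t => C +
      wsum (box n) 1 (θ n t)) (fun t _ => ?_) fun t ht => ?_).trans (hR _ ?_)
    · have := wsum_nonneg (box n) 1 (θ n t)
      positivity
    · refine (sobNormSq_one_le_wsum (((hG n).trig t ht).supp_θ)).trans
        (ENNReal.ofReal_le_ofReal ?_)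
      linarith [(hE0 n t ht).2]
    · rw [intervalIntegral.integral_add intervalIntegrable_const
        (hcw.intervalIntegrable_of_Icc hT.le), intervalIntegral.integral_const,
        sub_zero, smul_eq_mul]
      have := (hbd n).2.2
      nlinarith [mul_nonneg hT.le hC0]

/-- Solutions on the level of Fourier coefficients. -/
structure IsCoeffSolution (ν μ κ g α : ℝ) (ζ : ℝ → ℝ) (T : ℝ) (C : ℝ≥0)
    (u b : ℝ → Fin 2 → FSeries) (θ : ℝ → FSeries) : Prop where
  bounded : ∀ t, IsBoundedState C (u t) (b t) (θ t)
  integral_u : ∀ i, ∫⁻ t in Ioo 0 T, sobNormSq 3 (u t i) < ⊤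
  integral_b : ∀ i, ∫⁻ t in Ioo 0 T, sobNormSq 3 (b t i) < ⊤
  integral_θ : ∫⁻ t in Ioo 0 T, sobNormSq 1 (θ t) < ⊤
  mode_u : ∀ i k, IsModeSolution T ν (lapSymbol k) (fun t => u t i k)
    fun t => forceU g (u t) (b t) (θ t) i k
  mode_b : ∀ i k, IsModeSolution T μ (lapSymbol k) (fun t => b t i k)
    fun t => forceB (u t) (b t) i k
  mode_θ : ∀ k, IsModeSolution T κ (lapSymbol k) (fun t => θ t k)
    fun t => forceT α μ ζ (u t) (b t) (θ t) k

theorem norm_le_of_sobNormSq_le {c : FSeries} {C : ℝ≥0} (h : ∑' k, ‖c k‖ₑ ^ 2 ≤ C)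
    (k : Fin 2 → ℤ) : ‖c k‖ ≤ C + 1 := norm_le_of_tsum_sq_le C.2 (by simpa using h) k

/-- Compactness gives coefficientwise convergence at all times, lower semicontinuity transfers the
bounds, and each mode equation passes to the limit along the approximations whose box contains that
mode. -/
theorem exists_coeff_solution (hM : ∀ x, |ζ x| ≤ M) (hL : LipschitzWith L ζ) (hν : 0 < ν)
    (hμ : 0 < μ) (hκ : 0 < κ) (hg : 0 < g) (hT : 0 < T) (α : ℝ) {u₀ b₀ : Fin 2 → FSeries}
    {θ₀ : FSeries} (hu₀ : MemVs 2 u₀) (hb₀ : MemVs 2 b₀) (hθ₀ : MemHs 2 θ₀) :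
    ∃ (C : ℝ≥0) (u b : ℝ → Fin 2 → FSeries) (θ : ℝ → FSeries), u 0 = u₀ ∧ b 0 = b₀ ∧ θ 0 = θ₀ ∧
      IsCoeffSolution ν μ κ g α ζ T C u b θ := by
  obtain ⟨C, R, U, B, Θ, hn⟩ := exists_galerkin_sequence hM hL hν hμ hκ hg hT α hu₀ hb₀ hθ₀
  have hG := fun n => (hn n).1
  have hS := fun n => (hn n).2.2.2.2.1
  have hlap := lapSymbol_nonneg
  have hUC : ∀ n i k, ∀ t ∈ Icc 0 T, ‖U n t i k‖ ≤ C + 1 := fun n i k t ht =>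
    norm_le_of_sobNormSq_le ((hS n t ht).sq_u i) k
  have hBC : ∀ n i k, ∀ t ∈ Icc 0 T, ‖B n t i k‖ ≤ C + 1 := fun n i k t ht =>
    norm_le_of_sobNormSq_le ((hS n t ht).sq_b i) k
  have hΘC : ∀ n k, ∀ t ∈ Icc 0 T, ‖Θ n t k‖ ≤ C + 1 := fun n k t ht =>
    norm_le_of_sobNormSq_le (hS n t ht).bound_θ k
  have hUF := fun n i k (t : ℝ) ht => (hS n t ht).norm_forceU_le hg i k
  have hBF := fun n i k (t : ℝ) ht => (hS n t ht).norm_forceB_le i k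
  have hΘF := fun n k (t : ℝ) ht => (hS n t ht).norm_forceT_le hM hL α μ k
  set FU : (Fin 2 → ℤ) → ℝ := fun k => 16 * (freq k * C) + 4 * g * (C + 1)
  set FB : (Fin 2 → ℤ) → ℝ := fun k => 4 * (freq k * C)
  set FT : (Fin 2 → ℤ) → ℝ := fun k => freq k * (2 * C) + |α * μ| * (M ^ 2 * (4 * C) + 1)
  have h0T : (0 : ℝ) ∈ Icc 0 T := left_mem_Icc.2 hT.le
  -- Modes outside the box vanish identically, so the Lipschitz bound holds for them as well.
  have lip_aux : ∀ {K : ℝ} {c : ℝ → ℂ}, 0 ≤ K → (∀ t ∈ Icc 0 T, c t = 0) →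
      ∀ s ∈ Icc 0 T, ∀ t ∈ Icc 0 T, ‖c s - c t‖ ≤ K * |s - t| := fun hK hz s hs t ht => by
    rw [hz s hs, hz t ht, sub_zero, norm_zero]
    positivity
  have hUL : ∀ n i k, ∀ s ∈ Icc 0 T, ∀ t ∈ Icc 0 T,
      ‖U n s i k - U n t i k‖ ≤ (ν * lapSymbol k * (C + 1) + FU k) * |s - t| := by
    intro n i k
    by_cases hk : k ∈ box n
    · exact lipschitz_of_mode (mul_nonneg hν.le (hlap k))
        (by simpa using fun t ht0 ht1 => (hG n).deriv_u t ⟨ht0, ht1⟩ i k hk) (hUC n i k)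
        (hUF n i k)
    · exact lip_aux (c := fun t => U n t i k) (add_nonneg (mul_nonneg (mul_nonneg hν.le (hlap k)) (by positivity))
        ((norm_nonneg _).trans (hUF n i k 0 h0T))) fun t ht => ((hG n).trig t ht).supp_u i k hk
  have hBL : ∀ n i k, ∀ s ∈ Icc 0 T, ∀ t ∈ Icc 0 T,
      ‖B n s i k - B n t i k‖ ≤ (μ * lapSymbol k * (C + 1) + FB k) * |s - t| := by
    intro n i k
    by_cases hk : k ∈ box n
    · exact lipschitz_of_mode (mul_nonneg hμ.le (hlap k))
        (by simpa using fun t ht0 ht1 => (hG n).deriv_b t ⟨ht0, ht1⟩ i k hk) (hBC n i k)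
        (hBF n i k)
    · exact lip_aux (c := fun t => B n t i k) (add_nonneg (mul_nonneg (mul_nonneg hμ.le (hlap k)) (by positivity))
        ((norm_nonneg _).trans (hBF n i k 0 h0T))) fun t ht => ((hG n).trig t ht).supp_b i k hk
  have hΘL : ∀ n k, ∀ s ∈ Icc 0 T, ∀ t ∈ Icc 0 T,
      ‖Θ n s k - Θ n t k‖ ≤ (κ * lapSymbol k * (C + 1) + FT k) * |s - t| := by
    intro n k
    by_cases hk : k ∈ box n
    · exact lipschitz_of_mode (mul_nonneg hκ.le (hlap k))
        (by simpa using fun t ht0 ht1 => (hG n).deriv_θ t ⟨ht0, ht1⟩ k hk) (hΘC n k) (hΘF n k)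
    · exact lip_aux (c := fun t => Θ n t k) (add_nonneg (mul_nonneg (mul_nonneg hκ.le (hlap k)) (by positivity))
        ((norm_nonneg _).trans (hΘF n k 0 h0T))) fun t ht => ((hG n).trig t ht).supp_θ k hk
  -- The coefficients of all three unknowns are placed in one countable index set, so that a single
  -- extraction serves them all.
  obtain ⟨φ, hφ, y, hy⟩ := exists_subseq_tendsto hT.le
    (ι := (Fin 2 × (Fin 2 → ℤ)) ⊕ (Fin 2 × (Fin 2 → ℤ)) ⊕ (Fin 2 → ℤ))
    (x := fun n => Sum.elim (fun p t => U n t p.1 p.2)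
      (Sum.elim (fun p t => B n t p.1 p.2) fun k t => Θ n t k))
    (C := fun _ => C + 1)
    (K := Sum.elim (fun p => ν * lapSymbol p.2 * (C + 1) + FU p.2)
      (Sum.elim (fun p => μ * lapSymbol p.2 * (C + 1) + FB p.2)
        fun k => κ * lapSymbol k * (C + 1) + FT k))
    (by
      rintro n (⟨i, k⟩ | ⟨i, k⟩ | k)
      exacts [hUC n i k, hBC n i k, hΘC n k])
    (by
      rintro n (⟨i, k⟩ | ⟨i, k⟩ | k)
      exacts [hUL n i k, hBL n i k, hΘL n k])
  -- Time is clamped to [0, T], so that the limit is a bounded state at every real time.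
  set u : ℝ → Fin 2 → FSeries := fun t i k => y (Sum.inl (i, k)) (projIcc 0 T hT.le t) with hu
  set b : ℝ → Fin 2 → FSeries := fun t i k => y (Sum.inr (Sum.inl (i, k))) (projIcc 0 T hT.le t) with hb
  set θ : ℝ → FSeries := fun t k => y (Sum.inr (Sum.inr k)) (projIcc 0 T hT.le t) with hθ
  have hUt : ∀ t ∈ Icc 0 T, ∀ i k, Tendsto (fun n => U (φ n) t i k) atTop (𝓝 (u t i k)) :=
    fun t ht i k => by
      simp only [u, projIcc_of_mem hT.le ht]
      exact hy (Sum.inl (i, k)) t ht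
  have hBt : ∀ t ∈ Icc 0 T, ∀ i k, Tendsto (fun n => B (φ n) t i k) atTop (𝓝 (b t i k)) :=
    fun t ht i k => by
      simp only [b, projIcc_of_mem hT.le ht]
      exact hy (Sum.inr (Sum.inl (i, k))) t ht
  have hΘt : ∀ t ∈ Icc 0 T, ∀ k, Tendsto (fun n => Θ (φ n) t k) atTop (𝓝 (θ t k)) :=
    fun t ht k => by
      simp only [θ, projIcc_of_mem hT.le ht]
      exact hy (Sum.inr (Sum.inr k)) t ht
  have hmem : ∀ᵐ t ∂volume.restrict (Ioo 0 T), t ∈ Icc 0 T :=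
    (ae_restrict_mem measurableSet_Ioo).mono fun t ht => Ioo_subset_Icc_self ht
  have hbs : ∀ t, IsBoundedState C (u t) (b t) (θ t) := fun t =>
    IsBoundedState.of_tendsto (fun n => hS (φ n) _ (projIcc 0 T hT.le t).2)
      (fun i k => hy (Sum.inl (i, k)) _ (projIcc 0 T hT.le t).2)
      (fun i k => hy (Sum.inr (Sum.inl (i, k))) _ (projIcc 0 T hT.le t).2)
      (fun k => hy (Sum.inr (Sum.inr k)) _ (projIcc 0 T hT.le t).2)
  have hmeas : ∀ {c : ℝ → ℂ}, ContinuousOn c (Icc 0 T) →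
      AEStronglyMeasurable c (volume.restrict (Ioo 0 T)) := fun hc =>
    (hc.mono Ioo_subset_Icc_self).aestronglyMeasurable measurableSet_Ioo
  have hRt : (R : ℝ≥0∞) < ⊤ := ENNReal.coe_lt_top
  have hIu : ∀ i, ∫⁻ t in Ioo 0 T, sobNormSq 3 (u t i) < ⊤ := fun i =>
    (lintegral_sobNormSq_le_of_tendsto (c := fun n t => U (φ n) t i)
      (fun n k => hmeas ((hG (φ n)).continuousOn_u i k)) (hmem.mono fun t ht => hUt t ht i)
      fun n => (hn (φ n)).2.2.2.2.2.1 i).trans_lt hRt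
  have hIb : ∀ i, ∫⁻ t in Ioo 0 T, sobNormSq 3 (b t i) < ⊤ := fun i =>
    (lintegral_sobNormSq_le_of_tendsto (c := fun n t => B (φ n) t i)
      (fun n k => hmeas ((hG (φ n)).continuousOn_b i k)) (hmem.mono fun t ht => hBt t ht i)
      fun n => (hn (φ n)).2.2.2.2.2.2.1 i).trans_lt hRt
  have hIθ : ∫⁻ t in Ioo 0 T, sobNormSq 1 (θ t) < ⊤ :=
    (lintegral_sobNormSq_le_of_tendsto (c := fun n t => Θ (φ n) t)
      (fun n k => hmeas ((hG (φ n)).continuousOn_θ k)) (hmem.mono fun t ht => hΘt t ht)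
      fun n => (hn (φ n)).2.2.2.2.2.2.2).trans_lt hRt
  -- Continuity of b is needed at once, for measurability: finiteness of its H³ norm at almost every
  -- time enters the limit of the heating.
  have hbcont : ∀ i k, ContinuousOn (fun t => b t i k) (Icc 0 T) := fun i k => by
    refine (LipschitzOnWith.of_dist_le_mul
      (K := (μ * lapSymbol k * (C + 1) + FB k).toNNReal) fun s hs t ht => ?_).continuousOn
    rw [dist_eq_norm, Real.dist_eq]
    refine (le_of_tendsto ((hBt s hs i k).sub (hBt t ht i k)).norm
      (Eventually.of_forall fun n => hBL (φ n) i k s hs t ht)).trans ?_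
    gcongr
    exact Real.le_coe_toNNReal _
  have hb3 : ∀ᵐ t ∂volume.restrict (Ioo 0 T), ∀ i, sobNormSq 3 (b t i) < ⊤ :=
    ae_all_iff.2 fun i => ae_lt_top' (aemeasurable_sobNormSq fun k => hmeas (hbcont i k)) (hIb i).ne
  -- For fixed k the truncated data eventually agree with the data.
  have init : ∀ {c : ℕ → FSeries} {c₀ d : FSeries}, (∀ n, c n = truncate n c₀) →
      (∀ k, Tendsto (fun n => c (φ n) k) atTop (𝓝 (d k))) → d = c₀ := fun hc ht => by
    funext k
    obtain ⟨N, hN⟩ := exists_mem_box k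
    refine tendsto_nhds_unique (ht k) (tendsto_const_nhds.congr' ?_)
    filter_upwards [eventually_ge_atTop N] with n hn'
    rw [hc, truncate_of_mem (hN _ (hn'.trans (hφ.id_le n)))]
  -- A mode satisfies its equation only once the box contains it, so finitely many approximations
  -- are dropped.
  have shift : ∀ {N : ℕ} {f : ℕ → ℂ} {a : ℂ}, Tendsto (fun n => f (φ n)) atTop (𝓝 a) →
      Tendsto (fun n => f (φ (n + N))) atTop (𝓝 a) := fun {N f a} h =>
    h.comp (tendsto_add_atTop_nat N)
  refine ⟨C, u, b, θ, ?_, ?_, ?_, hbs, hIu, hIb, hIθ, fun i k => ?_, fun i k => ?_, fun k => ?_⟩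
  · exact funext fun i => init (fun n => congrFun (hn n).2.1 i) (hUt 0 h0T i)
  · exact funext fun i => init (fun n => congrFun (hn n).2.2.1 i) (hBt 0 h0T i)
  · exact init (fun n => (hn n).2.2.2.1) (hΘt 0 h0T)
  · obtain ⟨N, hN⟩ := exists_mem_box k
    have hk : ∀ n, k ∈ box (φ (n + N)) := fun n =>
      hN _ ((Nat.le_add_left N n).trans (hφ.id_le (n + N)))
    refine IsModeSolution.of_tendsto hT hν (hlap k) (c := fun n t => U (φ (n + N)) t i k)
      (fun n => isModeSolution_of_hasDerivWithinAt hT hν (hlap k)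
        (fun t ht => (hG (φ (n + N))).deriv_u t ht i k (hk n)) ((hG _).cont_u i k (hk n)))
      (fun n => hUC _ i k) (fun n => hUF _ i k) (fun n => hUL _ i k)
      (fun t ht => shift (f := fun n => U n t i k) (hUt t ht i k)) ?_
    filter_upwards [hmem] with t ht
    exact shift (f := fun n => forceU g (U n t) (B n t) (Θ n t) i k)
      (tendsto_forceU (fun n => hS (φ n) t ht) (hUt t ht) (hBt t ht) (hΘt t ht) g i k)
  · obtain ⟨N, hN⟩ := exists_mem_box k
    have hk : ∀ n, k ∈ box (φ (n + N)) := fun n =>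
      hN _ ((Nat.le_add_left N n).trans (hφ.id_le (n + N)))
    refine IsModeSolution.of_tendsto hT hμ (hlap k) (c := fun n t => B (φ (n + N)) t i k)
      (fun n => isModeSolution_of_hasDerivWithinAt hT hμ (hlap k)
        (fun t ht => (hG (φ (n + N))).deriv_b t ht i k (hk n)) ((hG _).cont_b i k (hk n)))
      (fun n => hBC _ i k) (fun n => hBF _ i k) (fun n => hBL _ i k)
      (fun t ht => shift (f := fun n => B n t i k) (hBt t ht i k)) ?_
    filter_upwards [hmem] with t ht
    exact shift (f := fun n => forceB (U n t) (B n t) i k)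
      (tendsto_forceB (fun n => hS (φ n) t ht) (hUt t ht) (hBt t ht) i k)
  · obtain ⟨N, hN⟩ := exists_mem_box k
    have hk : ∀ n, k ∈ box (φ (n + N)) := fun n =>
      hN _ ((Nat.le_add_left N n).trans (hφ.id_le (n + N)))
    refine IsModeSolution.of_tendsto hT hκ (hlap k) (c := fun n t => Θ (φ (n + N)) t k)
      (fun n => isModeSolution_of_hasDerivWithinAt hT hκ (hlap k)
        (fun t ht => (hG (φ (n + N))).deriv_θ t ht k (hk n)) ((hG _).cont_θ k (hk n)))
      (fun n => hΘC _ k) (fun n => hΘF _ k) (fun n => hΘL _ k)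
      (fun t ht => shift (f := fun n => Θ n t k) (hΘt t ht k)) ?_
    filter_upwards [hmem, hb3] with t ht h3
    exact shift (f := fun n => forceT α μ ζ (U n t) (B n t) (Θ n t) k)
      (tendsto_forceT hM hL (fun n => hS (φ n) t ht) (hUt t ht) (hBt t ht) (hΘt t ht) h3 α μ k)

end Approximation

end CalmedMHD

end

noncomputable section

namespace CalmedMHD

/-! ### Parabolic regularity for families of modes -/

section Regularity

variable {T κ s : ℝ} {c h : ℝ → FSeries}

/-- The factor (κ(1 + l))⁻¹ in front of the forcing lowers its Sobolev order by one: the sum of the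
mode inequalities is the parabolic energy estimate in H^s. -/
theorem tsum_modeData (hκ : 0 < κ)
    (hm : ∀ k, IsModeSolution T κ (lapSymbol k) (fun t => c t k) fun t => h t k) (s : ℝ) :
    ∑' k, ENNReal.ofReal ((1 + lapSymbol k) ^ s) *
        modeData T κ (lapSymbol k) (fun t => c t k) (fun t => h t k) =
      sobNormSq s (c 0) + ENNReal.ofReal κ⁻¹ *
        ∫⁻ t in Ioo 0 T, sobNormSq (s - 1) (fun k => h t k + κ * c t k) := by
  have hcm : ∀ k, AEStronglyMeasurable (fun t => c t k) (volume.restrict (Ioo 0 T)) := fun k =>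
    ((hm k).cont.mono Ioo_subset_Icc_self).aestronglyMeasurable measurableSet_Ioo
  have hwm : ∀ k, AEMeasurable (fun t => ‖h t k + κ * c t k‖ₑ ^ 2) (volume.restrict (Ioo 0 T)) :=
    fun k => ((hm k).meas.add ((hcm k).const_mul _)).enorm.pow_const 2
  simp only [modeData, mul_add, sobNormSq]
  rw [ENNReal.tsum_add, lintegral_tsum fun k => (hwm k).const_mul _, ← ENNReal.tsum_mul_left]
  congr 1
  refine tsum_congr fun k => ?_
  have hk : 0 < 1 + lapSymbol k := zero_lt_one.trans_le (one_le_one_add_lapSymbol k)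
  rw [lintegral_const_mul'' _ (hwm k), ← mul_assoc, ← mul_assoc,
    ← ENNReal.ofReal_mul (by positivity), ← ENNReal.ofReal_mul (by positivity)]
  congr 2
  rw [Real.rpow_sub_one hk.ne']
  field_simp

theorem sobNormSq_le_of_mode (hκ : 0 < κ)
    (hm : ∀ k, IsModeSolution T κ (lapSymbol k) (fun t => c t k) fun t => h t k) (s : ℝ) {t : ℝ}
    (ht : t ∈ Icc 0 T) :
    sobNormSq s (c t) ≤ sobNormSq s (c 0) + ENNReal.ofReal κ⁻¹ *
        ∫⁻ t in Ioo 0 T, sobNormSq (s - 1) (fun k => h t k + κ * c t k) := by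
  rw [← tsum_modeData hκ hm]
  exact ENNReal.tsum_le_tsum fun k => by
    gcongr
    exact (hm k).bound t ht

theorem lintegral_sobNormSq_le_of_mode (hκ : 0 < κ)
    (hm : ∀ k, IsModeSolution T κ (lapSymbol k) (fun t => c t k) fun t => h t k) (s : ℝ) :
    ENNReal.ofReal κ * ∫⁻ t in Ioo 0 T, sobNormSq (s + 1) (c t) ≤
      sobNormSq s (c 0) + ENNReal.ofReal κ⁻¹ *
        ∫⁻ t in Ioo 0 T, sobNormSq (s - 1) (fun k => h t k + κ * c t k) := by
  have hcm : ∀ k, AEMeasurable (fun t => ‖c t k‖ₑ ^ 2) (volume.restrict (Ioo 0 T)) := fun k =>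
    (((hm k).cont.mono Ioo_subset_Icc_self).aestronglyMeasurable measurableSet_Ioo).enorm.pow_const 2
  rw [← tsum_modeData hκ hm]
  simp only [sobNormSq]
  rw [lintegral_tsum fun k => (hcm k).const_mul _, ← ENNReal.tsum_mul_left]
  refine ENNReal.tsum_le_tsum fun k => ?_
  have hk : 0 < 1 + lapSymbol k := zero_lt_one.trans_le (one_le_one_add_lapSymbol k)
  rw [lintegral_const_mul'' _ (hcm k)]
  calc _ = ENNReal.ofReal ((1 + lapSymbol k) ^ s) *
        (ENNReal.ofReal (κ * (1 + lapSymbol k)) * ∫⁻ t in Ioo 0 T, ‖c t k‖ₑ ^ 2) := by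
        rw [← mul_assoc, ← mul_assoc, ← ENNReal.ofReal_mul hκ.le,
          ← ENNReal.ofReal_mul (by positivity), Real.rpow_add_one hk.ne']
        ring_nf
    _ ≤ _ := by
        gcongr
        exact (hm k).bound_integral

/-- Each mode is continuous, and its squared increment is at most four times its data uniformly in
time. The weighted data are summable, so dominated convergence over the frequencies gives strong
continuity. -/
theorem tendsto_sobNormSq_of_mode (hκ : 0 < κ)
    (hm : ∀ k, IsModeSolution T κ (lapSymbol k) (fun t => c t k) fun t => h t k)
    (h0 : sobNormSq s (c 0) < ⊤)
    (hh : ∫⁻ t in Ioo 0 T, sobNormSq (s - 1) (fun k => h t k + κ * c t k) < ⊤) {t₀ : ℝ}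
    (ht₀ : t₀ ∈ Icc 0 T) :
    Tendsto (fun t => sobNormSq s (c t - c t₀)) (𝓝[Icc 0 T] t₀) (𝓝 0) := by
  set A : (Fin 2 → ℤ) → ℝ≥0∞ := fun k => ENNReal.ofReal ((1 + lapSymbol k) ^ s) *
    modeData T κ (lapSymbol k) (fun t => c t k) (fun t => h t k)
  have hA : ∑' k, A k ≠ ⊤ := by
    rw [tsum_modeData hκ hm]
    finiteness
  have key : Tendsto (fun t => ∫⁻ k, ENNReal.ofReal ((1 + lapSymbol k) ^ s) *
      ‖(c t - c t₀) k‖ₑ ^ 2 ∂Measure.count) (𝓝[Icc 0 T] t₀)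
      (𝓝 (∫⁻ _ : Fin 2 → ℤ, 0 ∂Measure.count)) := by
    refine tendsto_lintegral_filter_of_dominated_convergence (fun k => 4 * A k)
      (Eventually.of_forall fun t => measurable_of_countable _) ?_ ?_ (ae_of_all _ fun k => ?_)
    · filter_upwards [self_mem_nhdsWithin] with t ht
      refine ae_of_all _ fun k => ?_
      rw [Pi.sub_apply, sub_eq_add_neg]
      calc _ ≤ ENNReal.ofReal ((1 + lapSymbol k) ^ s) * (2 * (‖c t k‖ₑ ^ 2 + ‖-c t₀ k‖ₑ ^ 2)) := by
            gcongr; exact enorm_add_sq_le _ _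
        _ ≤ ENNReal.ofReal ((1 + lapSymbol k) ^ s) *
            (2 * (modeData T κ (lapSymbol k) (fun t => c t k) (fun t => h t k) +
              modeData T κ (lapSymbol k) (fun t => c t k) (fun t => h t k))) := by
            rw [enorm_neg]
            gcongr
            exacts [(hm k).bound t ht, (hm k).bound t₀ ht₀]
        _ = 4 * A k := by ring
    · rw [lintegral_count, ENNReal.tsum_mul_left]
      finiteness
    · have h1 : Tendsto (fun t => c t k - c t₀ k) (𝓝[Icc 0 T] t₀) (𝓝 (c t₀ k - c t₀ k)) :=
        ((hm k).cont t₀ ht₀).sub_const _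
      have := ENNReal.Tendsto.const_mul (a := ENNReal.ofReal ((1 + lapSymbol k) ^ s))
        (ENNReal.Tendsto.pow (n := 2) h1.enorm) (Or.inr ENNReal.ofReal_ne_top)
      simpa using this
  simp only [lintegral_count, lintegral_zero] at key
  exact key

end Regularity

/-! ### Product estimates -/

theorem ennreal_add_sq_le (a b : ℝ≥0∞) : (a + b) ^ 2 ≤ 2 * (a ^ 2 + b ^ 2) := by
  have := ENNReal.rpow_add_le_mul_rpow_add_rpow a b (p := 2) (by norm_num)
  norm_num at this
  exact this

theorem sq_tsum_sum_le (v : Fin 2 → FSeries) :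
    (∑' l, ∑ j, ‖v j l‖ₑ) ^ 2 ≤ 128 * ∑ j, sobNormSq 2 (v j) := by
  rw [Summable.tsum_finsetSum fun _ _ => ENNReal.summable, Fin.sum_univ_two, Fin.sum_univ_two]
  calc _ ≤ 2 * ((∑' l, ‖v 0 l‖ₑ) ^ 2 + (∑' l, ‖v 1 l‖ₑ) ^ 2) := ennreal_add_sq_le _ _
    _ ≤ 2 * (64 * sobNormSq 2 (v 0) + 64 * sobNormSq 2 (v 1)) := by
        gcongr <;> exact sq_tsum_le_sobNormSq _
    _ = _ := by ring

theorem tsum_sq_freq_le (w : FSeries) :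
    ∑' k, (ENNReal.ofReal (freq k) * ‖w k‖ₑ) ^ 2 ≤ sobNormSq 1 w := by
  refine ENNReal.tsum_le_tsum fun k => ?_
  rw [mul_pow, ← ENNReal.ofReal_pow (freq_nonneg k), freq_sq, Real.rpow_one]
  gcongr
  linarith

theorem tsum_sq_freq_sq_le (w : FSeries) :
    ∑' k, (ENNReal.ofReal (freq k) * (ENNReal.ofReal (freq k) * ‖w k‖ₑ)) ^ 2 ≤ sobNormSq 2 w := by
  refine ENNReal.tsum_le_tsum fun k => ?_
  have hk := lapSymbol_nonneg k
  rw [← mul_assoc, ← sq, mul_pow, ← ENNReal.ofReal_pow (freq_nonneg k), freq_sq, Real.rpow_ofNat,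
    ← ENNReal.ofReal_pow hk]
  gcongr
  linarith

/-- With the derivative on w, Young's inequality puts v in ℓ¹, controlled by H², and ∇w in ℓ². -/
theorem tsum_sq_divP_le {v : Fin 2 → FSeries} (hv : IsSolenoidal v) (w : FSeries) :
    ∑' k, ‖divP v w k‖ₑ ^ 2 ≤ 128 * (∑ j, sobNormSq 2 (v j)) * sobNormSq 1 w := by
  calc _ ≤ ∑' k, (∑' l, (∑ j, ‖v j l‖ₑ) * (ENNReal.ofReal (freq (k - l)) * ‖w (k - l)‖ₑ)) ^ 2 :=
        ENNReal.tsum_le_tsum fun k => by gcongr; exact enorm_divP_le hv w k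
    _ ≤ _ := tsum_sq_conv_le _ fun m => ENNReal.ofReal (freq m) * ‖w m‖ₑ
    _ ≤ _ := mul_le_mul' (sq_tsum_sum_le v) (tsum_sq_freq_le w)

theorem sobNormSq_two_weight_le (c : FSeries) :
    sobNormSq 2 (fun k => ((1 + freq k : ℝ) : ℂ) * c k) ≤ 2 * sobNormSq 3 c := by
  simp only [sobNormSq, ← ENNReal.tsum_mul_left]
  refine ENNReal.tsum_le_tsum fun k => ?_
  have hk := lapSymbol_nonneg k
  have hf := freq_nonneg k
  have hs := freq_sq k
  rw [enorm_sq_eq, enorm_sq_eq, ← ENNReal.ofReal_mul (by positivity),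
    ← ENNReal.ofReal_mul (by positivity), ← ENNReal.ofReal_ofNat, ← ENNReal.ofReal_mul (by norm_num),
    norm_mul, Complex.norm_of_nonneg (by positivity), mul_pow, ← mul_assoc, ← mul_assoc]
  refine ENNReal.ofReal_le_ofReal (mul_le_mul_of_nonneg_right ?_ (sq_nonneg _))
  rw [Real.rpow_ofNat, Real.rpow_ofNat]
  have : (1 + freq k) ^ 2 ≤ 2 * (1 + lapSymbol k) := by nlinarith [sq_nonneg (freq k - 1)]
  calc _ ≤ (1 + lapSymbol k) ^ 2 * (2 * (1 + lapSymbol k)) := by gcongr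
    _ = _ := by ring

/-- The weight splits as 1 + |k| ≤ (1 + |l|) + |k - l|. Each summand then has one factor of high
order and one of lower order, so the estimate is linear in the high norms. -/
theorem sobNormSq_one_divP_le {v : Fin 2 → FSeries} (hv : IsSolenoidal v) (w : FSeries) :
    sobNormSq 1 (divP v w) ≤ 512 * ((∑ j, sobNormSq 3 (v j)) * sobNormSq 1 w +
      (∑ j, sobNormSq 2 (v j)) * sobNormSq 2 w) := by
  set V' : Fin 2 → FSeries := fun j k => ((1 + freq k : ℝ) : ℂ) * v j k
  set F : (Fin 2 → ℤ) → ℝ≥0∞ := fun m => ENNReal.ofReal (freq m) * ‖w m‖ₑ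
  set G : (Fin 2 → ℤ) → ℝ≥0∞ := fun m => ENNReal.ofReal (freq m) * F m
  have h1 : ∀ k, ENNReal.ofReal (1 + freq k) * ‖divP v w k‖ₑ ≤
      ∑' l, (∑ j, ‖V' j l‖ₑ) * F (k - l) + ∑' l, (∑ j, ‖v j l‖ₑ) * G (k - l) := by
    intro k
    rw [← ENNReal.tsum_add]
    refine (mul_le_mul_right (enorm_divP_le hv w k) _).trans ?_
    rw [← ENNReal.tsum_mul_left]
    refine ENNReal.tsum_le_tsum fun l => ?_
    have h2 : ∀ j, ‖V' j l‖ₑ = ENNReal.ofReal (1 + freq l) * ‖v j l‖ₑ := fun j => by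
      have := freq_nonneg l
      rw [enorm_mul, ← ofReal_norm, Complex.norm_of_nonneg (by positivity)]
    simp only [h2, ← Finset.mul_sum]
    have h3 : ENNReal.ofReal (1 + freq k) ≤
        ENNReal.ofReal (1 + freq l) + ENNReal.ofReal (freq (k - l)) := by
      rw [← ENNReal.ofReal_add (by linarith [freq_nonneg l]) (freq_nonneg _)]
      exact ENNReal.ofReal_le_ofReal (by linarith [freq_le_add_sub k l])
    calc _ ≤ (ENNReal.ofReal (1 + freq l) + ENNReal.ofReal (freq (k - l))) *
          ((∑ j, ‖v j l‖ₑ) * F (k - l)) := by gcongr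
      _ = _ := by simp only [G]; ring
  calc sobNormSq 1 (divP v w) ≤ ∑' k, (ENNReal.ofReal (1 + freq k) * ‖divP v w k‖ₑ) ^ 2 := by
        refine ENNReal.tsum_le_tsum fun k => ?_
        have := freq_nonneg k
        rw [mul_pow, ← ENNReal.ofReal_pow (by positivity), Real.rpow_one]
        gcongr
        nlinarith [freq_sq k]
    _ ≤ ∑' k, 2 * ((∑' l, (∑ j, ‖V' j l‖ₑ) * F (k - l)) ^ 2 +
          (∑' l, (∑ j, ‖v j l‖ₑ) * G (k - l)) ^ 2) :=
        ENNReal.tsum_le_tsum fun k => (by gcongr; exact h1 k : _ ≤ _).trans (ennreal_add_sq_le _ _)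
    _ ≤ 2 * ((128 * ∑ j, sobNormSq 2 (V' j)) * sobNormSq 1 w +
          (128 * ∑ j, sobNormSq 2 (v j)) * sobNormSq 2 w) := by
        rw [ENNReal.tsum_mul_left, ENNReal.tsum_add]
        gcongr
        · exact (tsum_sq_conv_le _ F).trans (mul_le_mul' (sq_tsum_sum_le V') (tsum_sq_freq_le w))
        · exact (tsum_sq_conv_le _ G).trans (mul_le_mul' (sq_tsum_sum_le v) (tsum_sq_freq_sq_le w))
    _ ≤ 2 * ((128 * (2 * ∑ j, sobNormSq 3 (v j))) * sobNormSq 1 w +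
          (256 * ∑ j, sobNormSq 2 (v j)) * sobNormSq 2 w) := by
        gcongr
        · rw [Finset.mul_sum]
          exact Finset.sum_le_sum fun j _ => sobNormSq_two_weight_le (v j)
        · norm_num
    _ = _ := by ring

theorem sobNormSq_leray_le (s : ℝ) (v : Fin 2 → FSeries) (i : Fin 2) :
    sobNormSq s (leray v i) ≤ 8 * ∑ j, sobNormSq s (v j) := by
  simp only [sobNormSq, Fin.sum_univ_two, ← ENNReal.tsum_add, ← ENNReal.tsum_mul_left]
  refine ENNReal.tsum_le_tsum fun k => ?_
  have h : ‖leray v i k‖ₑ ^ 2 ≤ 8 * (‖v 0 k‖ₑ ^ 2 + ‖v 1 k‖ₑ ^ 2) := by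
    have h1 : ‖leray v i k‖ ^ 2 ≤ 8 * (‖v 0 k‖ ^ 2 + ‖v 1 k‖ ^ 2) := by
      have := norm_leray_le v i k
      rw [Fin.sum_univ_two] at this
      nlinarith [norm_nonneg (leray v i k), norm_nonneg (v 0 k), norm_nonneg (v 1 k),
        sq_nonneg (‖v 0 k‖ - ‖v 1 k‖)]
    simp only [enorm_sq_eq]
    rw [← ENNReal.ofReal_add (by positivity) (by positivity), ← ENNReal.ofReal_ofNat,
      ← ENNReal.ofReal_mul (by norm_num)]
    exact ENNReal.ofReal_le_ofReal h1
  calc _ ≤ ENNReal.ofReal ((1 + lapSymbol k) ^ s) * (8 * (‖v 0 k‖ₑ ^ 2 + ‖v 1 k‖ₑ ^ 2)) := by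
        gcongr
    _ = _ := by ring

/-- The Lipschitz constant of the profile on the range of the curl is controlled by the H³ norm of
b. Its square appears linearly, beside an H¹ norm of the curl that is bounded in time, so the result
is integrable in time. -/
theorem sobNormSq_one_heatCoeff_curl_le {ζ : ℝ → ℝ} {M : ℝ} {L : ℝ≥0} (hM : ∀ x, |ζ x| ≤ M)
    (hL : LipschitzWith L ζ) {b : Fin 2 → FSeries} (hb : ∀ i, IsRealValued (b i))
    (h3 : ∀ i, sobNormSq 3 (b i) < ⊤) :
    sobNormSq 1 (heatCoeff ζ (curlCoeff b)) ≤
      2 * (ENNReal.ofReal M ^ 2 + L ^ 2 * (128 * ∑ i, sobNormSq 3 (b i))) *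
        sobNormSq 1 (curlCoeff b) := by
  have hM0 : 0 ≤ M := (abs_nonneg _).trans (hM 0)
  have h1 := tsum_curlCoeff_lt_top h3
  have h2 : sobNormSq 2 (curlCoeff b) ≤ 2 * ∑ i, sobNormSq 3 (b i) := by
    have := sobNormSq_curlCoeff_le 2 b
    norm_num at this ⊢
    exact this
  have hs : ∑' k, ‖curlCoeff b k‖ₑ ^ 2 < ⊤ := by
    refine (tsum_sq_le_sobNormSq (s := 2) (by norm_num) _).trans_lt (h2.trans_lt ?_)
    exact ENNReal.mul_lt_top (by simp) (ENNReal.sum_lt_top.2 fun i _ => h3 i)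
  refine (sobNormSq_one_heatCoeff_le hM hL (isRealValued_curlCoeff hb) hs h1).trans ?_
  gcongr
  rw [ENNReal.ofReal_add hM0 (by positivity), ENNReal.ofReal_mul L.coe_nonneg, ENNReal.ofReal_coe_nnreal,
    ENNReal.ofReal_toReal h1.ne]
  refine (ennreal_add_sq_le _ _).trans ?_
  rw [mul_pow]
  gcongr
  calc _ ≤ 64 * sobNormSq 2 (curlCoeff b) := sq_tsum_le_sobNormSq _
    _ ≤ 64 * (2 * ∑ i, sobNormSq 3 (b i)) := by gcongr
    _ = _ := by ring

end CalmedMHD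

end

noncomputable section

namespace CalmedMHD

/-! ### Regularity of the limit -/

/-- Almost everywhere domination by a multiple of `g`. -/
def Dominated (m : Measure ℝ) (g f : ℝ → ℝ≥0∞) : Prop := ∃ K : ℝ≥0, ∀ᵐ t ∂m, f t ≤ K * g t

namespace Dominated

variable {m : Measure ℝ} {g f f' : ℝ → ℝ≥0∞}

theorem of_le (h : ∀ᵐ t ∂m, f t ≤ f' t) (hf : Dominated m g f') : Dominated m g f :=
  let ⟨K, hK⟩ := hf
  ⟨K, by filter_upwards [h, hK] with t h1 h2 using h1.trans h2⟩

theorem add (hf : Dominated m g f) (hf' : Dominated m g f') :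
    Dominated m g fun t => f t + f' t := by
  obtain ⟨K, hK⟩ := hf
  obtain ⟨K', hK'⟩ := hf'
  refine ⟨K + K', ?_⟩
  filter_upwards [hK, hK'] with t h1 h2
  rw [ENNReal.coe_add, add_mul]
  exact add_le_add h1 h2

theorem const_mul {a : ℝ≥0∞} (ha : a ≠ ⊤) (hf : Dominated m g f) :
    Dominated m g fun t => a * f t := by
  obtain ⟨K, hK⟩ := hf
  refine ⟨a.toNNReal * K, ?_⟩
  filter_upwards [hK] with t h1
  rw [ENNReal.coe_mul, ENNReal.coe_toNNReal ha, mul_assoc]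
  gcongr

theorem sum {f : Fin 2 → ℝ → ℝ≥0∞} (hf : ∀ i, Dominated m g (f i)) :
    Dominated m g fun t => ∑ i, f i t := by
  simp only [Fin.sum_univ_two]
  exact (hf 0).add (hf 1)

theorem self_of_le (h : ∀ t, f t ≤ g t) : Dominated m g f :=
  ⟨1, ae_of_all _ fun t => by simpa using h t⟩

theorem const {a : ℝ≥0∞} (ha : a ≠ ⊤) (hg : ∀ t, 1 ≤ g t) : Dominated m g fun _ => a := by
  simpa using (self_of_le (f := fun _ => 1) hg).const_mul ha

theorem lintegral_lt_top (hf : Dominated m g f) (hg : ∫⁻ t, g t ∂m < ⊤) :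
    ∫⁻ t, f t ∂m < ⊤ := by
  obtain ⟨K, hK⟩ := hf
  refine (lintegral_mono_ae hK).trans_lt ?_
  rw [lintegral_const_mul' _ _ ENNReal.coe_ne_top]
  exact ENNReal.mul_lt_top ENNReal.coe_lt_top hg

/-- In each summand of the product estimate one factor is bounded in time, and the other is
dominated by g. -/
theorem divP {v : ℝ → Fin 2 → FSeries} {w : ℝ → FSeries} {C D : ℝ≥0}
    (hsol : ∀ᵐ t ∂m, IsSolenoidal (v t)) (hv2 : ∀ᵐ t ∂m, ∀ j, sobNormSq 2 (v t j) ≤ C)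
    (hv3 : ∀ j, Dominated m g fun t => sobNormSq 3 (v t j))
    (hw1 : ∀ᵐ t ∂m, sobNormSq 1 (w t) ≤ D) (hw2 : Dominated m g fun t => sobNormSq 2 (w t)) :
    Dominated m g fun t => sobNormSq 1 (CalmedMHD.divP (v t) (w t)) := by
  refine of_le (f' := fun t => 512 * (D * ∑ j, sobNormSq 3 (v t j) + 2 * C * sobNormSq 2 (w t))) ?_
    (const_mul (by simp) (((sum hv3).const_mul ENNReal.coe_ne_top).add
      (hw2.const_mul (by finiteness))))
  filter_upwards [hsol, hv2, hw1] with t h1 h2 h3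
  refine (sobNormSq_one_divP_le h1 (w t)).trans ?_
  rw [mul_comm (D : ℝ≥0∞)]
  gcongr
  rw [Fin.sum_univ_two, two_mul]
  exact add_le_add (h2 0) (h2 1)

theorem leray {v : ℝ → Fin 2 → FSeries} {s : ℝ}
    (h : ∀ j, Dominated m g fun t => sobNormSq s (v t j)) (i : Fin 2) :
    Dominated m g fun t => sobNormSq s (CalmedMHD.leray (v t) i) :=
  of_le (ae_of_all _ fun _ => sobNormSq_leray_le s _ i) ((sum h).const_mul (by simp))

theorem sobNormSq_add {c d : ℝ → FSeries} {s : ℝ} (hc : Dominated m g fun t => sobNormSq s (c t))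
    (hd : Dominated m g fun t => sobNormSq s (d t)) :
    Dominated m g fun t => sobNormSq s fun k => c t k + d t k :=
  of_le (ae_of_all _ fun t => sobNormSq_add_le s (c t) (d t)) ((hc.add hd).const_mul (by simp))

theorem sobNormSq_neg {c : ℝ → FSeries} {s : ℝ} (hc : Dominated m g fun t => sobNormSq s (c t)) :
    Dominated m g fun t => sobNormSq s fun k => -c t k :=
  of_le (ae_of_all _ fun t => (CalmedMHD.sobNormSq_neg s (c t)).le) hc

theorem sobNormSq_const_mul {c : ℝ → FSeries} {s : ℝ} (a : ℂ)
    (hc : Dominated m g fun t => sobNormSq s (c t)) :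
    Dominated m g fun t => sobNormSq s fun k => a * c t k :=
  of_le (ae_of_all _ fun t => (CalmedMHD.sobNormSq_const_mul s a (c t)).le)
    (hc.const_mul (by finiteness))

end Dominated

/-! ### Space-time bounds for the forcing, and the bootstrap for the temperature -/

namespace IsCoeffSolution

variable {ν μ κ g α T : ℝ} {ζ : ℝ → ℝ} {C : ℝ≥0} {u b : ℝ → Fin 2 → FSeries} {θ : ℝ → FSeries}

/-- The function that dominates the forcing terms. -/
def dominant (r : ℝ) (u b : ℝ → Fin 2 → FSeries) (θ : ℝ → FSeries) (t : ℝ) : ℝ≥0∞ :=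
  1 + ∑ i, sobNormSq 3 (u t i) + ∑ i, sobNormSq 3 (b t i) + sobNormSq r (θ t)

theorem meas {c : ℝ → ℂ} (hc : ContinuousOn c (Icc 0 T)) :
    AEStronglyMeasurable c (volume.restrict (Ioo 0 T)) :=
  (hc.mono Ioo_subset_Icc_self).aestronglyMeasurable measurableSet_Ioo

variable (h : IsCoeffSolution ν μ κ g α ζ T C u b θ)

include h

/-- The index r records how much regularity of the temperature is known: 1 from the construction, 2
after the first step of the bootstrap. -/
theorem lintegral_dominant {r : ℝ} (hr : ∫⁻ t in Ioo 0 T, sobNormSq r (θ t) < ⊤) :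
    ∫⁻ t in Ioo 0 T, dominant r u b θ t < ⊤ := by
  have hu : ∀ i, AEMeasurable (fun t => sobNormSq 3 (u t i)) (volume.restrict (Ioo 0 T)) :=
    fun i => aemeasurable_sobNormSq fun k => meas (h.mode_u i k).cont
  have hb : ∀ i, AEMeasurable (fun t => sobNormSq 3 (b t i)) (volume.restrict (Ioo 0 T)) :=
    fun i => aemeasurable_sobNormSq fun k => meas (h.mode_b i k).cont
  have hθ : AEMeasurable (fun t => sobNormSq r (θ t)) (volume.restrict (Ioo 0 T)) :=
    aemeasurable_sobNormSq fun k => meas (h.mode_θ k).cont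
  simp only [dominant]
  rw [lintegral_add_right' _ hθ, lintegral_add_right' _ (Finset.aemeasurable_fun_sum _ fun i _ => hb i),
    lintegral_add_right' _ (Finset.aemeasurable_fun_sum _ fun i _ => hu i),
    lintegral_finsetSum' _ fun i _ => hu i, lintegral_finsetSum' _ fun i _ => hb i]
  refine ENNReal.add_lt_top.2 ⟨ENNReal.add_lt_top.2 ⟨ENNReal.add_lt_top.2 ⟨by simp, ?_⟩, ?_⟩, hr⟩
  · exact ENNReal.sum_lt_top.2 fun i _ => h.integral_u i
  · exact ENNReal.sum_lt_top.2 fun i _ => h.integral_b i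

theorem ae_bounded : ∀ᵐ t ∂volume.restrict (Ioo 0 T), IsBoundedState C (u t) (b t) (θ t) :=
  ae_of_all _ h.bounded

omit h in
theorem dominated_u (r : ℝ) (i : Fin 2) : Dominated (volume.restrict (Ioo 0 T))
    (dominant r u b θ) fun t => sobNormSq 3 (u t i) :=
  Dominated.self_of_le fun t =>
    (Finset.single_le_sum (f := fun i => sobNormSq 3 (u t i)) (fun _ _ => zero_le)
      (Finset.mem_univ i)).trans (le_add_right (le_add_right le_add_self))

omit h in
theorem dominated_b (r : ℝ) (i : Fin 2) : Dominated (volume.restrict (Ioo 0 T))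
    (dominant r u b θ) fun t => sobNormSq 3 (b t i) :=
  Dominated.self_of_le fun t =>
    (Finset.single_le_sum (f := fun i => sobNormSq 3 (b t i)) (fun _ _ => zero_le)
      (Finset.mem_univ i)).trans (le_add_right le_add_self)

omit h in
theorem dominated_θ (r : ℝ) : Dominated (volume.restrict (Ioo 0 T))
    (dominant r u b θ) fun t => sobNormSq r (θ t) :=
  Dominated.self_of_le fun _ => le_add_self

omit h in
theorem dominated_const (r : ℝ) {a : ℝ≥0∞} (ha : a ≠ ⊤) : Dominated (volume.restrict (Ioo 0 T))
    (dominant r u b θ) fun _ => a :=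
  Dominated.const ha fun _ => le_add_right (le_add_right le_self_add)

theorem bounded_u {s : ℝ} (hs : s ≤ 2) (i : Fin 2) :
    ∀ᵐ t ∂volume.restrict (Ioo 0 T), sobNormSq s (u t i) ≤ C :=
  h.ae_bounded.mono fun _ ht => (sobNormSq_mono hs _).trans (ht.bound_u i)

theorem bounded_b {s : ℝ} (hs : s ≤ 2) (i : Fin 2) :
    ∀ᵐ t ∂volume.restrict (Ioo 0 T), sobNormSq s (b t i) ≤ C :=
  h.ae_bounded.mono fun _ ht => (sobNormSq_mono hs _).trans (ht.bound_b i)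

theorem dominated_u_low (r : ℝ) {s : ℝ} (hs : s ≤ 2) (i : Fin 2) :
    Dominated (volume.restrict (Ioo 0 T)) (dominant r u b θ) fun t => sobNormSq s (u t i) :=
  Dominated.of_le (h.bounded_u hs i) (dominated_const r ENNReal.coe_ne_top)

theorem dominated_b_low (r : ℝ) {s : ℝ} (hs : s ≤ 2) (i : Fin 2) :
    Dominated (volume.restrict (Ioo 0 T)) (dominant r u b θ) fun t => sobNormSq s (b t i) :=
  Dominated.of_le (h.bounded_b hs i) (dominated_const r ENNReal.coe_ne_top)

theorem dominated_divP_u (r : ℝ) {w : ℝ → FSeries} {D : ℝ≥0}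
    (hw1 : ∀ᵐ t ∂volume.restrict (Ioo 0 T), sobNormSq 1 (w t) ≤ D)
    (hw2 : Dominated (volume.restrict (Ioo 0 T)) (dominant r u b θ) fun t => sobNormSq 2 (w t)) :
    Dominated (volume.restrict (Ioo 0 T)) (dominant r u b θ)
      fun t => sobNormSq 1 (divP (u t) (w t)) :=
  Dominated.divP (h.ae_bounded.mono fun _ ht => ht.sol_u) (h.ae_bounded.mono fun _ ht => ht.bound_u)
    (dominated_u r) hw1 hw2

theorem dominated_divP_b (r : ℝ) {w : ℝ → FSeries} {D : ℝ≥0}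
    (hw1 : ∀ᵐ t ∂volume.restrict (Ioo 0 T), sobNormSq 1 (w t) ≤ D)
    (hw2 : Dominated (volume.restrict (Ioo 0 T)) (dominant r u b θ) fun t => sobNormSq 2 (w t)) :
    Dominated (volume.restrict (Ioo 0 T)) (dominant r u b θ)
      fun t => sobNormSq 1 (divP (b t) (w t)) :=
  Dominated.divP (h.ae_bounded.mono fun _ ht => ht.sol_b) (h.ae_bounded.mono fun _ ht => ht.bound_b)
    (dominated_b r) hw1 hw2

/-- The velocity and magnetic field are bounded in H² and square integrable in H³, so the quadratic
terms are in L²(H¹); buoyancy only needs θ in L²(H¹). -/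
theorem lintegral_forceU (i : Fin 2) : ∫⁻ t in Ioo 0 T,
    sobNormSq 1 (forceU g (u t) (b t) (θ t) i) < ⊤ := by
  refine Dominated.lintegral_lt_top ?_ (h.lintegral_dominant h.integral_θ)
  refine Dominated.sobNormSq_add (Dominated.sobNormSq_add (Dominated.sobNormSq_neg
    (Dominated.leray (fun j => ?_) i)) (Dominated.leray (fun j => ?_) i))
    (Dominated.sobNormSq_const_mul _ (Dominated.leray (fun j => ?_) i))
  · exact h.dominated_divP_u 1 (h.bounded_u (by norm_num) j) (h.dominated_u_low 1 le_rfl j)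
  · exact h.dominated_divP_b 1 (h.bounded_b (by norm_num) j) (h.dominated_b_low 1 le_rfl j)
  · fin_cases j
    · simpa [sobNormSq] using dominated_const 1 ENNReal.zero_ne_top
    · exact dominated_θ 1

theorem lintegral_forceB (i : Fin 2) : ∫⁻ t in Ioo 0 T,
    sobNormSq 1 (forceB (u t) (b t) i) < ⊤ := by
  refine Dominated.lintegral_lt_top ?_ (h.lintegral_dominant h.integral_θ)
  have := Dominated.sobNormSq_add
    (h.dominated_divP_b 1 (h.bounded_u (by norm_num) i) (h.dominated_u_low 1 le_rfl i))
    (Dominated.sobNormSq_neg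
      (h.dominated_divP_u 1 (h.bounded_b (by norm_num) i) (h.dominated_b_low 1 le_rfl i)))
  simp only [← sub_eq_add_neg] at this
  exact this

theorem lintegral_forced_u (i : Fin 2) : ∫⁻ t in Ioo 0 T,
    sobNormSq (2 - 1) (fun k => forceU g (u t) (b t) (θ t) i k + ν * u t i k) < ⊤ := by
  have hU := h.lintegral_forceU i
  have hdom : Dominated (volume.restrict (Ioo 0 T))
      (fun t => sobNormSq 1 (forceU g (u t) (b t) (θ t) i) + 1)
      fun t => sobNormSq 1 (fun k => forceU g (u t) (b t) (θ t) i k + ν * u t i k) := by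
    refine Dominated.sobNormSq_add (Dominated.self_of_le fun _ => le_self_add)
      (Dominated.sobNormSq_const_mul _ (Dominated.of_le (h.bounded_u (by norm_num) i)
        (Dominated.const ENNReal.coe_ne_top fun _ => le_add_self)))
  norm_num only
  refine hdom.lintegral_lt_top ?_
  rw [lintegral_add_right _ measurable_const]
  exact ENNReal.add_lt_top.2 ⟨hU, by simp⟩

theorem lintegral_forced_b (i : Fin 2) : ∫⁻ t in Ioo 0 T,
    sobNormSq (2 - 1) (fun k => forceB (u t) (b t) i k + μ * b t i k) < ⊤ := by
  have hB := h.lintegral_forceB i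
  have hdom : Dominated (volume.restrict (Ioo 0 T))
      (fun t => sobNormSq 1 (forceB (u t) (b t) i) + 1)
      fun t => sobNormSq 1 (fun k => forceB (u t) (b t) i k + μ * b t i k) := by
    refine Dominated.sobNormSq_add (Dominated.self_of_le fun _ => le_self_add)
      (Dominated.sobNormSq_const_mul _ (Dominated.of_le (h.bounded_b (by norm_num) i)
        (Dominated.const ENNReal.coe_ne_top fun _ => le_add_self)))
  norm_num only
  refine hdom.lintegral_lt_top ?_
  rw [lintegral_add_right _ measurable_const]
  exact ENNReal.add_lt_top.2 ⟨hB, by simp⟩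

theorem tendsto_u (hν : 0 < ν) (i : Fin 2) (h0 : sobNormSq 2 (u 0 i) < ⊤) {t₀ : ℝ}
    (ht₀ : t₀ ∈ Icc 0 T) :
    Tendsto (fun t => sobNormSq 2 (u t i - u t₀ i)) (𝓝[Icc 0 T] t₀) (𝓝 0) :=
  tendsto_sobNormSq_of_mode (c := fun t => u t i) hν (fun k => h.mode_u i k) h0
    (h.lintegral_forced_u i) ht₀

theorem tendsto_b (hμ : 0 < μ) (i : Fin 2) (h0 : sobNormSq 2 (b 0 i) < ⊤) {t₀ : ℝ}
    (ht₀ : t₀ ∈ Icc 0 T) :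
    Tendsto (fun t => sobNormSq 2 (b t i - b t₀ i)) (𝓝[Icc 0 T] t₀) (𝓝 0) :=
  tendsto_sobNormSq_of_mode (c := fun t => b t i) hμ (fun k => h.mode_b i k) h0
    (h.lintegral_forced_b i) ht₀

/-- First step of the bootstrap: transport by an H² field maps H¹ to L², and the heating is bounded
in L² by calming. -/
theorem lintegral_forceT_zero {M : ℝ} {L : ℝ≥0} (hM : ∀ x, |ζ x| ≤ M) (hL : LipschitzWith L ζ) :
    ∫⁻ t in Ioo 0 T, sobNormSq 0 (fun k => forceT α μ ζ (u t) (b t) (θ t) k + κ * θ t k) < ⊤ := by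
  refine Dominated.lintegral_lt_top ?_ (h.lintegral_dominant h.integral_θ)
  refine Dominated.sobNormSq_add (Dominated.sobNormSq_add (Dominated.sobNormSq_neg ?_)
    (Dominated.sobNormSq_const_mul _ ?_)) (Dominated.sobNormSq_const_mul _ ?_)
  · refine Dominated.of_le (f' := fun t => 128 * (2 * C) * sobNormSq 1 (θ t)) ?_
      ((dominated_θ 1).const_mul (by finiteness))
    filter_upwards [h.ae_bounded] with t ht
    rw [sobNormSq_zero_eq]
    refine (tsum_sq_divP_le ht.sol_u _).trans ?_
    gcongr
    rw [Fin.sum_univ_two, two_mul]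
    exact add_le_add (ht.bound_u 0) (ht.bound_u 1)
  · refine Dominated.of_le (f' := fun t => ENNReal.ofReal M ^ 2 * (4 * C)) ?_
      (dominated_const 1 (by finiteness))
    filter_upwards [h.ae_bounded] with t ht
    rw [sobNormSq_zero_eq]
    refine (tsum_sq_heatCoeff_le hM hL (isRealValued_curlCoeff ht.real_b)
      (ht.sq_curl.trans_lt (by finiteness))).trans ?_
    gcongr
    exact ht.sq_curl
  · exact Dominated.of_le (ae_of_all _ fun t => sobNormSq_mono zero_le_one _) (dominated_θ 1)

theorem θ_one {M : ℝ} {L : ℝ≥0} (hM : ∀ x, |ζ x| ≤ M) (hL : LipschitzWith L ζ) (hκ : 0 < κ)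
    (h0 : sobNormSq 1 (θ 0) < ⊤) : (∃ D : ℝ≥0, ∀ t ∈ Icc 0 T, sobNormSq 1 (θ t) ≤ D) ∧
      ∫⁻ t in Ioo 0 T, sobNormSq 2 (θ t) < ⊤ := by
  have hF := h.lintegral_forceT_zero hM hL
  have hA : sobNormSq 1 (θ 0) + ENNReal.ofReal κ⁻¹ * ∫⁻ t in Ioo 0 T,
      sobNormSq (1 - 1) (fun k => forceT α μ ζ (u t) (b t) (θ t) k + κ * θ t k) < ⊤ := by
    rw [sub_self]
    finiteness
  refine ⟨⟨_, fun t ht => (sobNormSq_le_of_mode hκ h.mode_θ 1 ht).trans_eq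
    (ENNReal.coe_toNNReal hA.ne).symm⟩, ?_⟩
  have := (lintegral_sobNormSq_le_of_mode hκ h.mode_θ 1).trans_lt hA
  rw [one_add_one_eq_two] at this
  exact ENNReal.lt_top_of_mul_ne_top_right this.ne (by simpa using hκ)

/-- Second step: θ, now in L^∞(H¹) ∩ L²(H²), puts the transport term in L²(H¹), and the heating is
there thanks to the H³ integrability of b. -/
theorem lintegral_forceT_one {M : ℝ} {L : ℝ≥0} (hM : ∀ x, |ζ x| ≤ M) (hL : LipschitzWith L ζ)
    {D : ℝ≥0} (h1 : ∀ t ∈ Icc 0 T, sobNormSq 1 (θ t) ≤ D)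
    (h2 : ∫⁻ t in Ioo 0 T, sobNormSq 2 (θ t) < ⊤) :
    ∫⁻ t in Ioo 0 T,
      sobNormSq (2 - 1) (fun k => forceT α μ ζ (u t) (b t) (θ t) k + κ * θ t k) < ⊤ := by
  norm_num only
  refine Dominated.lintegral_lt_top ?_ (h.lintegral_dominant h2)
  have h1' : ∀ᵐ t ∂volume.restrict (Ioo 0 T), sobNormSq 1 (θ t) ≤ D :=
    (ae_restrict_mem measurableSet_Ioo).mono fun t ht => h1 t (Ioo_subset_Icc_self ht)
  refine Dominated.sobNormSq_add (Dominated.sobNormSq_add (Dominated.sobNormSq_neg ?_)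
    (Dominated.sobNormSq_const_mul _ ?_)) (Dominated.sobNormSq_const_mul _ ?_)
  · exact h.dominated_divP_u 2 h1' (dominated_θ 2)
  · refine Dominated.of_le (f' := fun t => (4 * C) * (2 * (ENNReal.ofReal M ^ 2 +
      (L ^ 2 * 128) * ∑ i, sobNormSq 3 (b t i)))) ?_
      (Dominated.const_mul (by finiteness) (Dominated.const_mul (by finiteness)
        ((dominated_const 2 (by finiteness)).add
          ((Dominated.sum (dominated_b 2)).const_mul (by finiteness)))))
    have h3 : ∀ᵐ t ∂volume.restrict (Ioo 0 T), ∀ i, sobNormSq 3 (b t i) < ⊤ :=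
      ae_all_iff.2 fun i => ae_lt_top'
        (aemeasurable_sobNormSq fun k => meas (h.mode_b i k).cont) (h.integral_b i).ne
    filter_upwards [h.ae_bounded, h3] with t ht ht3
    refine (sobNormSq_one_heatCoeff_curl_le hM hL ht.real_b ht3).trans ?_
    rw [mul_comm, mul_assoc ((L : ℝ≥0∞) ^ 2)]
    gcongr
    exact ht.sobNormSq_curl
  · exact Dominated.of_le h1' (dominated_const 2 ENNReal.coe_ne_top)

theorem θ_two {M : ℝ} {L : ℝ≥0} (hM : ∀ x, |ζ x| ≤ M) (hL : LipschitzWith L ζ) (hκ : 0 < κ)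
    (h0 : sobNormSq 2 (θ 0) < ⊤) : (∃ D : ℝ≥0, ∀ t ∈ Icc 0 T, sobNormSq 2 (θ t) ≤ D) ∧
      ∫⁻ t in Ioo 0 T, sobNormSq 3 (θ t) < ⊤ ∧ ∀ t₀ ∈ Icc 0 T,
      Tendsto (fun t => sobNormSq 2 (θ t - θ t₀)) (𝓝[Icc 0 T] t₀) (𝓝 0) := by
  obtain ⟨⟨D, hD⟩, h2⟩ := h.θ_one hM hL hκ ((sobNormSq_mono (by norm_num) _).trans_lt h0)
  have hF := h.lintegral_forceT_one hM hL hD h2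
  have hA : sobNormSq 2 (θ 0) + ENNReal.ofReal κ⁻¹ * ∫⁻ t in Ioo 0 T,
      sobNormSq (2 - 1) (fun k => forceT α μ ζ (u t) (b t) (θ t) k + κ * θ t k) < ⊤ := by
    finiteness
  refine ⟨⟨_, fun t ht => (sobNormSq_le_of_mode hκ h.mode_θ 2 ht).trans_eq
    (ENNReal.coe_toNNReal hA.ne).symm⟩, ?_, fun t₀ ht₀ =>
    tendsto_sobNormSq_of_mode hκ h.mode_θ h0 hF ht₀⟩
  have := (lintegral_sobNormSq_le_of_mode hκ h.mode_θ 2).trans_lt hA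
  rw [two_add_one_eq_three] at this
  exact ENNReal.lt_top_of_mul_ne_top_right this.ne (by simpa using hκ)

end IsCoeffSolution

end CalmedMHD

end

noncomputable section

namespace CalmedMHD

/-! ### Nonlinear terms of `L²` functions -/

/-- In H¹ the multiplied coefficients are square summable and have the symmetry of a real function,
so the derivative is genuine and not the default value. -/
theorem exists_hasWeakPDeriv {f : L2} (hf : sobNormSq 1 (coeff f) < ⊤) (j : Fin 2) :
    HasWeakPDeriv j f (pderiv j f) := by
  have hs : ∑' k : Fin 2 → ℤ, ‖(2 * Real.pi * Complex.I * (k j : ℂ)) * coeff f k‖ₑ ^ 2 < ⊤ := by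
    refine (ENNReal.tsum_le_tsum fun k => ?_).trans_lt hf
    rw [Real.rpow_one, enorm_sq_eq, enorm_sq_eq,
      ← ENNReal.ofReal_mul (zero_le_one.trans (one_le_one_add_lapSymbol k)), norm_mul, mul_pow]
    refine ENNReal.ofReal_le_ofReal (mul_le_mul_of_nonneg_right ?_ (sq_nonneg _))
    have h1 := two_pi_abs_le_freq k j
    have h2 : ‖2 * Real.pi * Complex.I * (k j : ℂ)‖ = 2 * Real.pi * |(k j : ℝ)| := by
      simp [abs_of_pos Real.pi_pos]
    rw [h2]
    calc (2 * Real.pi * |(k j : ℝ)|) ^ 2 ≤ freq k ^ 2 := by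
          have := Real.pi_pos
          gcongr
      _ ≤ 1 + lapSymbol k := by rw [freq_sq]; linarith
  have hr : IsRealValued fun k : Fin 2 → ℤ =>
      (2 * Real.pi * Complex.I * (k j : ℂ)) * coeff f k := fun k => by
    have := isRealValued_fnCoeff (f : Torus → ℝ) k
    rw [fnCoeff_coeFn] at this
    simp only [this, Pi.neg_apply, map_mul, Complex.conj_I, Complex.conj_ofReal, map_ofNat,
      map_intCast, Int.cast_neg]
    ring
  obtain ⟨G, hG⟩ := exists_coeff_eq hr hs
  have hd : HasWeakPDeriv j f G := fun k => congrFun hG k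
  rwa [pderiv_eq hd]

/-- Stated for integrable functions, because products of L² functions are in general no better. -/
theorem fnCoeff_add {F G : Torus → ℝ} (hF : Integrable F torusMeasure)
    (hG : Integrable G torusMeasure) (k : Fin 2 → ℤ) :
    fnCoeff (fun x => F x + G x) k = fnCoeff F k + fnCoeff G k := by
  have key : ∀ {F : Torus → ℝ}, Integrable F torusMeasure →
      Integrable (fun x => UnitAddTorus.mFourier (-k) x * ((F x : ℝ) : ℂ)) torusMeasure :=
    fun hF => hF.ofReal.bdd_mul (c := 1) (ContinuousMap.continuous _).aestronglyMeasurable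
      (ae_of_all _ fun x => (ContinuousMap.norm_coe_le_norm _ x).trans
        UnitAddTorus.mFourier_norm.le)
  simp only [fnCoeff, UnitAddTorus.mFourierCoeff, smul_eq_mul]
  refine Eq.trans ?_ (integral_add (key hF) (key hG))
  exact integral_congr_ae (ae_of_all _ fun x => by push_cast; ring)

/-- The convolution formula for products yields the form with the derivative on f, which equals the
divergence form by solenoidality. -/
theorem fnCoeff_advect {v : Fin 2 → L2} (hv : IsSolenoidal (vcoeff v)) {f : L2}
    (hf : sobNormSq 1 (coeff f) < ⊤) :
    fnCoeff (advect v f) = divP (vcoeff v) (coeff f) := by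
  funext k
  have hL : ∀ f : L2, MemLp f 2 torusMeasure := fun f => Lp.memLp f
  have hmul : ∀ j, HasSum (fun l => coeff (v j) l * coeff (pderiv j f) (k - l))
      (fnCoeff (fun x => v j x * pderiv j f x) k) := fun j => fnCoeff_mul (hL _) (hL _) k
  have hint : ∀ j, Integrable (fun x => v j x * pderiv j f x) torusMeasure := fun j =>
    (hL (v j)).integrable_mul (hL (pderiv j f))
  have h1 : fnCoeff (advect v f) k = ∑ j, fnCoeff (fun x => v j x * pderiv j f x) k := by
    have : advect v f = fun x => v 0 x * pderiv 0 f x + v 1 x * pderiv 1 f x :=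
      funext fun x => Fin.sum_univ_two _
    rw [this, Fin.sum_univ_two]
    exact fnCoeff_add (hint 0) (hint 1) k
  rw [h1, divP_eq_tsum_sub hv]
  refine ((hasSum_sum fun j _ => hmul j).congr_fun fun l => ?_).tsum_eq.symm
  simp only [dotSymbol, Finset.sum_mul]
  refine Finset.sum_congr rfl fun j _ => ?_
  rw [exists_hasWeakPDeriv hf j (k - l)]
  simp only [vcoeff]
  ring

/-- An L² function is determined by its coefficients, so the function synthesised from the
coefficients of the curl is the curl itself. -/
theorem fnCoeff_ohmic (ζ : ℝ → ℝ) {b : Fin 2 → L2} (hb : ∀ i, sobNormSq 1 (vcoeff b i) < ⊤) :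
    fnCoeff (ohmic ζ b) = heatCoeff ζ (curlCoeff (vcoeff b)) := by
  have hc : coeff (pderiv 0 (b 1) - pderiv 1 (b 0)) = curlCoeff (vcoeff b) := by
    funext k
    rw [coeff_sub, exists_hasWeakPDeriv (hb 1) 0 k, exists_hasWeakPDeriv (hb 0) 1 k]
    rfl
  have hs : synth (curlCoeff (vcoeff b)) = pderiv 0 (b 1) - pderiv 1 (b 0) := by
    refine coeff_injective ?_
    rw [← hc]
    exact coeff_synth (isRealValued_fnCoeff _) (tsum_sq_coeff_lt_top _)
  refine fnCoeff_congr_ae ?_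
  rw [hs]
  filter_upwards [Lp.coeFn_sub (pderiv 0 (b 1)) (pderiv 1 (b 0))] with x hx
  simp only [ohmic, heatProfile, curl, hx, Pi.sub_apply]

/-! ### Time derivatives -/

theorem memL2Hs_of_lintegral {T s : ℝ} {c : ℝ → FSeries} (hm : CurveMeasurable T c)
    (hr : ∀ᵐ t ∂volume.restrict (Ioo 0 T), IsRealValued (c t))
    (hi : ∫⁻ t in Ioo 0 T, sobNormSq s (c t) < ⊤) : MemL2Hs T s c := by
  refine ⟨hm, ?_, hi⟩
  filter_upwards [hr, ae_lt_top' (aemeasurable_sobNormSq hm) hi.ne] with t h1 h2 using ⟨h1, h2⟩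

/-- The right-hand side of the mode equation equals (h + κc) - κ(1 + l)c, and the second term is
controlled by the H² norm. -/
theorem lintegral_modeDeriv_lt_top {T κ : ℝ} {c h : ℝ → FSeries}
    (hc : ∀ k, AEStronglyMeasurable (fun t => c t k) (volume.restrict (Ioo 0 T)))
    (hh : ∫⁻ t in Ioo 0 T, sobNormSq 0 (fun k => h t k + κ * c t k) < ⊤)
    (h2 : ∫⁻ t in Ioo 0 T, sobNormSq 2 (c t) < ⊤) :
    ∫⁻ t in Ioo 0 T, sobNormSq 0 (fun k => -(κ * lapSymbol k) * c t k + h t k) < ⊤ := by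
  have key : ∀ t, sobNormSq 0 (fun k => -(κ * lapSymbol k) * c t k + h t k) ≤
      2 * (sobNormSq 0 (fun k => h t k + κ * c t k) + ‖(κ : ℂ)‖ₑ ^ 2 * sobNormSq 2 (c t)) := by
    intro t
    have h1 : sobNormSq 0 (fun k => (κ : ℂ) * (((1 + lapSymbol k : ℝ) : ℂ) * c t k)) =
        ‖(κ : ℂ)‖ₑ ^ 2 * sobNormSq 2 (c t) := by
      rw [sobNormSq_const_mul, sobNormSq_zero_eq, sobNormSq]
      congr 1
      refine tsum_congr fun k => ?_
      have hk : 0 ≤ 1 + lapSymbol k := zero_le_one.trans (one_le_one_add_lapSymbol k)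
      rw [enorm_mul, mul_pow, enorm_sq_eq, Complex.norm_of_nonneg hk, Real.rpow_ofNat]
    rw [← h1]
    convert sobNormSq_sub_le 0 (fun k => h t k + κ * c t k)
      (fun k => (κ : ℂ) * (((1 + lapSymbol k : ℝ) : ℂ) * c t k)) using 2
    funext k
    simp only [Pi.sub_apply]
    push_cast
    ring
  refine (lintegral_mono key).trans_lt ?_
  rw [lintegral_const_mul' _ _ (by simp),
    lintegral_add_right' _ ((aemeasurable_sobNormSq hc).const_mul _),
    lintegral_const_mul' _ _ (by finiteness)]
  finiteness

theorem isRealValued_modeDeriv (κ : ℝ) {c h : FSeries} (hc : IsRealValued c)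
    (hh : IsRealValued h) : IsRealValued fun k => -(κ * lapSymbol k) * c k + h k := fun k => by
  simp [hc k, hh k, lapSymbol_neg]

theorem isSolenoidal_modeDeriv (κ : ℝ) {c h : Fin 2 → FSeries} (hc : IsSolenoidal c)
    (hh : IsSolenoidal h) : IsSolenoidal fun i k => -(κ * lapSymbol k) * c i k + h i k :=
  (hc.const_mul fun k => -(κ * lapSymbol k)).add hh

theorem tendsto_sobNormSq_mono {r s : ℝ} (h : r ≤ s) {l : Filter ℝ} {f : ℝ → FSeries}
    (hf : Tendsto (fun t => sobNormSq s (f t)) l (𝓝 0)) :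
    Tendsto (fun t => sobNormSq r (f t)) l (𝓝 0) :=
  tendsto_of_tendsto_of_tendsto_of_le_of_le tendsto_const_nhds hf (fun _ => zero_le)
    fun _ => sobNormSq_mono h _

theorem MemCHs.mono {T r s : ℝ} {c : ℝ → FSeries} (hc : MemCHs T s c) (h : r ≤ s) :
    MemCHs T r c :=
  ⟨fun t ht => ⟨(hc.1 t ht).1, (sobNormSq_mono h _).trans_lt (hc.1 t ht).2⟩,
    fun t₀ ht₀ => tendsto_sobNormSq_mono h (hc.2 t₀ ht₀)⟩

theorem MemL2Hs.mono {T r s : ℝ} {c : ℝ → FSeries} (hc : MemL2Hs T s c) (h : r ≤ s) :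
    MemL2Hs T r c :=
  ⟨hc.1, hc.2.1.mono fun _ ht => ⟨ht.1, (sobNormSq_mono h _).trans_lt ht.2⟩,
    (lintegral_mono fun _ => sobNormSq_mono h _).trans_lt hc.2.2⟩

end CalmedMHD

end

/-! ### The existence theorem -/

open CalmedMHD

theorem mainTheorem2 (ν μ κ g α : ℝ) (hν : 0 < ν) (hμ : 0 < μ) (hκ : 0 < κ) (hg : 0 < g)
    (ε : ℝ) (hε : 0 < ε) (ζ : ℝ → ℝ) (hζ : IsCalming ε ζ)
    (T : ℝ) (hT : 0 < T) (u₀ b₀ : Fin 2 → L2) (θ₀ : L2)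
    (hu₀ : MemVs 2 (vcoeff u₀)) (hb₀ : MemVs 2 (vcoeff b₀)) (hθ₀ : MemHs 2 (coeff θ₀)) :
    ∃ (u b : ℝ → Fin 2 → L2) (θ : ℝ → L2),
      IsStrongSolution ν μ κ g α ζ T u₀ b₀ θ₀ u b θ := by
  obtain ⟨L, hL⟩ := hζ.lipschitz
  obtain ⟨M, -, hM⟩ := hζ.exists_bound
  obtain ⟨C, u, b, θ, hu0, hb0, hθ0, h⟩ :=
    exists_coeff_solution hM hL hν hμ hκ hg hT α hu₀ hb₀ hθ₀
  have hCt : (C : ℝ≥0∞) < ⊤ := ENNReal.coe_lt_top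
  obtain ⟨⟨D, hD⟩, hθ3, hθc⟩ := h.θ_two hM hL hκ (by rw [hθ0]; exact hθ₀.2)
  have hcu : ∀ t, vcoeff (fun i => synth (u t i)) = u t := fun t => funext fun i =>
    coeff_synth ((h.bounded t).real_u i) (((h.bounded t).sq_u i).trans_lt hCt)
  have hcb : ∀ t, vcoeff (fun i => synth (b t i)) = b t := fun t => funext fun i =>
    coeff_synth ((h.bounded t).real_b i) (((h.bounded t).sq_b i).trans_lt hCt)
  have hcθ : ∀ t, coeff (synth (θ t)) = θ t := fun t =>
    coeff_synth (h.bounded t).real_θ ((h.bounded t).bound_θ.trans_lt hCt)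
  have hmu : ∀ i, CurveMeasurable T fun t => u t i := fun i k =>
    IsCoeffSolution.meas (h.mode_u i k).cont
  have hmb : ∀ i, CurveMeasurable T fun t => b t i := fun i k =>
    IsCoeffSolution.meas (h.mode_b i k).cont
  have hmθ : CurveMeasurable T θ := fun k => IsCoeffSolution.meas (h.mode_θ k).cont
  have hmem : ∀ᵐ t ∂volume.restrict (Ioo 0 T), t ∈ Icc 0 T :=
    (ae_restrict_mem measurableSet_Ioo).mono fun t ht => Ioo_subset_Icc_self ht
  have hCu : ∀ i, MemCHs T 2 fun t => u t i := fun i =>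
    ⟨fun t _ => ⟨(h.bounded t).real_u i, ((h.bounded t).bound_u i).trans_lt hCt⟩,
      fun t₀ ht₀ => h.tendsto_u hν i (((h.bounded 0).bound_u i).trans_lt hCt) ht₀⟩
  have hCb : ∀ i, MemCHs T 2 fun t => b t i := fun i =>
    ⟨fun t _ => ⟨(h.bounded t).real_b i, ((h.bounded t).bound_b i).trans_lt hCt⟩,
      fun t₀ ht₀ => h.tendsto_b hμ i (((h.bounded 0).bound_b i).trans_lt hCt) ht₀⟩
  have hCθ : MemCHs T 2 θ :=
    ⟨fun t ht => ⟨(h.bounded t).real_θ, (hD t ht).trans_lt ENNReal.coe_lt_top⟩, hθc⟩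
  have hLu : ∀ i, MemL2Hs T 3 fun t => u t i := fun i => memL2Hs_of_lintegral (hmu i)
    (ae_of_all _ fun t => (h.bounded t).real_u i) (h.integral_u i)
  have hLb : ∀ i, MemL2Hs T 3 fun t => b t i := fun i => memL2Hs_of_lintegral (hmb i)
    (ae_of_all _ fun t => (h.bounded t).real_b i) (h.integral_b i)
  have hLθ : MemL2Hs T 3 θ := memL2Hs_of_lintegral hmθ
    (ae_of_all _ fun t => (h.bounded t).real_θ) hθ3
  have hu1 : ∀ t i, sobNormSq 1 (u t i) < ⊤ := fun t i =>
    (sobNormSq_mono (by norm_num) _).trans_lt (((h.bounded t).bound_u i).trans_lt hCt)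
  have hb1 : ∀ t i, sobNormSq 1 (b t i) < ⊤ := fun t i =>
    (sobNormSq_mono (by norm_num) _).trans_lt (((h.bounded t).bound_b i).trans_lt hCt)
  have hadv : ∀ {v w : Fin 2 → L2}, IsSolenoidal (vcoeff v) →
      (∀ i, sobNormSq 1 (vcoeff w i) < ⊤) → vadvect v w = fun i => divP (vcoeff v) (vcoeff w i) :=
    fun hv hw => funext fun i => fnCoeff_advect hv (hw i)
  have hlow : ∀ {c : ℝ → FSeries}, ∫⁻ t in Ioo 0 T, sobNormSq (2 - 1) (c t) < ⊤ →
      ∫⁻ t in Ioo 0 T, sobNormSq 0 (c t) < ⊤ := fun hc =>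
    (lintegral_mono fun _ => sobNormSq_mono (by norm_num) _).trans_lt hc
  refine ⟨fun t i => synth (u t i), fun t i => synth (b t i), fun t => synth (θ t), ?_⟩
  refine
    { u_cont := ?_, b_cont := ?_, θ_cont := ?_, u_L2 := ?_, b_L2 := ?_, θ_L2 := ?_,
      u_init := ?_, b_init := ?_, θ_init := ?_, u_eq := ?_, b_eq := ?_, θ_eq := ?_,
      u_cont_H2 := ?_, b_cont_H2 := ?_, u_L2_H3 := ?_, b_L2_H3 := ?_, θ_Linfty_H2 := ?_,
      θ_L2_H3 := ?_ }
  -- Synthesis followed by taking coefficients is the identity here, so the requirements on Sobolev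
  -- norms become statements about the coefficient solution.
  all_goals try simp only [hcu, hcb, hcθ]
  · exact ⟨fun i => (hCu i).mono (by norm_num), fun t _ => (h.bounded t).sol_u⟩
  · exact ⟨fun i => (hCb i).mono (by norm_num), fun t _ => (h.bounded t).sol_b⟩
  · exact hCθ.mono (by norm_num)
  · exact ⟨fun i => (hLu i).mono (by norm_num), ae_of_all _ fun t => (h.bounded t).sol_u⟩
  · exact ⟨fun i => (hLb i).mono (by norm_num), ae_of_all _ fun t => (h.bounded t).sol_b⟩
  · exact hLθ.mono (by norm_num)
  · exact funext fun i => coeff_injective (congrFun ((hcu 0).trans hu0) i)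
  · exact funext fun i => coeff_injective (congrFun ((hcb 0).trans hb0) i)
  · exact coeff_injective ((hcθ 0).trans hθ0)
  -- The time derivative is the right-hand side of the mode equations, square integrable because u
  -- is in L²(H³) and the forcing in L²(H¹).
  · refine ⟨fun t i k => -(ν * lapSymbol k) * u t i k + forceU g (u t) (b t) (θ t) i k,
      ⟨fun i => memL2Hs_of_lintegral (fun k => ((hmu i k).const_mul _).add (h.mode_u i k).meas)
        (ae_of_all _ fun t => isRealValued_modeDeriv ν ((h.bounded t).real_u i)
          (isRealValued_forceU g (h.bounded t).real_u (h.bounded t).real_b (h.bounded t).real_θ i))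
        (lintegral_modeDeriv_lt_top (hmu i) (hlow (h.lintegral_forced_u i))
          ((hLu i).mono (by norm_num)).2.2),
        ae_of_all _ fun t => isSolenoidal_modeDeriv ν (h.bounded t).sol_u
          (isSolenoidal_forceU _ _ _ _)⟩,
      fun i φ hφ hc hs k => (h.mode_u i k).weak φ hφ hc hs, ae_of_all _ fun t i k => ?_⟩
    rw [hadv (by rw [hcu]; exact (h.bounded t).sol_u) (by rw [hcu]; exact hu1 t),
      hadv (by rw [hcb]; exact (h.bounded t).sol_b) (by rw [hcb]; exact hb1 t), hcu, hcb, buoyancy,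
      hcθ]
    simp only [forceU]
    ring
  · refine ⟨fun t i k => -(μ * lapSymbol k) * b t i k + forceB (u t) (b t) i k,
      ⟨fun i => memL2Hs_of_lintegral (fun k => ((hmb i k).const_mul _).add (h.mode_b i k).meas)
        (ae_of_all _ fun t => isRealValued_modeDeriv μ ((h.bounded t).real_b i)
          (isRealValued_forceB (h.bounded t).real_u (h.bounded t).real_b i))
        (lintegral_modeDeriv_lt_top (hmb i) (hlow (h.lintegral_forced_b i))
          ((hLb i).mono (by norm_num)).2.2),
        ae_of_all _ fun t => isSolenoidal_modeDeriv μ (h.bounded t).sol_b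
          (isSolenoidal_induction (fun i => ((h.bounded t).sq_u i).trans_lt hCt)
            fun i => ((h.bounded t).sq_b i).trans_lt hCt)⟩,
      fun i φ hφ hc hs k => (h.mode_b i k).weak φ hφ hc hs, ae_of_all _ fun t i k => ?_⟩
    rw [hadv (by rw [hcu]; exact (h.bounded t).sol_u) (by rw [hcb]; exact hb1 t),
      hadv (by rw [hcb]; exact (h.bounded t).sol_b) (by rw [hcu]; exact hu1 t), hcu, hcb]
    simp only [forceB]
    ring
  · refine ⟨fun t k => -(κ * lapSymbol k) * θ t k + forceT α μ ζ (u t) (b t) (θ t) k,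
      -- The derivative of θ is even in L²(L²); the concluding `mono` lowers the order to -1.
      (memL2Hs_of_lintegral (fun k => ((hmθ k).const_mul _).add (h.mode_θ k).meas)
        (ae_of_all _ fun t => isRealValued_modeDeriv κ (h.bounded t).real_θ
          (isRealValued_forceT α μ ζ (h.bounded t).real_u (h.bounded t).real_θ))
        (lintegral_modeDeriv_lt_top hmθ (h.lintegral_forceT_zero hM hL)
          (hLθ.mono (by norm_num)).2.2)).mono (by norm_num),
      fun φ hφ hc hs k => (h.mode_θ k).weak φ hφ hc hs, ?_⟩
    -- Membership of t in [0, T] is needed because the H¹ bound on θ comes from the bootstrap, which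
    -- is confined to that interval.
    filter_upwards [hmem] with t ht k
    rw [fnCoeff_advect (by rw [hcu]; exact (h.bounded t).sol_u)
      (by rw [hcθ]; exact (sobNormSq_mono (by norm_num) _).trans_lt (hCθ.1 t ht).2),
      fnCoeff_ohmic ζ (by rw [hcb]; exact hb1 t), hcu, hcb, hcθ, forceT]
    ring
  · exact ⟨hCu, fun t _ => (h.bounded t).sol_u⟩
  · exact ⟨hCb, fun t _ => (h.bounded t).sol_b⟩
  · exact ⟨hLu, ae_of_all _ fun t => (h.bounded t).sol_u⟩
  · exact ⟨hLb, ae_of_all _ fun t => (h.bounded t).sol_b⟩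
  · refine ⟨hmθ, ?_, D, ?_⟩
    · filter_upwards [hmem] with t ht using hCθ.1 t ht
    · filter_upwards [hmem] with t ht using hD t ht
  · exact hLθ
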